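/- **Setting.** Let $L^2(S^1)$ be taken with respect to arc length, let $M(f)$ denote multiplication by $f$, let $H^2(S^1)\subset L^2(S^1)$ be the closed span of $\{z^n : n\ge 0\}$ with orthogonal projection $P$, and let $T_f = P M(f)|_{H^2(S^1)}$ be the Toeplitz operator with symbol $f\in C(S^1)$. Let $\mathcal T$ be the C*-algebra on $H^2(S^1)$ generated by all $T_f$, and let $\sigma:\mathcal T\to C(S^1)$ be the symbol map, i.e. the unique $*$-homomorphism with $\sigma(T_f)=f$ and $\ker\sigma=\mathcal K(H^2(S^1))$. Let $C_0(S^1)=\{f\in C(S^1): f(1)=0\}$, $\mathcal T_0=\sigma^{-1}(C_0(S^1))$, and $\overline{\mathcal T}_0=\mathcal T_0+\mathcal K(L^2(S^1))\subset \mathbb B(L^2(S^1))$, where operators on $H^2(S^1)$ are extended by $0$ on its orthogonal complement. Let $\overline\sigma:\overline{\mathcal T}_0\to C_0(S^1)$ be the unique $*$-homomorphism that extends $\sigma|_{\mathcal T_0}$ and has kernel $\mathcal K(L^2(S^1))$. Let $C^*(\mathbb R)$ be the group C*-algebra of $\mathbb R$ (the completion of $L^1(\mathbb R)$ in the universal C*-norm),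 let $\lambda$ be its regular representation on $L^2(\mathbb R)$, the integrated form of translation $(\lambda_t\xi)(x)=\xi(x-t)$, and let $f\mapsto\widehat f$, $C_0(\mathbb R)\to C^*(\mathbb R)$, be the unique $*$-isomorphism extending the Fourier transform $\widehat f(s)=\int_{\mathbb R} f(t)e^{-2\pi i st}\,dt$ (for $f\in C_0(\mathbb R)\cap L^1(\mathbb R)$ with $\widehat f\in L^1(\mathbb R)$). Let $C_0(\mathbb R\cup\{+\infty\})$ be the continuous functions on the extended line $(-\infty,+\infty]$ that vanish at $-\infty$, acting on $L^2(\mathbb R)$ by multiplication operators $M(f)$. The Wiener–Hopf algebra $\mathcal T_{\mathbb R}$ is the C*-algebra on $L^2(\mathbb R)$ generated by the products $M(f)\lambda(g)$ with $f\in C_0(\mathbb R\cup\{+\infty\})$ and $g\in C^*(\mathbb R)$. Let $w(t)=\frac{t-i}{t+i}$ be the Cayley transform, let $W:L^2(S^1)\to L^2(\mathbb R)$ be the Hilbert space isomorphism $(W\xi)(t)=\frac{\sqrt2}{t+i}\,\xi(w(t))$, and let $U:L^2(\mathbb R)\to L^2(\mathbb R)$ be the Fourier transform $(U\xi)(s)=\int\xi(t)e^{-2\pi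 i st}\,dt$, extended by continuity from $L^1\cap L^2$. Write $\mathrm{Ad}_U\circ\mathrm{Ad}_W(B)=UWBW^{-1}U^{-1}$. **Theorem.** The maps $\sigma$, $\overline\sigma$ and $f\mapsto\widehat f$ above exist and are unique, $\overline\sigma$ is surjective, and $\mathrm{Ad}_U\circ\mathrm{Ad}_W$ carries $\overline{\mathcal T}_0$ onto $\mathcal T_{\mathbb R}$ and $\mathcal K(L^2(S^1))$ onto $\mathcal K(L^2(\mathbb R))$. Consequently there is a unique $*$-homomorphism $\sigma_{\mathbb R}:\mathcal T_{\mathbb R}\to C^*(\mathbb R)$ such that $$\sigma_{\mathbb R}\bigl(UWBW^{-1}U^{-1}\bigr)=\widehat{\overline\sigma(B)\circ w}\qquad\text{for all } B\in\overline{\mathcal T}_0 .$$ It is surjective with kernel $\mathcal K(L^2(\mathbb R))\subset\mathcal T_{\mathbb R}$, so that $\mathrm{Ad}_U\circ\mathrm{Ad}_W$ is an isomorphism from the extension $0\to\mathcal K(L^2(S^1))\to\overline{\mathcal T}_0\xrightarrow{\overline\sigma}C_0(S^1)\to0$ onto the extension $0\to\mathcal K(L^2(\mathbb R))\to\mathcal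 T_{\mathbb R}\xrightarrow{\sigma_{\mathbb R}}C^*(\mathbb R)\to0$. Moreover $$\sigma_{\mathbb R}(M(f)\lambda(g))=f(+\infty)\,g\qquad\text{for all } f\in C_0(\mathbb R\cup\{+\infty\}),\ g\in C^*(\mathbb R).$$ -/

import Mathlib

open MeasureTheory Filter Topology
open scoped ENNReal ZeroAtInfty FourierTransform

noncomputable section

namespace WienerHopf

/-! ### The circle with arc length -/

instance instMeasurableSpaceCircle : MeasurableSpace Circle := borel Circle

instance instBorelSpaceCircle : BorelSpace Circle := ⟨rfl⟩

/-- Arc length on the unit circle (total mass `2π`). -/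
def arcLength : Measure Circle :=
  (volume.restrict (Set.Ioc 0 (2 * Real.pi))).map Circle.exp

instance instIsFiniteMeasureArcLength : IsFiniteMeasure arcLength := by
  unfold arcLength
  infer_instance

/-- `L²(S¹)` with respect to arc length. -/
abbrev L2Circle : Type := Lp ℂ 2 arcLength

/-- `L²(ℝ)` with respect to Lebesgue measure. -/
abbrev L2Real : Type := Lp ℂ 2 (volume : Measure ℝ)

/-! ### Multiplication operators -/

/-- The operator of multiplication by an essentially bounded function on `L²(μ)`. -/
def mulOp {α : Type} [MeasurableSpace α] (μ : Measure α) (g : α → ℂ) (hg : MemLp g ∞ μ) :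
    Lp ℂ 2 μ →L[ℂ] Lp ℂ 2 μ :=
  (ContinuousLinearMap.mul ℂ ℂ).holderL μ ∞ 2 2 hg.toLp

theorem mulOp_ae {α : Type} [MeasurableSpace α] (μ : Measure α) (g : α → ℂ) (hg : MemLp g ∞ μ)
    (ξ : Lp ℂ 2 μ) : ∀ᵐ x ∂μ, mulOp μ g hg ξ x = g x * ξ x := by
  filter_upwards [(ContinuousLinearMap.mul ℂ ℂ).coeFn_holder (r := 2) hg.toLp ξ,
    hg.coeFn_toLp] with x h1 h2
  exact h1.trans (by rw [h2]; rfl)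

theorem memLp_top_circle (f : C(Circle, ℂ)) : MemLp f ∞ arcLength :=
  memLp_top_of_bound f.continuous.aestronglyMeasurable ‖f‖
    (Eventually.of_forall fun z => f.norm_coe_le_norm z)

/-- The multiplication representation of `C(S¹)` on `L²(S¹)`. -/
def circleMul (f : C(Circle, ℂ)) : L2Circle →L[ℂ] L2Circle :=
  mulOp arcLength f (memLp_top_circle f)

/-- The half-open extended line `ℝ ∪ {+∞}`, with the order topology. -/
abbrev ExtLine : Type := Set.Ioi (⊥ : EReal)

/-- The inclusion of `ℝ` in `ℝ ∪ {+∞}`. -/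
def ExtLine.ofReal (x : ℝ) : ExtLine := ⟨(x : EReal), EReal.bot_lt_coe x⟩

/-- The point `+∞` of `ℝ ∪ {+∞}`. -/
def ExtLine.infty : ExtLine := ⟨⊤, Set.mem_Ioi.2 bot_lt_top⟩

theorem ExtLine.continuous_ofReal : Continuous ExtLine.ofReal :=
  continuous_coe_real_ereal.subtype_mk _

theorem memLp_top_extLine (f : C₀(ExtLine, ℂ)) :
    MemLp (fun x => f (ExtLine.ofReal x)) ∞ (volume : Measure ℝ) :=
  memLp_top_of_bound (f.continuous.comp ExtLine.continuous_ofReal).aestronglyMeasurable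
    ‖f.toBCF‖ (Eventually.of_forall fun x => f.toBCF.norm_coe_le_norm (ExtLine.ofReal x))

/-- The multiplication representation `M` of `C₀(ℝ ∪ {+∞})` on `L²(ℝ)`. -/
def lineMul (f : C₀(ExtLine, ℂ)) : L2Real →L[ℂ] L2Real :=
  mulOp volume (fun x => f (ExtLine.ofReal x)) (memLp_top_extLine f)

/-! ### The compact operators -/

section Compact

variable {H : Type} [NormedAddCommGroup H] [InnerProductSpace ℂ H] [CompleteSpace H]

theorem isCompactOperator_star {T : H →L[ℂ] H} (hT : IsCompactOperator T) :
    IsCompactOperator (star T : H →L[ℂ] H) := by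
  rw [ContinuousLinearMap.star_eq_adjoint]
  set S := ContinuousLinearMap.adjoint T with hS
  change IsCompactOperator (S : H →ₗ[ℂ] H)
  rw [isCompactOperator_iff_isCompact_closure_image_closedBall (𝕜₁ := ℂ) (S : H →ₗ[ℂ] H) one_pos]
  refine TotallyBounded.isCompact_of_isClosed (TotallyBounded.closure ?_) isClosed_closure
  have hTS : IsCompactOperator (T ∘L S) := hT.comp_clm S
  have hc := (isCompactOperator_iff_isCompact_closure_image_closedBall (𝕜₁ := ℂ)
    ((T ∘L S : H →L[ℂ] H) : H →ₗ[ℂ] H) one_pos).1 hTS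
  have key : ∀ x y : H, ‖x‖ ≤ 1 → ‖y‖ ≤ 1 → ‖S x - S y‖ ^ 2 ≤ 2 * ‖T (S x) - T (S y)‖ := by
    intro x y hx hy
    have h1 : ‖S (x - y)‖ ^ 2 = RCLike.re (inner ℂ (T (S (x - y))) (x - y)) := by
      rw [← ContinuousLinearMap.adjoint_inner_right, ← hS, inner_self_eq_norm_sq]
    rw [← map_sub, h1, ← map_sub, ← map_sub]
    refine (RCLike.re_le_norm _).trans ((norm_inner_le_norm _ _).trans ?_)
    have : ‖x - y‖ ≤ 2 := (norm_sub_le _ _).trans (by linarith)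
    nlinarith [norm_nonneg (T (S (x - y)))]
  rw [Metric.totallyBounded_iff]
  intro ε hε
  obtain ⟨t, ht, hcov⟩ := Metric.totallyBounded_iff.1 (hc.totallyBounded.subset subset_closure)
    (ε ^ 2 / 8) (by positivity)
  classical
  let c : H → H := fun y => if h : ∃ x, ‖x‖ ≤ 1 ∧ dist (T (S x)) y < ε ^ 2 / 8 then S h.choose else 0
  refine ⟨c '' t, ht.image c, ?_⟩
  rintro _ ⟨x, hx, rfl⟩
  have hx1 : ‖x‖ ≤ 1 := by simpa using hx
  have hm := hcov ⟨x, hx, rfl⟩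
  simp only [Set.mem_iUnion, Metric.mem_ball] at hm
  obtain ⟨y, hy, hxy⟩ := hm
  have hex : ∃ x, ‖x‖ ≤ 1 ∧ dist (T (S x)) y < ε ^ 2 / 8 := ⟨x, hx1, hxy⟩
  simp only [Set.mem_iUnion, Metric.mem_ball]
  refine ⟨c y, ⟨y, hy, rfl⟩, ?_⟩
  have hcy : c y = S hex.choose := dif_pos hex
  rw [hcy]
  obtain ⟨h1, h2⟩ := hex.choose_spec
  have h3 := key x hex.choose hx1 h1
  rw [← dist_eq_norm (T (S x))] at h3
  have h4 : dist (T (S x)) (T (S hex.choose)) < ε ^ 2 / 4 := by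
    have := dist_triangle_right (T (S x)) (T (S hex.choose)) y
    have h5 : dist (T (S x)) y < ε ^ 2 / 8 := hxy
    linarith
  have : ‖S x - S hex.choose‖ ^ 2 < ε ^ 2 := by nlinarith [sq_pos_of_pos hε]
  rw [show dist ((S : H →ₗ[ℂ] H) x) (S hex.choose) = ‖S x - S hex.choose‖ from dist_eq_norm _ _]
  exact lt_of_pow_lt_pow_left₀ 2 hε.le this

variable (H) in
/-- The C⋆-algebra `𝒦(H)` of compact operators, as a subalgebra of `B(H)`. -/
def compactOps : NonUnitalStarSubalgebra ℂ (H →L[ℂ] H) where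
  carrier := {T | IsCompactOperator T}
  add_mem' ha hb := IsCompactOperator.add ha hb
  zero_mem' := isCompactOperator_zero
  mul_mem' {_ b} ha _ := IsCompactOperator.comp_clm ha b
  smul_mem' c _ ha := IsCompactOperator.smul ha c
  star_mem' ha := isCompactOperator_star ha

end Compact

/-! ### The Toeplitz extension -/

theorem continuous_circle_coe : Continuous fun z : Circle => (z : ℂ) := continuous_subtype_val

/-- The coordinate function `z` on the circle. -/
def circleZ : C(Circle, ℂ) := ⟨fun z => (z : ℂ), continuous_circle_coe⟩

/-- The Hardy space `H²(S¹)`: the closed span in `L²(S¹)` of the functions `zⁿ`, `n ≥ 0`. -/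
def hardySubmodule : Submodule ℂ L2Circle :=
  (Submodule.span ℂ (Set.range fun n : ℕ =>
    ContinuousMap.toLp (E := ℂ) 2 arcLength ℂ (circleZ ^ n))).topologicalClosure

instance instCompleteSpaceHardySubmodule : CompleteSpace hardySubmodule :=
  (Submodule.isClosed_topologicalClosure _).completeSpace_coe

/-- The Hardy space as a Hilbert space. -/
def Hardy : Type := hardySubmodule

instance instNormedAddCommGroupHardy : NormedAddCommGroup Hardy :=
  inferInstanceAs (NormedAddCommGroup hardySubmodule)

instance instInnerProductSpaceHardy : InnerProductSpace ℂ Hardy :=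
  inferInstanceAs (InnerProductSpace ℂ hardySubmodule)

instance instCompleteSpaceHardy : CompleteSpace Hardy :=
  inferInstanceAs (CompleteSpace hardySubmodule)

/-- The inclusion `H²(S¹) → L²(S¹)`. -/
def hardyIncl : Hardy →L[ℂ] L2Circle := hardySubmodule.subtypeL

/-- The orthogonal projection of `L²(S¹)` onto `H²(S¹)`. -/
def hardyProj : L2Circle →L[ℂ] Hardy := hardySubmodule.orthogonalProjectionOnto

theorem hardyProj_incl (x : Hardy) : hardyProj (hardyIncl x) = x :=
  hardySubmodule.orthogonalProjectionOnto_mem_subspace_eq_self x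

theorem adjoint_hardyIncl : ContinuousLinearMap.adjoint hardyIncl = hardyProj :=
  hardySubmodule.adjoint_subtypeL

theorem adjoint_hardyProj : ContinuousLinearMap.adjoint hardyProj = hardyIncl :=
  hardySubmodule.adjoint_orthogonalProjectionOnto

/-- The Toeplitz operator `T_f`, the compression of multiplication by `f` to `H²(S¹)`. -/
def toeplitzOp (f : C(Circle, ℂ)) : Hardy →L[ℂ] Hardy :=
  hardyProj ∘L circleMul f ∘L hardyIncl

/-- The Toeplitz algebra `𝒯`: the C⋆-algebra on `H²(S¹)` generated by the Toeplitz operators. -/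
def toeplitzAlgebra : StarSubalgebra ℂ (Hardy →L[ℂ] Hardy) :=
  (StarAlgebra.adjoin ℂ (Set.range toeplitzOp)).topologicalClosure

theorem toeplitzOp_mem (f : C(Circle, ℂ)) : toeplitzOp f ∈ toeplitzAlgebra :=
  StarSubalgebra.le_topologicalClosure _ (StarAlgebra.subset_adjoin ℂ _ ⟨f, rfl⟩)

/-- `σ : 𝒯 → C(S¹)` is the symbol map of the Toeplitz extension: `σ(T_f) = f`, and the kernel
of `σ` is the ideal of compact operators (which is contained in `𝒯`). -/
def IsToeplitzSymbol (σ : toeplitzAlgebra →⋆ₐ[ℂ] C(Circle, ℂ)) : Prop :=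
  (∀ f, σ ⟨toeplitzOp f, toeplitzOp_mem f⟩ = f) ∧
  (∀ A, σ A = 0 ↔ IsCompactOperator (A : Hardy →L[ℂ] Hardy)) ∧
  ∀ A : Hardy →L[ℂ] Hardy, IsCompactOperator A → A ∈ toeplitzAlgebra

/-- `C₀(S¹)`: the continuous functions on the circle that vanish at `1`. -/
def circleC0 : NonUnitalStarSubalgebra ℂ C(Circle, ℂ) where
  carrier := {f | f 1 = 0}
  add_mem' {a b} ha hb := by simp_all
  zero_mem' := rfl
  mul_mem' {a b} ha _ := by simp_all
  smul_mem' c f hf := by simp_all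
  star_mem' {a} ha := by simp_all

/-- The nonunital Toeplitz algebra `𝒯₀ = σ⁻¹(C₀(S¹))`. -/
def toeplitz0 (σ : toeplitzAlgebra →⋆ₐ[ℂ] C(Circle, ℂ)) :
    NonUnitalStarSubalgebra ℂ toeplitzAlgebra :=
  circleC0.comap σ

/-- The inclusion `B(H²(S¹)) ⊆ B(L²(S¹))`, extending an operator by `0` on the orthogonal
complement of `H²(S¹)`. -/
def hardyExt (A : Hardy →L[ℂ] Hardy) : L2Circle →L[ℂ] L2Circle :=
  hardyIncl ∘L A ∘L hardyProj

theorem hardyExt_add (A B : Hardy →L[ℂ] Hardy) : hardyExt (A + B) = hardyExt A + hardyExt B := by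
  ext1 x; simp [hardyExt]

theorem hardyExt_smul (c : ℂ) (A : Hardy →L[ℂ] Hardy) : hardyExt (c • A) = c • hardyExt A := by
  ext1 x; simp [hardyExt]

theorem hardyExt_mul (A B : Hardy →L[ℂ] Hardy) : hardyExt (A * B) = hardyExt A * hardyExt B := by
  ext1 x; simp [hardyExt, hardyProj_incl]

theorem hardyExt_star (A : Hardy →L[ℂ] Hardy) : hardyExt (star A) = star (hardyExt A) := by
  simp only [hardyExt, ContinuousLinearMap.star_eq_adjoint, ContinuousLinearMap.adjoint_comp,
    adjoint_hardyIncl, adjoint_hardyProj]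
  rfl

/-- The uncompressed nonunital Toeplitz algebra `𝒯₀ + 𝒦(L²(S¹))` on `L²(S¹)`. -/
def uncompressed (σ : toeplitzAlgebra →⋆ₐ[ℂ] C(Circle, ℂ)) :
    NonUnitalStarSubalgebra ℂ (L2Circle →L[ℂ] L2Circle) where
  carrier := {B | ∃ A ∈ toeplitz0 σ, ∃ K ∈ compactOps L2Circle, B = hardyExt A + K}
  add_mem' := by
    rintro _ _ ⟨A, hA, K, hK, rfl⟩ ⟨A', hA', K', hK', rfl⟩
    refine ⟨A + A', add_mem hA hA', K + K', add_mem hK hK', ?_⟩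
    push_cast
    rw [hardyExt_add]; abel
  zero_mem' := ⟨0, zero_mem _, 0, zero_mem _, by ext1 x; simp [hardyExt]⟩
  mul_mem' := by
    rintro _ _ ⟨A, hA, K, hK, rfl⟩ ⟨A', hA', K', hK', rfl⟩
    refine ⟨A * A', mul_mem hA hA', hardyExt A * K' + K * hardyExt A' + K * K',
      add_mem (add_mem (IsCompactOperator.clm_comp hK' (hardyExt A))
        (IsCompactOperator.comp_clm hK (hardyExt A'))) (mul_mem hK hK'), ?_⟩
    push_cast
    rw [hardyExt_mul, add_mul, mul_add, mul_add]; abel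
  smul_mem' := by
    rintro c _ ⟨A, hA, K, hK, rfl⟩
    refine ⟨c • A, SMulMemClass.smul_mem c hA, c • K, SMulMemClass.smul_mem c hK, ?_⟩
    rw [smul_add, ← hardyExt_smul]; rfl
  star_mem' := by
    rintro _ ⟨A, hA, K, hK, rfl⟩
    refine ⟨star A, star_mem hA, star K, star_mem hK, ?_⟩
    rw [star_add, ← hardyExt_star]; rfl

theorem hardyExt_mem {σ : toeplitzAlgebra →⋆ₐ[ℂ] C(Circle, ℂ)} {A : toeplitzAlgebra}
    (hA : A ∈ toeplitz0 σ) : hardyExt A ∈ uncompressed σ :=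
  ⟨A, hA, 0, zero_mem _, (add_zero _).symm⟩

/-- `σbar` is the symbol map of the uncompressed nonunital Toeplitz algebra: it extends `σ` and its
kernel consists of the compact operators on `L²(S¹)`. -/
def IsUncompressedSymbol (σ : toeplitzAlgebra →⋆ₐ[ℂ] C(Circle, ℂ))
    (σbar : uncompressed σ →⋆ₙₐ[ℂ] circleC0) : Prop :=
  (∀ (A : toeplitzAlgebra) (hA : A ∈ toeplitz0 σ),
    σbar ⟨hardyExt A, hardyExt_mem hA⟩ = ⟨σ A, hA⟩) ∧
  ∀ B, σbar B = 0 ↔ IsCompactOperator (B : L2Circle →L[ℂ] L2Circle)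

/-! ### The Cayley transform and its unitarization -/

theorem add_I_ne_zero (t : ℝ) : (t : ℂ) + Complex.I ≠ 0 := fun h => by
  simpa using congrArg Complex.im h

theorem norm_sub_I (t : ℝ) : ‖(t : ℂ) - Complex.I‖ = ‖(t : ℂ) + Complex.I‖ := by
  rw [← Complex.norm_conj ((t : ℂ) + Complex.I)]
  simp [sub_eq_add_neg]

theorem norm_add_I_sq (t : ℝ) : ‖(t : ℂ) + Complex.I‖ ^ 2 = 1 + t ^ 2 := by
  rw [← Complex.normSq_eq_norm_sq, Complex.normSq_apply]
  simp; ring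

theorem cayley_mem (t : ℝ) :
    ((t : ℂ) - Complex.I) / ((t : ℂ) + Complex.I) ∈ Submonoid.unitSphere ℂ := by
  change _ ∈ Metric.sphere (0 : ℂ) 1
  rw [mem_sphere_zero_iff_norm, norm_div, norm_sub_I,
    div_self (norm_ne_zero_iff.2 (add_I_ne_zero t))]

/-- The Cayley transform `w(t) = (t - i) / (t + i)`. -/
def cayley (t : ℝ) : Circle :=
  ⟨((t : ℂ) - Complex.I) / ((t : ℂ) + Complex.I), cayley_mem t⟩

theorem coe_cayley (t : ℝ) :
    (cayley t : ℂ) = ((t : ℂ) - Complex.I) / ((t : ℂ) + Complex.I) := rfl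

theorem continuous_cayley : Continuous cayley := by
  refine Continuous.subtype_mk ?_ _
  exact (by fun_prop : Continuous fun t : ℝ => (t : ℂ) - Complex.I).div
    (by fun_prop) add_I_ne_zero

/-- The measurable inverse `z ↦ i (1 + z) / (1 - z)` of the Cayley transform. -/
def cayleyInv (z : Circle) : ℝ := (Complex.I * (1 + (z : ℂ)) / (1 - (z : ℂ))).re

theorem measurable_cayleyInv : Measurable cayleyInv := by
  have h : Measurable fun z : Circle => (z : ℂ) := continuous_circle_coe.measurable
  exact Complex.measurable_re.comp (((h.const_add 1).const_mul Complex.I).div (h.const_sub 1))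

theorem cayleyInv_cayley (t : ℝ) : cayleyInv (cayley t) = t := by
  have h := add_I_ne_zero t
  have hI := Complex.I_ne_zero
  have h1 : 1 - (cayley t : ℂ) = 2 * Complex.I / ((t : ℂ) + Complex.I) := by
    rw [coe_cayley]; field_simp; ring
  have h2 : 1 + (cayley t : ℂ) = 2 * t / ((t : ℂ) + Complex.I) := by
    rw [coe_cayley]; field_simp; ring
  rw [cayleyInv, h1, h2]
  have : Complex.I * (2 * t / ((t : ℂ) + Complex.I)) / (2 * Complex.I / ((t : ℂ) + Complex.I))
      = (t : ℂ) := by field_simp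
  rw [this, Complex.ofReal_re]

theorem cayley_aux (C S e f t : ℂ) (hC : C ≠ 0) (ht : t = S / C)
    (he1 : e = C + S * Complex.I) (hf1 : f = C - S * Complex.I) (hef : e * f = 1) :
    (t - Complex.I) / (t + Complex.I) = -(e * e) := by
  have hI := Complex.I_ne_zero
  have hf : f ≠ 0 := right_ne_zero_of_mul_eq_one hef
  have e1 : t - Complex.I = -Complex.I * e / C := by
    rw [ht, he1]; field_simp; linear_combination S * Complex.I_sq
  have e2 : t + Complex.I = Complex.I * f / C := by
    rw [ht, hf1]; field_simp; linear_combination S * Complex.I_sq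
  rw [e1, e2, div_div_div_cancel_right₀ hC, div_eq_iff (mul_ne_zero hI hf)]
  linear_combination Complex.I * e * hef

theorem cayley_eq_exp (t : ℝ) : cayley t = Circle.exp (2 * Real.arctan t + Real.pi) := by
  apply Circle.ext
  have hc : (Real.cos (Real.arctan t) : ℂ) ≠ 0 := by
    exact_mod_cast (Real.cos_arctan_pos t).ne'
  have ht : (t : ℂ) = Complex.sin (Real.arctan t) / Complex.cos (Real.arctan t) := by
    rw [← Complex.ofReal_sin, ← Complex.ofReal_cos, ← Complex.ofReal_div,
      ← Real.tan_eq_sin_div_cos, Real.tan_arctan]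
  rw [Complex.ofReal_cos] at hc
  rw [coe_cayley, Circle.coe_exp, cayley_aux (Complex.cos (Real.arctan t))
    (Complex.sin (Real.arctan t)) (Complex.exp ((Real.arctan t : ℂ) * Complex.I))
    (Complex.exp (-(Real.arctan t : ℂ) * Complex.I)) t hc ht
    (Complex.exp_mul_I _) (by rw [Complex.exp_mul_I, Complex.cos_neg, Complex.sin_neg]; ring)
    (by rw [← Complex.exp_add]; ring_nf; simp), ← Complex.exp_add]
  push_cast
  have h2 : (2 * (Real.arctan t : ℂ) + (Real.pi : ℂ)) * Complex.I =
      ((Real.arctan t : ℂ) * Complex.I + (Real.arctan t : ℂ) * Complex.I) +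
        (Real.pi : ℂ) * Complex.I := by ring
  have h3 := Complex.exp_add ((Real.arctan t : ℂ) * Complex.I + (Real.arctan t : ℂ) * Complex.I)
    ((Real.pi : ℂ) * Complex.I)
  rw [← h2, Complex.exp_pi_mul_I, mul_neg_one] at h3
  push_cast at h3
  exact h3.symm

theorem lintegral_cayley (g : Circle → ℝ≥0∞) (hg : Measurable g) :
    ∫⁻ z, g z ∂arcLength = ∫⁻ t : ℝ, ENNReal.ofReal (2 / (1 + t ^ 2)) * g (cayley t) := by
  have hd : ∀ x ∈ (Set.univ : Set ℝ), HasDerivWithinAt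
      (fun t => 2 * Real.arctan t + Real.pi) (2 / (1 + x ^ 2)) Set.univ x := by
    intro x _
    have := (((Real.hasDerivAt_arctan x).const_mul 2).add_const Real.pi).hasDerivWithinAt
      (s := Set.univ)
    rwa [mul_one_div] at this
  have hinj : Set.InjOn (fun t => 2 * Real.arctan t + Real.pi) Set.univ := by
    intro a _ b _ hab
    exact Real.arctan_injective (by simpa using hab)
  have himg : (fun t => 2 * Real.arctan t + Real.pi) '' Set.univ = Set.Ioo 0 (2 * Real.pi) := by
    ext y
    simp only [Set.image_univ, Set.mem_range, Set.mem_Ioo]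
    constructor
    · rintro ⟨t, rfl⟩
      have h1 := Real.neg_pi_div_two_lt_arctan t
      have h2 := Real.arctan_lt_pi_div_two t
      constructor <;> linarith
    · rintro ⟨h1, h2⟩
      refine ⟨Real.tan ((y - Real.pi) / 2), ?_⟩
      rw [Real.arctan_tan (by linarith) (by linarith)]; linarith
  have key := lintegral_image_eq_lintegral_abs_deriv_mul MeasurableSet.univ hd hinj
    (fun θ => g (Circle.exp θ))
  rw [himg, setLIntegral_univ] at key
  rw [arcLength, lintegral_map hg Circle.exp.continuous.measurable,
    ← setLIntegral_congr Ioo_ae_eq_Ioc, key]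
  refine lintegral_congr fun t => ?_
  rw [cayley_eq_exp, abs_of_pos (by positivity)]

/-- The weight `√2 / (t + i)`. -/
def weight (t : ℝ) : ℂ := (Real.sqrt 2 : ℂ) / ((t : ℂ) + Complex.I)

theorem weight_ne_zero (t : ℝ) : weight t ≠ 0 :=
  div_ne_zero (by simp) (add_I_ne_zero t)

theorem continuous_weight : Continuous weight :=
  continuous_const.div (by fun_prop) add_I_ne_zero

theorem enorm_weight_sq (t : ℝ) : ‖weight t‖ₑ ^ 2 = ENNReal.ofReal (2 / (1 + t ^ 2)) := by
  rw [← ofReal_norm, ← ENNReal.ofReal_pow (norm_nonneg _), weight, norm_div, div_pow,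
    norm_add_I_sq]
  congr 2
  simp

theorem quasi_cayley : Measure.QuasiMeasurePreserving cayley volume arcLength := by
  refine ⟨continuous_cayley.measurable, Measure.AbsolutelyContinuous.mk fun s hs h => ?_⟩
  have h1 := lintegral_cayley (s.indicator 1) (measurable_one.indicator hs)
  rw [lintegral_indicator_one hs, h, eq_comm, lintegral_eq_zero_iff] at h1
  · rw [Measure.map_apply continuous_cayley.measurable hs]
    refine measure_mono_null ?_ (ae_iff.1 h1)
    intro t ht
    have h2 : (0 : ℝ) < 2 / (1 + t ^ 2) := by positivity
    have h3 : cayley t ∈ s := ht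
    simp [h3]
    positivity
  · exact ((by fun_prop : Measurable fun t : ℝ => 2 / (1 + t ^ 2)).ennreal_ofReal).mul
      ((measurable_one.indicator hs).comp continuous_cayley.measurable)

theorem eLpNorm_cayley (f : Circle → ℂ) (hf : AEStronglyMeasurable f arcLength) :
    eLpNorm (fun t => weight t * f (cayley t)) 2 volume = eLpNorm f 2 arcLength := by
  have hm := hf.stronglyMeasurable_mk
  have h1 : eLpNorm f 2 arcLength = eLpNorm (hf.mk f) 2 arcLength :=
    eLpNorm_congr_ae hf.ae_eq_mk
  have h2 : eLpNorm (fun t => weight t * f (cayley t)) 2 volume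
      = eLpNorm (fun t => weight t * hf.mk f (cayley t)) 2 volume := by
    refine eLpNorm_congr_ae ?_
    filter_upwards [quasi_cayley.ae_eq_comp hf.ae_eq_mk] with t ht
    simp only [Function.comp] at ht
    rw [ht]
  rw [h1, h2]
  rw [eLpNorm_eq_lintegral_rpow_enorm_toReal two_ne_zero ENNReal.ofNat_ne_top,
    eLpNorm_eq_lintegral_rpow_enorm_toReal two_ne_zero ENNReal.ofNat_ne_top]
  congr 1
  simp only [ENNReal.toReal_ofNat, ENNReal.rpow_two]
  rw [lintegral_cayley _ (hm.measurable.enorm.pow_const 2)]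
  refine lintegral_congr fun t => ?_
  rw [enorm_mul, mul_pow, enorm_weight_sq]

theorem memLp_cayley (ξ : L2Circle) :
    MemLp (fun t => weight t * ξ (cayley t)) 2 (volume : Measure ℝ) := by
  refine ⟨continuous_weight.aestronglyMeasurable.mul
    ((Lp.aestronglyMeasurable ξ).comp_quasiMeasurePreserving quasi_cayley), ?_⟩
  rw [eLpNorm_cayley _ (Lp.aestronglyMeasurable ξ)]
  exact Lp.eLpNorm_lt_top ξ

/-- The map `(Wξ)(t) = √2 / (t + i) · ξ(w(t))` as a linear isometry `L²(S¹) → L²(ℝ)`. -/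
def cayleyIsometry : L2Circle →ₗᵢ[ℂ] L2Real where
  toFun ξ := (memLp_cayley ξ).toLp
  map_add' ξ η := by
    apply Lp.ext
    filter_upwards [(memLp_cayley (ξ + η)).coeFn_toLp, (memLp_cayley ξ).coeFn_toLp,
      (memLp_cayley η).coeFn_toLp, Lp.coeFn_add (memLp_cayley ξ).toLp (memLp_cayley η).toLp,
      quasi_cayley.ae_eq_comp (Lp.coeFn_add ξ η)] with t h1 h2 h3 h4 h5
    simp only [Function.comp, Pi.add_apply] at h5
    rw [h4, Pi.add_apply, h1, h2, h3, h5, mul_add]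
  map_smul' c ξ := by
    apply Lp.ext
    simp only [RingHom.id_apply]
    filter_upwards [(memLp_cayley (c • ξ)).coeFn_toLp, (memLp_cayley ξ).coeFn_toLp,
      Lp.coeFn_smul c (memLp_cayley ξ).toLp,
      quasi_cayley.ae_eq_comp (Lp.coeFn_smul c ξ)] with t h1 h2 h3 h4
    simp only [Function.comp, Pi.smul_apply, smul_eq_mul] at h4
    rw [h3, Pi.smul_apply, h1, h2, h4, smul_eq_mul]; ring
  norm_map' ξ := by
    change ‖(memLp_cayley ξ).toLp‖ = ‖ξ‖
    rw [Lp.norm_toLp, eLpNorm_cayley _ (Lp.aestronglyMeasurable ξ), Lp.norm_def]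

theorem cayleyIsometry_surjective : Function.Surjective cayleyIsometry := by
  intro η
  let f : Circle → ℂ := fun z => (weight (cayleyInv z))⁻¹ * η (cayleyInv z)
  have hη : Measurable (η : ℝ → ℂ) := (Lp.stronglyMeasurable η).measurable
  have hf : Measurable f :=
    ((continuous_weight.measurable.comp measurable_cayleyInv).inv).mul
      (hη.comp measurable_cayleyInv)
  have hfη : ∀ t, weight t * f (cayley t) = η t := by
    intro t
    simp only [f, cayleyInv_cayley]
    rw [mul_inv_cancel_left₀ (weight_ne_zero t)]
  have hmem : MemLp f 2 arcLength := by
    refine ⟨hf.aestronglyMeasurable, ?_⟩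
    rw [← eLpNorm_cayley f hf.aestronglyMeasurable]
    simp only [hfη]
    exact Lp.eLpNorm_lt_top η
  refine ⟨hmem.toLp, ?_⟩
  apply Lp.ext
  filter_upwards [(memLp_cayley hmem.toLp).coeFn_toLp,
    quasi_cayley.ae_eq_comp hmem.coeFn_toLp] with t h1 h2
  simp only [Function.comp] at h2
  change ((memLp_cayley hmem.toLp).toLp : ℝ → ℂ) t = η t
  rw [h1, h2, hfη]

/-- The unitarized Cayley transform `W : L²(S¹) → L²(ℝ)`, `(Wξ)(t) = √2 / (t + i) · ξ(w(t))`. -/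
def cayleyW : L2Circle ≃ₗᵢ[ℂ] L2Real :=
  LinearIsometryEquiv.ofSurjective cayleyIsometry cayleyIsometry_surjective

theorem cayleyW_ae (ξ : L2Circle) :
    ∀ᵐ t : ℝ, cayleyW ξ t = (Real.sqrt 2 : ℂ) / ((t : ℂ) + Complex.I) * ξ (cayley t) :=
  (memLp_cayley ξ).coeFn_toLp

/-- The Fourier transform `U : L²(ℝ) → L²(ℝ)`, `(Uξ)(s) = ∫ ξ(t) e^{-2πist} dt`. -/
def fourierU : L2Real ≃ₗᵢ[ℂ] L2Real := Lp.fourierTransformₗᵢ ℝ ℂ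

/-- `Ad_U ∘ Ad_W : B(L²(S¹)) → B(L²(ℝ))`, that is, `B ↦ U W B W⁻¹ U⁻¹`. -/
def adUW : (L2Circle →L[ℂ] L2Circle) ≃⋆ₐ[ℂ] (L2Real →L[ℂ] L2Real) :=
  cayleyW.conjStarAlgEquiv.trans fourierU.conjStarAlgEquiv

theorem tendsto_cayley : Tendsto cayley (cocompact ℝ) (𝓝 1) := by
  refine (Topology.IsEmbedding.subtypeVal : IsEmbedding fun z : Circle => (z : ℂ))
    |>.tendsto_nhds_iff.2 ?_
  change Tendsto (fun t => (cayley t : ℂ)) (cocompact ℝ) (𝓝 1)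
  rw [tendsto_iff_norm_sub_tendsto_zero]
  have h1 : Tendsto (fun t : ℝ => 2 / ‖t‖) (cocompact ℝ) (𝓝 0) :=
    tendsto_const_nhds.div_atTop tendsto_norm_cocompact_atTop
  refine squeeze_zero' (Eventually.of_forall fun t => norm_nonneg _) ?_ h1
  have h0 : ∀ᶠ t : ℝ in cocompact ℝ, 0 < ‖t‖ :=
    tendsto_norm_cocompact_atTop.eventually_gt_atTop 0
  filter_upwards [h0] with t ht
  have h := add_I_ne_zero t
  have h2 : (cayley t : ℂ) - 1 = -2 * Complex.I / ((t : ℂ) + Complex.I) := by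
    rw [coe_cayley]; field_simp; ring
  rw [h2, norm_div]
  have h3 : ‖t‖ ≤ ‖(t : ℂ) + Complex.I‖ := by
    have := Complex.abs_re_le_norm ((t : ℂ) + Complex.I)
    simpa using this
  simp only [norm_mul, norm_neg, Complex.norm_I, mul_one, RCLike.norm_ofNat]
  gcongr

/-- The map `f ↦ f ∘ w` from `C₀(S¹)` to `C₀(ℝ)`. -/
def compCayley (f : circleC0) : C₀(ℝ, ℂ) where
  toFun t := (f : C(Circle, ℂ)) (cayley t)
  continuous_toFun := (f : C(Circle, ℂ)).continuous.comp continuous_cayley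
  zero_at_infty' := by
    have h := ((f : C(Circle, ℂ)).continuous.tendsto 1).comp tendsto_cayley
    have h1 : (f : C(Circle, ℂ)) 1 = 0 := f.2
    rwa [h1] at h

/-! ### The group C⋆-algebra of `ℝ` -/

/-- A strongly continuous unitary representation of `ℝ` on a Hilbert space. -/
structure UnitaryRep where
  carrier : Type
  [normed : NormedAddCommGroup carrier]
  [inner : InnerProductSpace ℂ carrier]
  [complete : CompleteSpace carrier]
  u : ℝ → (carrier ≃ₗᵢ[ℂ] carrier)
  map_add : ∀ s t ξ, u (s + t) ξ = u s (u t ξ)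
  continuous_apply : ∀ ξ, Continuous fun t => u t ξ

attribute [instance] UnitaryRep.normed UnitaryRep.inner UnitaryRep.complete

namespace UnitaryRep

variable (π : UnitaryRep)

theorem integrable_smul (f : Lp ℂ 1 (volume : Measure ℝ)) (ξ : π.carrier) :
    Integrable (fun t => f t • π.u t ξ) := by
  refine (L1.integrable_coeFn f).smul_bdd ‖ξ‖ (π.continuous_apply ξ).aestronglyMeasurable
    (Eventually.of_forall fun t => ?_)
  exact ((π.u t).norm_map ξ).le

/-- The integrated form of `π` on `L¹(ℝ)`: `π(f) ξ = ∫ f(t) π_t ξ dt`. -/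
def integrated (f : Lp ℂ 1 (volume : Measure ℝ)) : π.carrier →L[ℂ] π.carrier :=
  LinearMap.mkContinuous
    { toFun := fun ξ => ∫ t, f t • π.u t ξ
      map_add' := fun ξ η => by
        simp only [(π.u _).map_add, smul_add]
        exact integral_add (π.integrable_smul f ξ) (π.integrable_smul f η)
      map_smul' := fun c ξ => by
        rw [RingHom.id_apply, ← integral_smul]
        congr 1
        ext1 t
        rw [(π.u t).map_smul, smul_comm] } ‖f‖ fun ξ => by
    refine (norm_integral_le_integral_norm _).trans (le_of_eq ?_)
    simp only [norm_smul, LinearIsometryEquiv.norm_map]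
    rw [integral_mul_const, L1.norm_eq_integral_norm]

theorem integrated_apply (f : Lp ℂ 1 (volume : Measure ℝ)) (ξ : π.carrier) :
    π.integrated f ξ = ∫ t, f t • π.u t ξ := rfl

theorem norm_integrated_le (f : Lp ℂ 1 (volume : Measure ℝ)) : ‖π.integrated f‖ ≤ ‖f‖ :=
  LinearMap.mkContinuous_norm_le _ (norm_nonneg f) _

end UnitaryRep

/-- The C⋆-algebra `∏_π B(H_π)` of bounded families of operators, with the supremum norm, where
`π` ranges over the unitary representations of `ℝ`. -/
def UniversalProduct : Type 1 := lp (fun π : UnitaryRep => π.carrier →L[ℂ] π.carrier) ∞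

instance instNonUnitalCStarAlgebraUniversalProduct : NonUnitalCStarAlgebra UniversalProduct :=
  inferInstanceAs (NonUnitalCStarAlgebra (lp (fun π : UnitaryRep => π.carrier →L[ℂ] π.carrier) ∞))

/-- The family `(π(f))_π` of all integrated forms of `f ∈ L¹(ℝ)`. Its norm is the universal
C⋆-norm `sup_π ‖π(f)‖`. -/
def universalRep (f : Lp ℂ 1 (volume : Measure ℝ)) : UniversalProduct :=
  ⟨fun π => π.integrated f, memℓp_infty ⟨‖f‖, by rintro _ ⟨π, rfl⟩; exact π.norm_integrated_le f⟩⟩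

/-- The C⋆-subalgebra of `∏_π B(H_π)` generated by the image of `L¹(ℝ)`. -/
def groupCStarSubalgebra : NonUnitalStarSubalgebra ℂ UniversalProduct :=
  (NonUnitalStarAlgebra.adjoin ℂ (Set.range universalRep)).topologicalClosure

/-- The group C⋆-algebra `C*(ℝ)`: the completion of (the image of) `L¹(ℝ)` in the universal
C⋆-norm, realized as a closure in `∏_π B(H_π)`. -/
def GroupCStar : Type 1 := groupCStarSubalgebra

instance instNonUnitalCStarAlgebraGroupCStar : NonUnitalCStarAlgebra GroupCStar :=
  NonUnitalStarSubalgebra.nonUnitalCStarAlgebra groupCStarSubalgebra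
    (h_closed := NonUnitalStarSubalgebra.isClosed_topologicalClosure _)

/-- The canonical map `L¹(ℝ) → C*(ℝ)`. -/
def ofL1 (f : Lp ℂ 1 (volume : Measure ℝ)) : GroupCStar :=
  ⟨universalRep f, NonUnitalStarSubalgebra.le_topologicalClosure _
    (NonUnitalStarAlgebra.subset_adjoin ℂ _ ⟨f, rfl⟩)⟩

/-- The integrated form of a unitary representation, as a representation of `C*(ℝ)`. -/
def UnitaryRep.integratedForm (π : UnitaryRep) : GroupCStar →⋆ₙₐ[ℂ] (π.carrier →L[ℂ] π.carrier) where
  toFun a := a.1.1 π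
  map_smul' _ _ := rfl
  map_zero' := rfl
  map_add' _ _ := rfl
  map_mul' _ _ := rfl
  map_star' _ := rfl

theorem UnitaryRep.integratedForm_ofL1 (π : UnitaryRep) (f : Lp ℂ 1 (volume : Measure ℝ)) :
    π.integratedForm (ofL1 f) = π.integrated f := rfl

/-- Translation `(λ_t ξ)(x) = ξ(x - t)` on `L²(ℝ)`, as an isometry. -/
def translation (t : ℝ) : L2Real →ₗᵢ[ℂ] L2Real :=
  Lp.compMeasurePreservingₗᵢ ℂ (fun x : ℝ => x - t) (measurePreserving_sub_right volume t)

theorem translation_ae (t : ℝ) (ξ : L2Real) :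
    ∀ᵐ x : ℝ, translation t ξ x = ξ (x - t) :=
  Lp.coeFn_compMeasurePreserving ξ (measurePreserving_sub_right volume t)

theorem translation_add (s t : ℝ) (ξ : L2Real) :
    translation (s + t) ξ = translation s (translation t ξ) := by
  apply Lp.ext
  filter_upwards [translation_ae (s + t) ξ, translation_ae s (translation t ξ),
    (measurePreserving_sub_right volume s).quasiMeasurePreserving.ae (translation_ae t ξ)]
    with x h1 h2 h3
  rw [h1, h2, h3, sub_sub]

theorem translation_zero (ξ : L2Real) : translation 0 ξ = ξ := by
  apply Lp.ext
  filter_upwards [translation_ae 0 ξ] with x h1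
  rw [h1, sub_zero]

/-- The regular representation `λ` of `ℝ` on `L²(ℝ)`. -/
def regularRep : UnitaryRep where
  carrier := L2Real
  u t := LinearIsometryEquiv.ofSurjective (translation t) fun ξ =>
    ⟨translation (-t) ξ, by rw [← translation_add, add_neg_cancel, translation_zero]⟩
  map_add := translation_add
  continuous_apply ξ := by
    let g : C(ℝ, C(ℝ, ℝ)) := (ContinuousMap.mk (fun p : ℝ × ℝ => p.2 - p.1) (by fun_prop)).curry
    exact (continuous_const (y := ξ)).compMeasurePreservingLp g.continuous
      (fun t => measurePreserving_sub_right volume t) ENNReal.ofNat_ne_top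

/-- The regular representation `λ` of `C*(ℝ)` on `L²(ℝ)`. -/
def regular : GroupCStar →⋆ₙₐ[ℂ] (L2Real →L[ℂ] L2Real) := regularRep.integratedForm

/-- `F : C₀(ℝ) → C*(ℝ)` extends the Fourier transform `f̂(s) = ∫ f(t) e^{-2πist} dt`: it sends
`f` to `f̂ ∈ L¹(ℝ) → C*(ℝ)` whenever `f` and `f̂` are integrable. -/
def ExtendsFourier (F : C₀(ℝ, ℂ) ≃⋆ₐ[ℂ] GroupCStar) : Prop :=
  ∀ f : C₀(ℝ, ℂ), Integrable f → ∀ hf : Integrable (𝓕 (f : ℝ → ℂ)),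
    F f = ofL1 (memLp_one_iff_integrable.2 hf).toLp

/-! ### The Wiener–Hopf algebra -/

/-- The Wiener–Hopf algebra `𝒯_ℝ`: the C⋆-algebra on `L²(ℝ)` generated by the products
`M(f) λ(g)`. -/
def wienerHopf : NonUnitalStarSubalgebra ℂ (L2Real →L[ℂ] L2Real) :=
  (NonUnitalStarAlgebra.adjoin ℂ
    {T | ∃ (f : C₀(ExtLine, ℂ)) (g : GroupCStar), T = lineMul f * regular g}).topologicalClosure

/-- The product `M(f) λ(g)` as an element of the Wiener–Hopf algebra. -/
def mulConv (f : C₀(ExtLine, ℂ)) (g : GroupCStar) : wienerHopf :=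
  ⟨lineMul f * regular g, NonUnitalStarSubalgebra.le_topologicalClosure _
    (NonUnitalStarAlgebra.subset_adjoin ℂ _ ⟨f, g, rfl⟩)⟩

/-- `σR` makes the square formed with the symbol `σbar`, with `Ad_U ∘ Ad_W` and with
`f ↦ F(f ∘ w)` commute. -/
def Intertwines {σ : toeplitzAlgebra →⋆ₐ[ℂ] C(Circle, ℂ)} (σbar : uncompressed σ →⋆ₙₐ[ℂ] circleC0)
    (F : C₀(ℝ, ℂ) ≃⋆ₐ[ℂ] GroupCStar) (σR : wienerHopf →⋆ₙₐ[ℂ] GroupCStar) : Prop :=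
  ∀ (B : uncompressed σ) (A : wienerHopf),
    (A : L2Real →L[ℂ] L2Real) = adUW (B : L2Circle →L[ℂ] L2Circle) →
      σR A = F (compCayley (σbar B))

end WienerHopf

end

open WienerHopf

open MeasureTheory Filter Topology
open scoped ENNReal ZeroAtInfty FourierTransform

noncomputable section

namespace WienerHopf

/-! ### Compact operators on Hilbert spaces -/

section Hilbert

variable {H : Type*} [NormedAddCommGroup H] [InnerProductSpace ℂ H]
variable {G : Type*} [NormedAddCommGroup G] [InnerProductSpace ℂ G]

open InnerProductSpace

/-! Everything is computed modulo compact operators, where compressions to the Hardy space become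
multiplicative.

On the circle, the commutator of the Hardy projection `P` with `M(z)` has rank one, so by
Stone–Weierstrass `[P, M(f)]` is compact for every continuous `f` (`isCompactOperator_commutator`),
and `f ↦ P M(f) P` is a `*`-homomorphism modulo compacts. Conjugating `P M(f) P + K` by `M(zⁿ)` and
letting `n → ∞` recovers `M(f)` strongly, whence `‖f‖ ≤ ‖P M(f) P + K‖`
(`norm_le_norm_compression_add`). This one estimate makes symbols unique and the sets of operators
having a symbol closed, which yields `σ` and `σbar`. The compacts lie in the Toeplitz algebra
because `1 - T_z T_z*` is the projection onto the constants.

On the line, `U` turns modulations into translations, so `λ(F b) = U M(b) U⁻¹`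
(`ExtendsFourier.regular_apply`), of norm `‖b‖∞`. Since `C*(ℝ)` carries the universal norm, the
isomorphism `F` also needs `‖π(φ̂)‖ ≤ ‖φ‖∞` for every unitary representation `π`
(`UnitaryRep.norm_schwartz_le`). This follows from an algebraic identity among Schwartz functions,
and density of Schwartz functions does the rest.

The two sides meet in two computations. The conjugation `Ad_U ∘ Ad_W` sends `M(h)` to `λ(F(h ∘ w))`
when `h(1) = 0`, and it sends `P` to the projection onto `L²[0,∞)` (`adUW_hardyP`), because `w` is a
constant plus a multiple of `1/(t+i)`, whose Fourier transform lives on `(0,∞)`. A function `f` on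
`ℝ ∪ {+∞}` differs from `f(+∞) 1_{[0,∞)}` by a function `a` vanishing at both ends of `ℝ`, and for
such `a` the operator `M(a) λ(g)` is a limit of Hilbert–Schmidt operators. Hence `M(f) λ(F(h ∘ w))`
agrees modulo compacts with the transform of `f(+∞) P M(h) P`
(`isCompactOperator_lineMul_regular_sub`). Together with the inclusion of the compacts in the
Wiener–Hopf algebra (`compactOps_le_wienerHopf`), this gives the equality of the two algebras and
the formula for `σ_ℝ`. -/

theorem isCompactOperator_rankOne (x : G) (y : H) : IsCompactOperator (rankOne ℂ x y) := by
  rw [rankOne_def']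
  exact (isCompactOperator_of_locallyCompactSpace_dom (innerSL ℂ y)).clm_comp (ContinuousLinearMap.toSpanSingleton ℂ x)

theorem compact_add {S T : H →L[ℂ] G} (hS : IsCompactOperator S) (hT : IsCompactOperator T) :
    IsCompactOperator (S + T : H →L[ℂ] G) := IsCompactOperator.add hS hT

theorem compact_sub {S T : H →L[ℂ] G} (hS : IsCompactOperator S) (hT : IsCompactOperator T) :
    IsCompactOperator (S - T : H →L[ℂ] G) := IsCompactOperator.sub hS hT

theorem compact_neg {S : H →L[ℂ] G} (hS : IsCompactOperator S) :
    IsCompactOperator (-S : H →L[ℂ] G) := IsCompactOperator.neg hS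

theorem compact_zero : IsCompactOperator (0 : H →L[ℂ] G) := isCompactOperator_zero

theorem compact_smul {S : H →L[ℂ] G} (c : ℂ) (hS : IsCompactOperator S) :
    IsCompactOperator (c • S : H →L[ℂ] G) := IsCompactOperator.smul hS c

theorem compact_mul_right {K : H →L[ℂ] H} (hK : IsCompactOperator K) (A : H →L[ℂ] H) :
    IsCompactOperator (K * A : H →L[ℂ] H) := hK.comp_clm A

theorem compact_mul_left (A : H →L[ℂ] H) {K : H →L[ℂ] H} (hK : IsCompactOperator K) :
    IsCompactOperator (A * K : H →L[ℂ] H) := hK.clm_comp A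

/-- For a fixed second vector, the admissible first vectors form a closed subspace, hence
everything; then the roles are exchanged. Membership of all compacts in a closed space thereby
reduces to explicit vectors. -/
theorem rankOne_mem_of_total {A : Submodule ℂ (H →L[ℂ] G)} (hA : IsClosed (A : Set (H →L[ℂ] G)))
    {D : Set G} {E : Set H} (hD : (Submodule.span ℂ D).topologicalClosure = ⊤)
    (hE : (Submodule.span ℂ E).topologicalClosure = ⊤)
    (h : ∀ x ∈ D, ∀ y ∈ E, rankOne ℂ x y ∈ A) (x : G) (y : H) : rankOne ℂ x y ∈ A := by
  have h1 : ∀ y ∈ E, ∀ x, rankOne ℂ x y ∈ A := by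
    intro y hy x
    let S : Submodule ℂ G :=
      { carrier := {x | rankOne ℂ x y ∈ A}
        add_mem' := fun {a b} ha hb => by
          rw [Set.mem_ofPred_eq, map_add]; exact add_mem ha hb
        zero_mem' := by rw [Set.mem_ofPred_eq, map_zero]; exact zero_mem _
        smul_mem' := fun c a ha => by
          rw [Set.mem_ofPred_eq, map_smul]; exact A.smul_mem _ ha }
    have hS : IsClosed (S : Set G) := 
      hA.preimage (ContinuousLinearMap.smulRightL ℂ H G (innerSL ℂ y)).continuous
    have : (⊤ : Submodule ℂ G) ≤ S := by
      rw [← hD]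
      exact Submodule.topologicalClosure_minimal _ (Submodule.span_le.2 fun x hx => h x hx y hy) hS
    exact this (Submodule.mem_top (x := x))
  let S : Submodule ℂ H :=
    { carrier := {y | rankOne ℂ x y ∈ A}
      add_mem' := fun {a b} ha hb => by
        rw [Set.mem_ofPred_eq, map_add]; exact add_mem ha hb
      zero_mem' := by rw [Set.mem_ofPred_eq, map_zero]; exact zero_mem _
      smul_mem' := fun c a ha => by
        rw [Set.mem_ofPred_eq, map_smulₛₗ]; exact A.smul_mem _ ha }
  have hS : IsClosed (S : Set H) := hA.preimage (rankOne ℂ x : H →L⋆[ℂ] _).continuous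
  have : (⊤ : Submodule ℂ H) ≤ S := by
    rw [← hE]
    exact Submodule.topologicalClosure_minimal _ (Submodule.span_le.2 fun y hy => h1 y hy x) hS
  exact this (Submodule.mem_top (x := y))

/-- Finite rank operators are dense in the compacts: project onto the span of a finite `ε/2`-net of
the image of the unit ball. The projected operator is a finite sum of rank one operators. -/
theorem isCompactOperator_mem_of_rankOne_mem [CompleteSpace H] [CompleteSpace G]
    {A : Submodule ℂ (H →L[ℂ] G)}
    (hA : IsClosed (A : Set (H →L[ℂ] G))) (h : ∀ x y, rankOne ℂ x y ∈ A) (K : H →L[ℂ] G)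
    (hK : IsCompactOperator K) : K ∈ A := by
  rw [← SetLike.mem_coe, ← hA.closure_eq, Metric.mem_closure_iff]
  intro ε hε
  have hc := (isCompactOperator_iff_isCompact_closure_image_closedBall (𝕜₁ := ℂ)
    (K : H →ₗ[ℂ] G) one_pos).1 hK
  obtain ⟨t, ht, hcov⟩ := Metric.totallyBounded_iff.1 (hc.totallyBounded.subset subset_closure)
    (ε / 2) (by positivity)
  let V := Submodule.span ℂ t
  have : FiniteDimensional ℂ V := FiniteDimensional.span_of_finite ℂ ht
  refine ⟨V.starProjection ∘L K, ?_, ?_⟩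
  · let b := stdOrthonormalBasis ℂ V
    have : V.starProjection ∘L K =
        ∑ i, rankOne ℂ (b i : G) (ContinuousLinearMap.adjoint K (b i)) := by
      ext x
      rw [ContinuousLinearMap.comp_apply, Submodule.starProjection_apply,
        b.orthogonalProjectionOnto_apply_eq_sum]
      simp [ContinuousLinearMap.adjoint_inner_left]
    rw [this]
    exact A.sum_mem fun i _ => h _ _
  · rw [dist_eq_norm]
    refine (ContinuousLinearMap.opNorm_le_of_unit_norm (C := ε / 2) (by positivity) ?_).trans_lt
      (by linarith)
    intro x hx
    have hm := hcov ⟨x, by simp [hx], rfl⟩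
    simp only [Set.mem_iUnion, Metric.mem_ball] at hm
    obtain ⟨y, hy, hxy⟩ := hm
    have h1 := V.starProjection_minimal (K x)
    have h2 : ‖K x - V.starProjection (K x)‖ ≤ ‖K x - y‖ := by
      rw [h1]
      exact ciInf_le ⟨0, by rintro _ ⟨z, rfl⟩; positivity⟩ (⟨y, Submodule.subset_span hy⟩ : V)
    rw [_root_.sub_apply, ContinuousLinearMap.comp_apply]
    refine h2.trans ?_
    rw [← dist_eq_norm]
    exact hxy.le

/-- Hilbert–Schmidt operators are norm limits of their truncations to finitely many basis vectors;
the tail is controlled by Cauchy–Schwarz and Bessel's inequality. -/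
theorem isCompactOperator_of_sum_norm_sq_le [CompleteSpace G] {ι : Type*} (b : HilbertBasis ι ℂ H)
    (T : H →L[ℂ] G) (C : ℝ) (h : ∀ s : Finset ι, ∑ i ∈ s, ‖T (b i)‖ ^ 2 ≤ C) :
    IsCompactOperator T := by
  classical
  have hs : Summable fun i => ‖T (b i)‖ ^ 2 :=
    summable_of_sum_le (fun i => by positivity) h
  let F : Finset ι → H →L[ℂ] G := fun s => ∑ i ∈ s, rankOne ℂ (T (b i)) (b i)
  have hF : ∀ s, IsCompactOperator (F s) := by
    intro s
    have : F s ∈ compactOperator (RingHom.id ℂ) H G := by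
      simp only [F]
      exact Submodule.sum_mem _ fun i _ => isCompactOperator_rankOne _ _
    exact this
  have hlim : Tendsto F atTop (𝓝 T) := by
    rw [Metric.tendsto_atTop]
    intro ε hε
    obtain ⟨s, hsv⟩ := summable_iff_vanishing_norm.1 hs ((ε / 2) ^ 2) (by positivity)
    refine ⟨s, fun n hn => ?_⟩
    rw [dist_comm, dist_eq_norm]
    refine (ContinuousLinearMap.opNorm_le_bound _ (M := ε / 2) (by positivity) ?_).trans_lt
      (by linarith)
    intro x
    have hT : HasSum (fun i => inner ℂ (b i) x • T (b i)) (T x) := by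
      have := (b.hasSum_repr x).mapL T
      simpa [b.repr_apply_apply] using this
    have h1 : Tendsto (fun m : Finset ι => ‖(∑ i ∈ m, inner ℂ (b i) x • T (b i)) - F n x‖) atTop
        (𝓝 ‖T x - F n x‖) := (Tendsto.sub_const hT _).norm
    rw [_root_.sub_apply]
    refine le_of_tendsto h1 ?_
    filter_upwards [eventually_ge_atTop n] with m hm
    have h2 : (∑ i ∈ m, inner ℂ (b i) x • T (b i)) - F n x =
        ∑ i ∈ m \ n, inner ℂ (b i) x • T (b i) := by
      rw [← Finset.sum_sdiff hm]
      simp [F]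
    rw [h2]
    calc ‖∑ i ∈ m \ n, inner ℂ (b i) x • T (b i)‖
        ≤ ∑ i ∈ m \ n, ‖inner ℂ (b i) x‖ * ‖T (b i)‖ :=
          (norm_sum_le _ _).trans_eq (by simp [norm_smul])
      _ ≤ √(∑ i ∈ m \ n, ‖inner ℂ (b i) x‖ ^ 2) * √(∑ i ∈ m \ n, ‖T (b i)‖ ^ 2) :=
          Real.sum_mul_le_sqrt_mul_sqrt _ _ _
      _ ≤ √(‖x‖ ^ 2) * √((ε / 2) ^ 2) := by
          gcongr
          · exact b.orthonormal.sum_inner_products_le x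
          · exact (Real.le_norm_self _).trans
              (hsv _ (Finset.disjoint_of_subset_right hn Finset.sdiff_disjoint)).le
      _ = ε / 2 * ‖x‖ := by
          rw [Real.sqrt_sq (norm_nonneg _), Real.sqrt_sq (by positivity), mul_comm]
  exact isCompactOperator_of_tendsto hlim (Eventually.of_forall hF)

/-- An integral operator whose kernel has a square integrable family of sections is compact. -/
theorem isCompactOperator_of_ae_eq_inner {α : Type*} [MeasurableSpace α] {μ : Measure α}
    [CompleteSpace H] (T : H →L[ℂ] Lp ℂ 2 μ) (k : α → H)
    (hT : ∀ ξ, ∀ᵐ x ∂μ, T ξ x = inner ℂ (k x) ξ) (hk : ∫⁻ x, ‖k x‖ₑ ^ 2 ∂μ ≠ ∞) :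
    IsCompactOperator T := by
  obtain ⟨w, b, -⟩ := exists_hilbertBasis ℂ H
  refine isCompactOperator_of_sum_norm_sq_le b T (∫⁻ x, ‖k x‖ₑ ^ 2 ∂μ).toReal fun s => ?_
  rw [← ENNReal.ofReal_le_iff_le_toReal hk, ENNReal.ofReal_sum_of_nonneg fun i _ => by positivity]
  have h1 : ∀ i, ENNReal.ofReal (‖T (b i)‖ ^ 2) = ∫⁻ x, ‖T (b i) x‖ₑ ^ 2 ∂μ := by
    intro i
    rw [ENNReal.ofReal_pow (norm_nonneg _), ofReal_norm, Lp.enorm_def,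
      eLpNorm_eq_lintegral_rpow_enorm_toReal two_ne_zero ENNReal.ofNat_ne_top]
    simp only [ENNReal.toReal_ofNat, ENNReal.rpow_two]
    rw [← ENNReal.rpow_natCast, ← ENNReal.rpow_mul]
    norm_num
  simp only [h1]
  rw [← lintegral_finsetSum' _ fun i _ => (Lp.aestronglyMeasurable _).enorm.pow_const 2]
  refine lintegral_mono_ae ?_
  have h2 : ∀ᵐ x ∂μ, ∀ i ∈ s, T (b i) x = inner ℂ (k x) (b i) :=
    (ae_ball_iff s.countable_toSet).2 fun i _ => hT (b i)
  filter_upwards [h2] with x hx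
  -- Bessel's inequality for each section `k x`, integrated over `x`, bounds the Hilbert–Schmidt
  -- norm.
  have h3 := b.orthonormal.sum_inner_products_le (k x) (s := s)
  calc ∑ i ∈ s, ‖T (b i) x‖ₑ ^ 2 = ENNReal.ofReal (∑ i ∈ s, ‖inner ℂ (b i) (k x)‖ ^ 2) := by
        rw [ENNReal.ofReal_sum_of_nonneg fun i _ => by positivity]
        refine Finset.sum_congr rfl fun i hi => ?_
        rw [hx i hi, ENNReal.ofReal_pow (norm_nonneg _), norm_inner_symm, ofReal_norm]
    _ ≤ ENNReal.ofReal (‖k x‖ ^ 2) := ENNReal.ofReal_le_ofReal h3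
    _ = ‖k x‖ₑ ^ 2 := by rw [ENNReal.ofReal_pow (norm_nonneg _), ofReal_norm]

theorem clm_eq_of_total {E : Set H} (hE : (Submodule.span ℂ E).topologicalClosure = ⊤)
    {S T : H →L[ℂ] G} (h : ∀ x ∈ E, S x = T x) : S = T := by
  refine ContinuousLinearMap.ext_on (s := E) ?_ h
  rw [← Submodule.dense_iff_topologicalClosure_eq_top] at hE
  exact hE

/-- A bounded sequence of operators converges strongly if it does so on a total set. -/
theorem tendsto_of_total {E : Set H} (hE : (Submodule.span ℂ E).topologicalClosure = ⊤)
    {T : ℕ → H →L[ℂ] G} {S : H →L[ℂ] G} {C : ℝ} (hC : ∀ n, ‖T n‖ ≤ C)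
    (h : ∀ x ∈ E, Tendsto (fun n => T n x) atTop (𝓝 (S x))) (x : H) :
    Tendsto (fun n => T n x) atTop (𝓝 (S x)) := by
  have hd : Dense (Submodule.span ℂ E : Set H) := by
    rwa [← Submodule.dense_iff_topologicalClosure_eq_top] at hE
  have hspan : ∀ y ∈ Submodule.span ℂ E, Tendsto (fun n => T n y) atTop (𝓝 (S y)) := by
    intro y hy
    induction hy using Submodule.span_induction with
    | mem y hy => exact h y hy
    | zero => simp
    | add y z _ _ hy hz => simpa using hy.add hz
    | smul c y _ hy => simpa using hy.const_smul c
  have hC0 : 0 ≤ C := (norm_nonneg _).trans (hC 0)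
  rw [Metric.tendsto_atTop]
  intro ε hε
  -- Replacing `x` by `y` costs at most `(C + ‖S‖) · dist x y`; the extra `1` only keeps the
  -- denominator positive.
  obtain ⟨y, hy, hxy⟩ := Metric.mem_closure_iff.1 (hd x) (ε / (2 * (C + ‖S‖ + 1))) (by positivity)
  obtain ⟨N, hN⟩ := Metric.tendsto_atTop.1 (hspan y hy) (ε / 2) (by positivity)
  refine ⟨N, fun n hn => ?_⟩
  have h1 : dist (T n x) (T n y) ≤ C * dist x y := by
    rw [dist_eq_norm, dist_eq_norm, ← map_sub]
    exact (T n).le_of_opNorm_le (hC n) _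
  have h2 : dist (S y) (S x) ≤ ‖S‖ * dist x y := by
    rw [dist_comm x, dist_eq_norm, dist_eq_norm, ← map_sub]
    exact S.le_opNorm _
  have h3 : (C + ‖S‖ + 1) * dist x y < ε / 2 := by
    rw [lt_div_iff₀ (by positivity)] at hxy
    linarith
  have h4 := dist_triangle4 (T n x) (T n y) (S y) (S x)
  have h5 := hN n hn
  nlinarith [dist_nonneg (x := x) (y := y)]

/-- A compact operator maps weakly null bounded sequences to norm null sequences. -/
theorem isCompactOperator_tendsto_zero [CompleteSpace H] [CompleteSpace G]
    {K : H →L[ℂ] G} (hK : IsCompactOperator K) {v : ℕ → H} {C : ℝ} (hC : ∀ n, ‖v n‖ ≤ C)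
    (hv : ∀ y, Tendsto (fun n => inner ℂ y (v n)) atTop (𝓝 0)) :
    Tendsto (fun n => K (v n)) atTop (𝓝 0) := by
  have hC0 : 0 ≤ C := (norm_nonneg _).trans (hC 0)
  let A : Submodule ℂ (H →L[ℂ] G) :=
    { carrier := {T | Tendsto (fun n => T (v n)) atTop (𝓝 0)}
      add_mem' := fun {a b} ha hb => by simpa using Tendsto.add ha hb
      zero_mem' := by simp
      smul_mem' := fun c a ha => by simpa using Tendsto.const_smul ha c }
  have hA : IsClosed (A : Set (H →L[ℂ] G)) := by
    refine isClosed_of_closure_subset fun T hT => ?_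
    change Tendsto (fun n => T (v n)) atTop (𝓝 0)
    rw [Metric.tendsto_atTop]
    intro ε hε
    obtain ⟨S, hS, hTS⟩ := Metric.mem_closure_iff.1 hT (ε / (2 * (C + 1))) (by positivity)
    obtain ⟨N, hN⟩ := Metric.tendsto_atTop.1 (hS : Tendsto (fun n => S (v n)) atTop (𝓝 0))
      (ε / 2) (by positivity)
    refine ⟨N, fun n hn => ?_⟩
    have h1 : dist (T (v n)) (S (v n)) ≤ dist T S * C := by
      rw [dist_eq_norm, dist_eq_norm, ← _root_.sub_apply]
      exact (T - S).le_opNorm_of_le (hC n)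
    have h3 : (C + 1) * dist T S < ε / 2 := by
      rw [lt_div_iff₀ (by positivity)] at hTS
      linarith
    have h4 := dist_triangle (T (v n)) (S (v n)) 0
    have h5 := hN n hn
    nlinarith [dist_nonneg (x := T) (y := S)]
  refine isCompactOperator_mem_of_rankOne_mem hA (fun x y => ?_) K hK
  change Tendsto (fun n => rankOne ℂ x y (v n)) atTop (𝓝 0)
  simpa using (hv y).smul_const x

end Hilbert

theorem isClosed_compactOperator {H G : Type*} [NormedAddCommGroup H] [InnerProductSpace ℂ H]
    [NormedAddCommGroup G] [InnerProductSpace ℂ G] [CompleteSpace G] :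
    IsClosed (compactOperator (RingHom.id ℂ) H G : Set (H →L[ℂ] G)) :=
  isClosed_setOfPred_isCompactOperator

/-- Since `L` is bounded below modulo `C`, a convergent sequence in `L(V) + C` has Cauchy components
in `V`. This is how the algebras of operators with a symbol are shown to be closed. -/
theorem isClosed_setOf_exists_sub_mem {X Y : Type*} [NormedAddCommGroup X] [NormedSpace ℂ X]
    [CompleteSpace X] [NormedAddCommGroup Y] [NormedSpace ℂ Y] (L : X →L[ℂ] Y)
    (V : Set X) (hV : IsClosed V) (C : Submodule ℂ Y) (hC : IsClosed (C : Set Y))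
    (h : ∀ x, ∀ c ∈ C, ‖x‖ ≤ ‖L x + c‖) : IsClosed {y | ∃ x ∈ V, y - L x ∈ C} := by
  refine IsSeqClosed.isClosed fun y z hy hz => ?_
  choose x hxV hxC using hy
  have hd : ∀ m n, dist (x m) (x n) ≤ dist (y m) (y n) := by
    intro m n
    have := h (x m - x n) _ (C.sub_mem (hxC m) (hxC n))
    rw [dist_eq_norm, dist_eq_norm]
    rwa [map_sub, show L (x m) - L (x n) + (y m - L (x m) - (y n - L (x n))) = y m - y n by abel]
      at this
  have hc : CauchySeq x := by
    rw [Metric.cauchySeq_iff]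
    intro ε hε
    obtain ⟨N, hN⟩ := Metric.cauchySeq_iff.1 hz.cauchySeq ε hε
    exact ⟨N, fun m hm n hn => (hd m n).trans_lt (hN m hm n hn)⟩
  obtain ⟨x', hx'⟩ := cauchySeq_tendsto_of_complete hc
  exact ⟨x', hV.mem_of_tendsto hx' (Eventually.of_forall hxV),
    hC.mem_of_tendsto (hz.sub ((L.continuous.tendsto _).comp hx')) (Eventually.of_forall hxC)⟩

/-! ### Multiplication operators on `L²` -/

section MulOp

variable {α : Type} [MeasurableSpace α] {μ : Measure α}

theorem mulOp_apply_eq {g : α → ℂ} (hg : MemLp g ∞ μ) {ξ η : Lp ℂ 2 μ}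
    (h : ∀ᵐ x ∂μ, η x = g x * ξ x) : mulOp μ g hg ξ = η := by
  apply Lp.ext
  filter_upwards [h, mulOp_ae μ g hg ξ] with x h1 h2
  rw [h1, h2]

theorem mulOp_add {f g k : α → ℂ} (hf : MemLp f ∞ μ) (hg : MemLp g ∞ μ) (hk : MemLp k ∞ μ)
    (h : ∀ᵐ x ∂μ, k x = f x + g x) : mulOp μ f hf + mulOp μ g hg = mulOp μ k hk := by
  ext1 ξ
  refine (mulOp_apply_eq hk ?_).symm
  filter_upwards [h, mulOp_ae μ f hf ξ, mulOp_ae μ g hg ξ,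
    Lp.coeFn_add (mulOp μ f hf ξ) (mulOp μ g hg ξ)] with x h1 h2 h3 h4
  rw [add_apply, h4, Pi.add_apply, h1, h2, h3, add_mul]

theorem mulOp_smul {f k : α → ℂ} (hf : MemLp f ∞ μ) (hk : MemLp k ∞ μ) (c : ℂ)
    (h : ∀ᵐ x ∂μ, k x = c * f x) : c • mulOp μ f hf = mulOp μ k hk := by
  ext1 ξ
  refine (mulOp_apply_eq hk ?_).symm
  filter_upwards [h, mulOp_ae μ f hf ξ, Lp.coeFn_smul c (mulOp μ f hf ξ)] with x h1 h2 h3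
  rw [smul_apply, h3, Pi.smul_apply, h1, h2, smul_eq_mul, mul_assoc]

theorem mulOp_mul {f g k : α → ℂ} (hf : MemLp f ∞ μ) (hg : MemLp g ∞ μ) (hk : MemLp k ∞ μ)
    (h : ∀ᵐ x ∂μ, k x = f x * g x) : mulOp μ f hf * mulOp μ g hg = mulOp μ k hk := by
  ext1 ξ
  refine (mulOp_apply_eq hk ?_).symm
  filter_upwards [h, mulOp_ae μ f hf (mulOp μ g hg ξ), mulOp_ae μ g hg ξ] with x h1 h2 h3
  rw [mul_apply_eq_comp, h2, h3, h1, mul_assoc]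

theorem mulOp_one {f : α → ℂ} (hf : MemLp f ∞ μ) (h : ∀ᵐ x ∂μ, f x = 1) : mulOp μ f hf = 1 := by
  ext1 ξ
  refine mulOp_apply_eq hf ?_
  filter_upwards [h] with x h1
  rw [h1, one_mul, one_apply_eq_self]

theorem star_mulOp {f g : α → ℂ} (hf : MemLp f ∞ μ) (hg : MemLp g ∞ μ)
    (h : ∀ᵐ x ∂μ, g x = star (f x)) : star (mulOp μ f hf) = mulOp μ g hg := by
  rw [ContinuousLinearMap.star_eq_adjoint, eq_comm, ContinuousLinearMap.eq_adjoint_iff]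
  intro ξ η
  rw [L2.inner_def, L2.inner_def]
  refine integral_congr_ae ?_
  filter_upwards [h, mulOp_ae μ f hf η, mulOp_ae μ g hg ξ] with x h1 h2 h3
  simp only [RCLike.inner_apply, h1, h2, h3, map_mul, RCLike.star_def, RCLike.conj_conj]
  ring

theorem norm_mulOp_le {f : α → ℂ} (hf : MemLp f ∞ μ) {C : ℝ} (hC : 0 ≤ C)
    (h : ∀ᵐ x ∂μ, ‖f x‖ ≤ C) : ‖mulOp μ f hf‖ ≤ C := by
  refine ContinuousLinearMap.opNorm_le_bound _ hC fun ξ => ?_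
  refine Lp.norm_le_mul_norm_of_ae_le_mul ?_
  filter_upwards [h, mulOp_ae μ f hf ξ] with x h1 h2
  rw [h2, norm_mul]
  gcongr

end MulOp

/-! ### Fourier analysis on the circle -/

/-- The functions `z ↦ zⁿ`, `n ∈ ℤ`, on the circle. -/
def circlePow (n : ℤ) : C(Circle, ℂ) :=
  ⟨fun z => ((z ^ n : Circle) : ℂ), continuous_circle_coe.comp (continuous_zpow n)⟩

theorem circlePow_apply (n : ℤ) (z : Circle) : circlePow n z = ((z ^ n : Circle) : ℂ) := rfl

theorem circlePow_natCast (n : ℕ) : circlePow n = circleZ ^ n := by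
  ext z; simp [circlePow_apply, circleZ]

theorem circlePow_one : circlePow 1 = circleZ := by
  ext z; simp [circlePow_apply, circleZ]

theorem circlePow_add (m n : ℤ) : circlePow (m + n) = circlePow m * circlePow n := by
  ext z; simp [circlePow_apply, zpow_add]

theorem star_circlePow (n : ℤ) : star (circlePow n) = circlePow (-n) := by
  ext z; simp [circlePow_apply, ← Circle.coe_inv_eq_conj]

/-- Stone–Weierstrass, as `z` alone separates points. -/
theorem circle_starSubalgebra_eq_top (S : StarSubalgebra ℂ C(Circle, ℂ))
    (hS : IsClosed (S : Set C(Circle, ℂ))) (hz : circleZ ∈ S) : S = ⊤ := by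
  have h := ContinuousMap.starSubalgebra_topologicalClosure_eq_top_of_separatesPoints S
    fun x y hxy => ⟨circleZ, ⟨circleZ, hz, rfl⟩, fun h => hxy (Circle.ext h)⟩
  rw [eq_top_iff, ← h]
  exact StarSubalgebra.topologicalClosure_minimal le_rfl hS

/-- The integer powers of `z` are closed under products and conjugation, so their span is already a
`*`-subalgebra and Stone–Weierstrass applies to its closure. -/
theorem span_circlePow : (Submodule.span ℂ (Set.range circlePow)).topologicalClosure = ⊤ := by
  let A : StarSubalgebra ℂ C(Circle, ℂ) :=
    { toSubalgebra := (Submodule.span ℂ (Set.range circlePow)).toSubalgebra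
        (Submodule.subset_span ⟨0, by ext z; simp [circlePow_apply]⟩) fun f g hf hg => by
          induction hf, hg using Submodule.span_induction₂ with
          | mem_mem x y hx hy =>
            obtain ⟨m, rfl⟩ := hx
            obtain ⟨n, rfl⟩ := hy
            exact Submodule.subset_span ⟨m + n, circlePow_add m n⟩
          | zero_left => simp
          | zero_right => simp
          | add_left _ _ _ _ _ _ h1 h2 => rw [add_mul]; exact add_mem h1 h2
          | add_right _ _ _ _ _ _ h1 h2 => rw [mul_add]; exact add_mem h1 h2
          | smul_left r _ _ _ _ h => rw [smul_mul_assoc]; exact Submodule.smul_mem _ _ h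
          | smul_right r _ _ _ _ h => rw [mul_smul_comm]; exact Submodule.smul_mem _ _ h
      star_mem' := fun {f} hf => by
        change star f ∈ Submodule.span ℂ (Set.range circlePow)
        replace hf : f ∈ Submodule.span ℂ (Set.range circlePow) := hf
        induction hf using Submodule.span_induction with
        | mem x hx =>
          obtain ⟨m, rfl⟩ := hx
          exact Submodule.subset_span ⟨-m, (star_circlePow m).symm⟩
        | zero => simp
        | add x y _ _ h1 h2 => rw [star_add]; exact add_mem h1 h2
        | smul c x _ h => rw [star_smul]; exact Submodule.smul_mem _ _ h }
  have h := circle_starSubalgebra_eq_top A.topologicalClosure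
    (StarSubalgebra.isClosed_topologicalClosure _)
    (StarSubalgebra.le_topologicalClosure _ (Submodule.subset_span ⟨1, circlePow_one⟩))
  rw [eq_top_iff]
  intro f _
  have hf : f ∈ A.topologicalClosure := h ▸ StarSubalgebra.mem_top
  exact hf

/-- Needed so that continuous functions that agree almost everywhere are equal, which makes
multiplication operators determine their symbol. -/
instance instIsOpenPosMeasureArcLength : arcLength.IsOpenPosMeasure := by
  refine ⟨fun U hU hne h0 => ?_⟩
  obtain ⟨z, hz⟩ := hne
  obtain ⟨φ, hφ⟩ : ∃ φ : ℝ, Circle.exp φ = z := ⟨_, Circle.exp_arg z⟩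
  obtain ⟨θ, hθ, hθz⟩ : ∃ θ ∈ Set.Ioc 0 (2 * Real.pi), Circle.exp θ = z := by
    have hp : Function.Periodic Circle.exp (2 * Real.pi) := Circle.periodic_exp
    refine ⟨toIocMod Real.two_pi_pos 0 φ, by simpa using toIocMod_mem_Ioc Real.two_pi_pos 0 φ, ?_⟩
    rw [toIocMod, hp.sub_zsmul_eq, hφ]
  have hV : IsOpen (Circle.exp ⁻¹' U) := hU.preimage Circle.exp.continuous
  rw [arcLength, Measure.map_apply Circle.exp.continuous.measurable hU.measurableSet,
    Measure.restrict_apply hV.measurableSet] at h0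
  -- The angle `θ` may be the endpoint `2π`, so the open set is moved into the open interval by
  -- using only that `θ` lies in its closure.
  have h1 : ((Circle.exp ⁻¹' U) ∩ Set.Ioo 0 (2 * Real.pi)).Nonempty := by
    have hcl : θ ∈ closure (Set.Ioo 0 (2 * Real.pi)) := by
      rw [closure_Ioo Real.two_pi_pos.ne]
      exact ⟨hθ.1.le, hθ.2⟩
    exact mem_closure_iff.1 hcl _ hV (by rw [Set.mem_preimage, hθz]; exact hz)
  exact ((hV.inter isOpen_Ioo).measure_pos volume h1).ne'
    (measure_mono_null (Set.inter_subset_inter_right _ Set.Ioo_subset_Ioc_self) h0)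

/-- The functions `zⁿ`, `n ∈ ℤ`, in `L²(S¹)`. -/
def monomial (n : ℤ) : L2Circle := ContinuousMap.toLp (E := ℂ) 2 arcLength ℂ (circlePow n)

theorem monomial_ae (n : ℤ) : ∀ᵐ z ∂arcLength, monomial n z = circlePow n z :=
  ContinuousMap.coeFn_toLp arcLength (circlePow n)

theorem span_monomial : (Submodule.span ℂ (Set.range monomial)).topologicalClosure = ⊤ := by
  have h := (ContinuousMap.toLp_denseRange (α := Circle) (E := ℂ) arcLength ℂ
    (p := 2) ENNReal.ofNat_ne_top).topologicalClosure_map_submodule span_circlePow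
  rw [Submodule.map_span, ← Set.range_comp] at h
  exact h

theorem inner_monomial (m n : ℤ) :
    inner ℂ (monomial m) (monomial n) = if m = n then (2 * Real.pi : ℂ) else 0 := by
  have h1 : inner ℂ (monomial m) (monomial n) = ∫ z, circlePow (n - m) z ∂arcLength := by
    rw [L2.inner_def]
    refine integral_congr_ae ?_
    filter_upwards [monomial_ae m, monomial_ae n] with z hm hn
    rw [hm, hn, sub_eq_add_neg, circlePow_add, ← star_circlePow]
    simp
  rw [h1, arcLength, integral_map Circle.exp.continuous.measurable.aemeasurable
    (circlePow _).continuous.aestronglyMeasurable,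
    ← intervalIntegral.integral_of_le Real.two_pi_pos.le]
  have h2 : ∀ x : ℝ, circlePow (n - m) (Circle.exp x) =
      Complex.exp ((((n - m : ℤ) : ℂ) * Complex.I) * x) := by
    intro x
    rw [circlePow_apply, Circle.coe_zpow, Circle.coe_exp, ← Complex.exp_int_mul]
    congr 1; ring
  simp only [h2]
  split_ifs with hmn
  · simp [hmn]
  · have hc : ((n - m : ℤ) : ℂ) * Complex.I ≠ 0 :=
      mul_ne_zero (Int.cast_ne_zero.2 (sub_ne_zero.2 (Ne.symm hmn))) Complex.I_ne_zero
    rw [integral_exp_mul_complex hc]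
    have : ((n - m : ℤ) : ℂ) * Complex.I * ((2 * Real.pi : ℝ) : ℂ) =
        ((n - m : ℤ) : ℂ) * (2 * Real.pi * Complex.I) := by push_cast; ring
    rw [this, Complex.exp_int_mul_two_pi_mul_I]
    simp

/-- Multiplication operators as a `*`-homomorphism `C(S¹) → B(L²(S¹))`. -/
def circleMulHom : C(Circle, ℂ) →⋆ₐ[ℂ] (L2Circle →L[ℂ] L2Circle) where
  toFun := circleMul
  map_one' := mulOp_one _ (Eventually.of_forall fun _ => rfl)
  map_mul' f g := (mulOp_mul _ _ _ (Eventually.of_forall fun _ => rfl)).symm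
  map_zero' := by
    ext1 ξ
    exact mulOp_apply_eq _ (Eventually.of_forall fun z => by simp)
  map_add' f g := (mulOp_add _ _ _ (Eventually.of_forall fun _ => rfl)).symm
  commutes' c := by
    rw [Algebra.algebraMap_eq_smul_one, Algebra.algebraMap_eq_smul_one,
      ← mulOp_one (μ := arcLength) (memLp_top_circle 1) (Eventually.of_forall fun _ => rfl)]
    exact (mulOp_smul _ _ c (Eventually.of_forall fun _ => by simp)).symm
  map_star' f := (star_mulOp _ _ (Eventually.of_forall fun _ => rfl)).symm

theorem circleMulHom_apply (f : C(Circle, ℂ)) : circleMulHom f = circleMul f := rfl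

theorem circleMul_toLp (f g : C(Circle, ℂ)) :
    circleMul f (ContinuousMap.toLp (E := ℂ) 2 arcLength ℂ g) =
      ContinuousMap.toLp (E := ℂ) 2 arcLength ℂ (f * g) := by
  refine mulOp_apply_eq _ ?_
  filter_upwards [ContinuousMap.coeFn_toLp (p := 2) (𝕜 := ℂ) arcLength g,
    ContinuousMap.coeFn_toLp (p := 2) (𝕜 := ℂ) arcLength (f * g)] with z h1 h2
  rw [h1, h2, ContinuousMap.mul_apply]

theorem circleMul_circlePow (m n : ℤ) : circleMul (circlePow m) (monomial n) = monomial (m + n) := by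
  rw [monomial, circleMul_toLp, ← circlePow_add]; rfl

/-- An injective `*`-homomorphism of C⋆-algebras is isometric; injectivity is tested on the constant
function `1`. -/
theorem norm_circleMul (f : C(Circle, ℂ)) : ‖circleMul f‖ = ‖f‖ := by
  refine NonUnitalStarAlgHom.norm_map circleMulHom (fun f g hfg => ?_) f
  refine ContinuousMap.toLp_injective (p := 2) (𝕜 := ℂ) arcLength ?_
  have h := congrArg (fun T : L2Circle →L[ℂ] L2Circle =>
    T (ContinuousMap.toLp (E := ℂ) 2 arcLength ℂ 1)) hfg
  simpa only [circleMulHom_apply, circleMul_toLp, mul_one] using h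

/-! ### Toeplitz operators modulo the compact operators -/

open InnerProductSpace

/-- The projection of `L²(S¹)` onto the Hardy space. -/
def hardyP : L2Circle →L[ℂ] L2Circle := hardyIncl ∘L hardyProj

theorem hardyP_eq : hardyP = hardySubmodule.starProjection := rfl

theorem hardyP_incl (x : Hardy) : hardyP (hardyIncl x) = hardyIncl x :=
  congrArg hardyIncl (hardyProj_incl x)

theorem hardyProj_hardyP (ξ : L2Circle) : hardyProj (hardyP ξ) = hardyProj ξ :=
  hardyProj_incl _

theorem hardyP_mul_self : hardyP * hardyP = hardyP :=
  hardySubmodule.isIdempotentElem_starProjection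

theorem star_hardyP : star hardyP = hardyP :=
  isSelfAdjoint_starProjection hardySubmodule

theorem monomial_mem_hardySubmodule (n : ℕ) : monomial n ∈ hardySubmodule :=
  Submodule.le_topologicalClosure _ (Submodule.subset_span ⟨n, by
    rw [monomial, circlePow_natCast]⟩)

theorem hardyP_monomial_of_nonneg {n : ℤ} (hn : 0 ≤ n) : hardyP (monomial n) = monomial n := by
  lift n to ℕ using hn
  exact Submodule.starProjection_eq_self_iff.2 (monomial_mem_hardySubmodule n)

theorem hardyP_monomial_of_neg {n : ℤ} (hn : n < 0) : hardyP (monomial n) = 0 := by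
  have h : monomial n ∈ hardySubmoduleᗮ := by
    rw [hardySubmodule, Submodule.orthogonal_closure, Submodule.mem_orthogonal]
    intro x hx
    induction hx using Submodule.span_induction with
    | mem x hx =>
      obtain ⟨m, rfl⟩ := hx
      have := inner_monomial m n
      rw [if_neg (by lia), monomial, circlePow_natCast] at this
      exact this
    | zero => simp
    | add x y _ _ h1 h2 => rw [inner_add_left, h1, h2, add_zero]
    | smul c x _ h => rw [inner_smul_left, h, mul_zero]
  rw [hardyP_eq, Submodule.starProjection_apply, ZeroMemClass.coe_eq_zero,
    Submodule.orthogonalProjectionOnto_eq_zero_iff]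
  exact h

theorem norm_hardyIncl_le : ‖hardyIncl‖ ≤ 1 :=
  hardySubmodule.norm_subtypeL_le

theorem norm_hardyProj_le : ‖hardyProj‖ ≤ 1 :=
  hardySubmodule.orthogonalProjectionOnto_norm_le

/-- Multiplication by `z` crosses the boundary between negative and nonnegative exponents only at
`z⁻¹ ↦ 1`. The factor `(2π)⁻¹` compensates for `‖zⁿ‖² = 2π` under arc length. -/
theorem commutator_circleZ : hardyP * circleMul circleZ - circleMul circleZ * hardyP =
    (2 * Real.pi : ℂ)⁻¹ • rankOne ℂ (monomial 0) (monomial (-1)) := by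
  refine clm_eq_of_total span_monomial ?_
  rintro _ ⟨n, rfl⟩
  have hpi : (2 * Real.pi : ℂ) ≠ 0 := by
    exact_mod_cast Real.two_pi_pos.ne'
  simp only [_root_.sub_apply, mul_apply_eq_comp, ← circlePow_one, circleMul_circlePow,
    smul_apply, rankOne_apply, inner_monomial]
  rcases lt_trichotomy n (-1) with h | h | h
  · rw [hardyP_monomial_of_neg (by lia), hardyP_monomial_of_neg (by lia), if_neg (by lia)]
    simp
  · subst h
    rw [if_pos rfl, hardyP_monomial_of_nonneg (by lia), hardyP_monomial_of_neg (by lia), smul_smul,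
      inv_mul_cancel₀ hpi]
    simp
  · rw [hardyP_monomial_of_nonneg (by lia), hardyP_monomial_of_nonneg (by lia), if_neg (by lia),
      circleMul_circlePow]
    simp

/-- Continuous multiplication operators commute with the Hardy projection modulo compacts. -/
theorem isCompactOperator_commutator (f : C(Circle, ℂ)) :
    IsCompactOperator (hardyP * circleMul f - circleMul f * hardyP) := by
  let c : C(Circle, ℂ) → (L2Circle →L[ℂ] L2Circle) := fun f =>
    hardyP * circleMulHom f - circleMulHom f * hardyP
  have hcont : Continuous circleMulHom :=
    AddMonoidHomClass.continuous_of_bound circleMulHom 1 fun f => by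
      rw [circleMulHom_apply, norm_circleMul, one_mul]
  have hc : Continuous c :=
    (continuous_const.mul hcont).sub (hcont.mul continuous_const)
  -- The commutator with `P` is a derivation and its values on adjoints are negatives of adjoints,
  -- so the functions with compact commutator form a closed `*`-subalgebra; it contains `z`.
  let S : StarSubalgebra ℂ C(Circle, ℂ) :=
    { carrier := {f | IsCompactOperator (c f)}
      mul_mem' := fun {f g} hf hg => by
        have : c (f * g) = c f * circleMulHom g + circleMulHom f * c g := by
          simp only [c, map_mul]; noncomm_ring
        rw [Set.mem_ofPred_eq, this]
        exact compact_add (compact_mul_right hf _) (compact_mul_left _ hg)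
      add_mem' := fun {f g} hf hg => by
        have : c (f + g) = c f + c g := by simp only [c, map_add]; noncomm_ring
        rw [Set.mem_ofPred_eq, this]
        exact compact_add hf hg
      algebraMap_mem' := fun r => by
        have : c (algebraMap ℂ _ r) = 0 := by
          simp only [c, AlgHomClass.commutes]; rw [Algebra.commutes, sub_self]
        rw [Set.mem_ofPred_eq, this]
        exact isCompactOperator_zero
      star_mem' := fun {f} hf => by
        have : c (star f) = - star (c f) := by
          simp only [c, map_star, star_sub, star_mul, star_hardyP]; noncomm_ring
        change IsCompactOperator (c (star f))
        rw [this]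
        exact compact_neg (isCompactOperator_star hf) }
  have h := circle_starSubalgebra_eq_top S (isClosed_compactOperator.preimage hc) (by
    change IsCompactOperator (hardyP * circleMul circleZ - circleMul circleZ * hardyP)
    rw [commutator_circleZ]
    exact compact_smul _ (isCompactOperator_rankOne _ _))
  have hf : f ∈ S := h ▸ StarSubalgebra.mem_top
  exact hf

theorem norm_circlePow_le (n : ℤ) : ‖circlePow n‖ ≤ 1 :=
  (ContinuousMap.norm_le _ zero_le_one).2 fun z => by rw [circlePow_apply, Circle.norm_coe]

theorem circleMul_mul (f g : C(Circle, ℂ)) : circleMul (f * g) = circleMul f * circleMul g :=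
  map_mul circleMulHom f g

theorem norm_circleMul_conj_le (B : L2Circle →L[ℂ] L2Circle) (n : ℤ) :
    ‖circleMul (circlePow (-n)) * B * circleMul (circlePow n)‖ ≤ ‖B‖ := by
  have h1 := norm_mul_le (circleMul (circlePow (-n)) * B) (circleMul (circlePow n))
  have h2 := norm_mul_le (circleMul (circlePow (-n))) B
  rw [norm_circleMul] at h1 h2
  nlinarith [norm_circlePow_le n, norm_circlePow_le (-n), norm_nonneg B,
    norm_nonneg (circlePow n), norm_nonneg (circlePow (-n)),
    norm_nonneg (circleMul (circlePow (-n)) * B)]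

/-- Weak convergence of `zⁿ⁺ᵏ` to zero: against each monomial the inner products are eventually
zero, and the norms are bounded. -/
theorem tendsto_inner_monomial (k : ℤ) (ξ : L2Circle) :
    Tendsto (fun n : ℕ => inner ℂ ξ (monomial (n + k))) atTop (𝓝 0) := by
  have hn : ∀ m, ‖monomial m‖ ≤ √(2 * Real.pi) := by
    intro m
    rw [norm_eq_sqrt_re_inner (𝕜 := ℂ), inner_monomial, if_pos rfl]
    simp
  have h := tendsto_of_total span_monomial (T := fun n : ℕ => innerSL ℂ (monomial (n + k)))
    (S := (0 : L2Circle →L[ℂ] ℂ)) (C := √(2 * Real.pi))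
    (fun n => by rw [innerSL_apply_norm]; exact hn _) (by
      rintro _ ⟨m, rfl⟩
      refine tendsto_const_nhds.congr' ?_
      filter_upwards [eventually_gt_atTop (m - k).toNat] with n hn
      rw [innerSL_apply_apply, inner_monomial, if_neg (by lia)]
      rfl) ξ
  have h2 := (continuous_star.tendsto _).comp h
  simpa [Function.comp_def] using h2

/-- Conjugation by `M(zⁿ)` does not increase norms, pushes `P` to the identity and kills `K` in the
strong limit, so `M(f)` is a strong limit of operators of norm at most that of the right-hand side.
-/
theorem norm_le_norm_compression_add (f : C(Circle, ℂ)) {K : L2Circle →L[ℂ] L2Circle}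
    (hK : IsCompactOperator K) : ‖f‖ ≤ ‖hardyP * circleMul f * hardyP + K‖ := by
  set B := hardyP * circleMul f * hardyP + K with hB
  let T : ℕ → L2Circle →L[ℂ] L2Circle := fun n =>
    circleMul (circlePow (-n)) * B * circleMul (circlePow n)
  have hP : ∀ ξ, Tendsto (fun n : ℕ =>
      (circleMul (circlePow (-n)) * hardyP * circleMul (circlePow n)) ξ) atTop
      (𝓝 ((1 : L2Circle →L[ℂ] L2Circle) ξ)) := by
    refine tendsto_of_total span_monomial (C := ‖hardyP‖)
      (fun n => norm_circleMul_conj_le hardyP n) ?_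
    rintro _ ⟨k, rfl⟩
    refine tendsto_const_nhds.congr' ?_
    filter_upwards [eventually_gt_atTop (-k).toNat] with n hn
    rw [mul_apply_eq_comp, mul_apply_eq_comp, circleMul_circlePow,
      hardyP_monomial_of_nonneg (by lia), circleMul_circlePow, one_apply_eq_self]
    congr 1; ring
  have h1 : ∀ ξ, Tendsto (fun n => T n ξ) atTop (𝓝 (circleMul f ξ)) := by
    refine tendsto_of_total span_monomial (C := ‖B‖) (fun n => norm_circleMul_conj_le B n) ?_
    rintro _ ⟨k, rfl⟩
    -- A compact operator sends the weakly null sequence `zⁿ⁺ᵏ` to a norm null one.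
    have hKn : Tendsto (fun n : ℕ => K (monomial (n + k))) atTop (𝓝 0) := by
      refine isCompactOperator_tendsto_zero hK (C := √(2 * Real.pi)) (fun n => ?_)
        (tendsto_inner_monomial k)
      rw [norm_eq_sqrt_re_inner (𝕜 := ℂ), inner_monomial, if_pos rfl]
      simp
    have hKn' : Tendsto (fun n : ℕ => circleMul (circlePow (-n)) (K (monomial (n + k)))) atTop
        (𝓝 0) := by
      refine squeeze_zero_norm (fun n => ?_) (tendsto_zero_iff_norm_tendsto_zero.1 hKn)
      refine (ContinuousLinearMap.le_opNorm _ _).trans ?_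
      rw [norm_circleMul]
      exact mul_le_of_le_one_left (norm_nonneg _) (norm_circlePow_le _)
    have h2 := (hP (circleMul f (monomial k))).add hKn'
    rw [add_zero, one_apply_eq_self] at h2
    refine h2.congr' ?_
    filter_upwards [eventually_gt_atTop (-k).toNat] with n hn
    -- `M(f)` commutes with `M(zⁿ)`, and for large `n` the right-hand `P` acts trivially on `zⁿ⁺ᵏ`.
    have h3 : circleMul (circlePow n) (circleMul f (monomial k)) =
        circleMul f (monomial (n + k)) := by
      rw [← circleMul_circlePow, ← mul_apply_eq_comp, ← mul_apply_eq_comp, ← circleMul_mul,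
        ← circleMul_mul, mul_comm]
    simp only [T, hB, mul_apply_eq_comp, circleMul_circlePow, add_apply, map_add,
      hardyP_monomial_of_nonneg (show (0 : ℤ) ≤ n + k by lia), h3]
  rw [← norm_circleMul]
  refine ContinuousLinearMap.opNorm_le_bound _ (norm_nonneg _) fun ξ => ?_
  exact le_of_tendsto (h1 ξ).norm (Eventually.of_forall fun n =>
    (T n).le_of_opNorm_le (norm_circleMul_conj_le B n) ξ)

/-- The map `f ↦ T_f` as a continuous linear map. -/
def toeplitzL : C(Circle, ℂ) →L[ℂ] (Hardy →L[ℂ] Hardy) :=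
  LinearMap.mkContinuous
    { toFun := toeplitzOp
      map_add' := fun f g => by
        ext1 x
        simp only [toeplitzOp, ← circleMulHom_apply, map_add, add_apply,
          ContinuousLinearMap.comp_apply]
      map_smul' := fun c f => by
        ext1 x
        simp only [toeplitzOp, ← circleMulHom_apply, map_smul, smul_apply,
          ContinuousLinearMap.comp_apply, RingHom.id_apply] } 1 fun f => by
    refine ContinuousLinearMap.opNorm_le_bound _ (by positivity) fun x => ?_
    refine ((hardyProj.le_of_opNorm_le norm_hardyProj_le _).trans_eq (one_mul _)).trans ?_
    refine ((circleMul f).le_opNorm _).trans ?_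
    rw [norm_circleMul, one_mul]
    gcongr
    exact (hardyIncl.le_of_opNorm_le norm_hardyIncl_le _).trans_eq (one_mul _)

theorem toeplitzL_apply (f : C(Circle, ℂ)) : toeplitzL f = toeplitzOp f := rfl

theorem hardyExt_toeplitzOp (f : C(Circle, ℂ)) :
    hardyExt (toeplitzOp f) = hardyP * circleMul f * hardyP := rfl

theorem norm_hardyExt_le (A : Hardy →L[ℂ] Hardy) : ‖hardyExt A‖ ≤ ‖A‖ := by
  refine ContinuousLinearMap.opNorm_le_bound _ (norm_nonneg _) fun x => ?_
  refine ((hardyIncl.le_of_opNorm_le norm_hardyIncl_le _).trans_eq (one_mul _)).trans ?_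
  refine (A.le_opNorm _).trans ?_
  gcongr
  exact (hardyProj.le_of_opNorm_le norm_hardyProj_le _).trans_eq (one_mul _)

theorem hardyProj_hardyExt_hardyIncl (A : Hardy →L[ℂ] Hardy) :
    hardyProj ∘L hardyExt A ∘L hardyIncl = A := by
  ext1 x
  simp [hardyExt, hardyProj_incl]

theorem isCompactOperator_hardyExt_iff {A : Hardy →L[ℂ] Hardy} :
    IsCompactOperator (hardyExt A) ↔ IsCompactOperator A := by
  constructor
  · intro h
    rw [← hardyProj_hardyExt_hardyIncl A]
    exact (h.comp_clm hardyIncl).clm_comp hardyProj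
  · intro h
    exact (h.comp_clm hardyProj).clm_comp hardyIncl

theorem norm_le_norm_toeplitzOp_add (f : C(Circle, ℂ)) {K : Hardy →L[ℂ] Hardy}
    (hK : IsCompactOperator K) : ‖f‖ ≤ ‖toeplitzOp f + K‖ := by
  refine (norm_le_norm_compression_add f (isCompactOperator_hardyExt_iff.2 hK)).trans ?_
  rw [← hardyExt_toeplitzOp, ← hardyExt_add]
  exact norm_hardyExt_le _

theorem toeplitzOp_one : toeplitzOp 1 = 1 := by
  ext1 x
  have : circleMul 1 = 1 := map_one circleMulHom
  simp [toeplitzOp, this, hardyProj_incl]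

/-- The defect is the compression of `M(f) [P, M(g)]`, which is compact. -/
theorem isCompactOperator_toeplitzOp_mul_sub (f g : C(Circle, ℂ)) :
    IsCompactOperator (toeplitzOp f * toeplitzOp g - toeplitzOp (f * g)) := by
  have : toeplitzOp f * toeplitzOp g - toeplitzOp (f * g) =
      hardyProj ∘L (circleMul f * (hardyP * circleMul g - circleMul g * hardyP)) ∘L hardyIncl := by
    ext1 x
    simp only [_root_.sub_apply, mul_apply_eq_comp, ContinuousLinearMap.comp_apply, hardyP_incl,
      map_sub, toeplitzOp, circleMul_mul]
    rfl
  rw [this]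
  exact ((compact_mul_left (circleMul f)
    (isCompactOperator_commutator g)).comp_clm hardyIncl).clm_comp hardyProj

theorem star_toeplitzOp (f : C(Circle, ℂ)) : star (toeplitzOp f) = toeplitzOp (star f) := by
  have h : ContinuousLinearMap.adjoint (circleMul f) = circleMul (star f) :=
    (map_star circleMulHom f).symm
  simp only [toeplitzOp, ContinuousLinearMap.star_eq_adjoint, ContinuousLinearMap.adjoint_comp,
    adjoint_hardyIncl, adjoint_hardyProj, h]
  rfl

/-- `f` is a symbol of `A`: the operators `A` and `T_f` agree modulo compacts. -/
def IsSymbol (A : Hardy →L[ℂ] Hardy) (f : C(Circle, ℂ)) : Prop :=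
  IsCompactOperator (A - toeplitzL f)

namespace IsSymbol

variable {A B : Hardy →L[ℂ] Hardy} {f g : C(Circle, ℂ)}

theorem unique (hf : IsSymbol A f) (hg : IsSymbol A g) : f = g := by
  have h := norm_le_norm_toeplitzOp_add (f - g) (compact_sub hf hg)
  rw [← toeplitzL_apply, map_sub, show toeplitzL f - toeplitzL g +
    ((A - toeplitzL f) - (A - toeplitzL g)) = 0 by abel, norm_zero, norm_le_zero_iff,
    sub_eq_zero] at h
  exact h

theorem toeplitz (f : C(Circle, ℂ)) : IsSymbol (toeplitzOp f) f := by
  rw [IsSymbol, toeplitzL_apply, sub_self]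
  exact compact_zero

theorem add (hA : IsSymbol A f) (hB : IsSymbol B g) : IsSymbol (A + B) (f + g) := by
  rw [IsSymbol, map_add, add_sub_add_comm]
  exact compact_add hA hB

theorem smul (hA : IsSymbol A f) (c : ℂ) : IsSymbol (c • A) (c • f) := by
  rw [IsSymbol, map_smul, ← smul_sub]
  exact compact_smul c hA

theorem mul (hA : IsSymbol A f) (hB : IsSymbol B g) : IsSymbol (A * B) (f * g) := by
  have : A * B - toeplitzL (f * g) = (A - toeplitzL f) * B + toeplitzL f * (B - toeplitzL g) +
      (toeplitzOp f * toeplitzOp g - toeplitzOp (f * g)) := by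
    simp only [toeplitzL_apply]; noncomm_ring
  rw [IsSymbol, this]
  exact compact_add (compact_add (compact_mul_right hA _) (compact_mul_left _ hB))
    (isCompactOperator_toeplitzOp_mul_sub f g)

theorem star (hA : IsSymbol A f) : IsSymbol (star A) (star f) := by
  rw [IsSymbol, toeplitzL_apply, ← star_toeplitzOp, ← star_sub]
  exact isCompactOperator_star hA

theorem algebraMap (r : ℂ) : IsSymbol (algebraMap ℂ _ r) (algebraMap ℂ _ r) := by
  rw [Algebra.algebraMap_eq_smul_one, Algebra.algebraMap_eq_smul_one, ← toeplitzOp_one]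
  exact (toeplitz 1).smul r

end IsSymbol

/-- The operators `T_f + K` form a `*`-algebra, and the estimate `‖f‖ ≤ ‖T_f + K‖` makes it closed;
hence it contains the C⋆-algebra generated by the `T_f`. -/
theorem exists_isSymbol {A : Hardy →L[ℂ] Hardy} (hA : A ∈ toeplitzAlgebra) :
    ∃ f, IsSymbol A f := by
  let S : StarSubalgebra ℂ (Hardy →L[ℂ] Hardy) :=
    { carrier := {A | ∃ f ∈ Set.univ, A - toeplitzL f ∈ compactOperator (RingHom.id ℂ) Hardy Hardy}
      mul_mem' := fun ⟨f, _, hf⟩ ⟨g, _, hg⟩ => ⟨f * g, trivial, IsSymbol.mul hf hg⟩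
      add_mem' := fun ⟨f, _, hf⟩ ⟨g, _, hg⟩ => ⟨f + g, trivial, IsSymbol.add hf hg⟩
      algebraMap_mem' := fun r => ⟨_, trivial, IsSymbol.algebraMap r⟩
      star_mem' := fun ⟨f, _, hf⟩ => ⟨star f, trivial, IsSymbol.star hf⟩ }
  have hS : toeplitzAlgebra ≤ S := by
    refine StarSubalgebra.topologicalClosure_minimal ?_ ?_
    · rw [StarAlgebra.adjoin_le_iff]
      rintro _ ⟨f, rfl⟩
      exact ⟨f, trivial, IsSymbol.toeplitz f⟩
    · exact isClosed_setOf_exists_sub_mem toeplitzL Set.univ isClosed_univ _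
        isClosed_compactOperator fun f K hK => norm_le_norm_toeplitzOp_add f hK
  obtain ⟨f, -, hf⟩ := hS hA
  exact ⟨f, hf⟩

/-- The monomials `zⁿ`, `n ≥ 0`, in the Hardy space. -/
def hardyMonomial (n : ℕ) : Hardy := hardyProj (monomial n)

theorem hardyIncl_hardyMonomial (n : ℕ) : hardyIncl (hardyMonomial n) = monomial n :=
  hardyP_monomial_of_nonneg (Int.natCast_nonneg n)

theorem inner_hardy (x y : Hardy) : inner ℂ x y = inner ℂ (hardyIncl x) (hardyIncl y) := rfl

theorem hardyProj_surjective : Function.Surjective hardyProj := fun x =>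
  ⟨hardyIncl x, hardyProj_incl x⟩

theorem hardyProj_monomial_of_neg {n : ℤ} (hn : n < 0) : hardyProj (monomial n) = 0 := by
  rw [← hardyProj_hardyP, hardyP_monomial_of_neg hn, map_zero]

theorem span_hardyMonomial :
    (Submodule.span ℂ (Set.range hardyMonomial)).topologicalClosure = ⊤ := by
  have h := hardyProj_surjective.denseRange.topologicalClosure_map_submodule
    (f := hardyProj) span_monomial
  rw [eq_top_iff, ← h]
  refine Submodule.topologicalClosure_mono ?_
  rw [Submodule.map_span, Submodule.span_le]
  rintro _ ⟨_, ⟨n, rfl⟩, rfl⟩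
  rcases lt_or_ge n 0 with hn | hn
  · have : hardyProj (monomial n) = 0 := hardyProj_monomial_of_neg hn
    change hardyProj (monomial n) ∈ _
    rw [this]
    exact zero_mem _
  · lift n to ℕ using hn
    exact Submodule.subset_span ⟨n, rfl⟩

theorem toeplitzOp_circlePow_hardyMonomial (m : ℤ) (n : ℕ) :
    toeplitzOp (circlePow m) (hardyMonomial n) = hardyProj (monomial (m + n)) := by
  simp only [toeplitzOp, ContinuousLinearMap.comp_apply, hardyIncl_hardyMonomial,
    circleMul_circlePow]

/-- The operator `1 - T_z T_{z⁻¹}` is the projection onto the constants. Sandwiching it between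
`T_{zᵐ}` and `T_{z⁻ⁿ}` gives, up to the factor `2π`, the rank one operator on `zᵐ` and `zⁿ`, and
these monomials are total in the Hardy space. -/
theorem isCompactOperator_mem_toeplitzAlgebra {K : Hardy →L[ℂ] Hardy}
    (hK : IsCompactOperator K) : K ∈ toeplitzAlgebra := by
  have hpi : (2 * Real.pi : ℂ) ≠ 0 := by
    exact_mod_cast Real.two_pi_pos.ne'
  let A : Submodule ℂ (Hardy →L[ℂ] Hardy) := Subalgebra.toSubmodule toeplitzAlgebra.toSubalgebra
  have hA : IsClosed (A : Set (Hardy →L[ℂ] Hardy)) := StarSubalgebra.isClosed_topologicalClosure _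
  refine isCompactOperator_mem_of_rankOne_mem hA
    (rankOne_mem_of_total hA span_hardyMonomial span_hardyMonomial ?_) K hK
  rintro _ ⟨m, rfl⟩ _ ⟨n, rfl⟩
  have h : rankOne ℂ (hardyMonomial m) (hardyMonomial n) = (2 * Real.pi : ℂ) •
      (toeplitzOp (circlePow m) * (1 - toeplitzOp (circlePow 1) * toeplitzOp (circlePow (-1))) *
        toeplitzOp (circlePow (-n))) := by
    refine clm_eq_of_total span_hardyMonomial ?_
    rintro _ ⟨k, rfl⟩
    have e1 : ∀ j : ℕ, (1 - toeplitzOp (circlePow 1) * toeplitzOp (circlePow (-1)))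
        (hardyMonomial j) = if j = 0 then hardyMonomial 0 else 0 := by
      intro j
      rw [_root_.sub_apply, mul_apply_eq_comp, toeplitzOp_circlePow_hardyMonomial,
        one_apply_eq_self]
      rcases j with - | j
      · rw [hardyProj_monomial_of_neg (by simp)]; simp
      · have : (-1 + ((j + 1 : ℕ) : ℤ)) = (j : ℤ) := by lia
        have h2 : (1 + (j : ℤ)) = ((j + 1 : ℕ) : ℤ) := by lia
        rw [this]
        change _ - toeplitzOp (circlePow 1) (hardyMonomial j) = _
        rw [toeplitzOp_circlePow_hardyMonomial, h2]
        simp [hardyMonomial]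
    rw [rankOne_apply, inner_hardy, hardyIncl_hardyMonomial, hardyIncl_hardyMonomial,
      inner_monomial, smul_apply, mul_apply_eq_comp, mul_apply_eq_comp,
      toeplitzOp_circlePow_hardyMonomial]
    rcases lt_or_ge k n with hk | hk
    · rw [hardyProj_monomial_of_neg (by lia), if_neg (by lia)]
      simp
    · obtain ⟨j, rfl⟩ := Nat.exists_eq_add_of_le hk
      have : (-(n : ℤ) + ((n + j : ℕ) : ℤ)) = (j : ℤ) := by lia
      rw [this]
      change _ = _ • toeplitzOp (circlePow m) ((1 - toeplitzOp (circlePow 1) *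
        toeplitzOp (circlePow (-1))) (hardyMonomial j))
      rw [e1]
      rcases j with - | j
      · rw [if_pos (by lia), if_pos rfl, toeplitzOp_circlePow_hardyMonomial]
        simp [hardyMonomial]
      · rw [if_neg (by lia), if_neg (by lia)]
        simp
  rw [h]
  have hmem : toeplitzOp (circlePow m) * (1 - toeplitzOp (circlePow 1) *
      toeplitzOp (circlePow (-1))) * toeplitzOp (circlePow (-n)) ∈ toeplitzAlgebra :=
    mul_mem (mul_mem (toeplitzOp_mem _) (sub_mem (one_mem _)
      (mul_mem (toeplitzOp_mem _) (toeplitzOp_mem _)))) (toeplitzOp_mem _)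
  exact A.smul_mem _ hmem

/-- The symbol of an element of the Toeplitz algebra. -/
def symbol (A : toeplitzAlgebra) : C(Circle, ℂ) := (exists_isSymbol A.2).choose

theorem isSymbol_symbol (A : toeplitzAlgebra) : IsSymbol A (symbol A) :=
  (exists_isSymbol A.2).choose_spec

theorem IsSymbol.symbol_eq {A : toeplitzAlgebra} {f : C(Circle, ℂ)} (h : IsSymbol A f) :
    symbol A = f :=
  (isSymbol_symbol A).unique h

theorem isSymbol_zero_iff {A : Hardy →L[ℂ] Hardy} : IsSymbol A 0 ↔ IsCompactOperator A := by
  rw [IsSymbol, map_zero, sub_zero]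

/-- The symbol map of the Toeplitz extension. -/
def symbolHom : toeplitzAlgebra →⋆ₐ[ℂ] C(Circle, ℂ) where
  toFun := symbol
  map_one' := by
    refine IsSymbol.symbol_eq ?_
    have := IsSymbol.toeplitz 1
    rwa [toeplitzOp_one] at this
  map_mul' A B := IsSymbol.symbol_eq (A := A * B) ((isSymbol_symbol A).mul (isSymbol_symbol B))
  map_zero' := IsSymbol.symbol_eq (A := 0) (isSymbol_zero_iff.2 compact_zero)
  map_add' A B := IsSymbol.symbol_eq (A := A + B) ((isSymbol_symbol A).add (isSymbol_symbol B))
  commutes' r := IsSymbol.symbol_eq (A := algebraMap ℂ toeplitzAlgebra r) (IsSymbol.algebraMap r)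
  map_star' A := IsSymbol.symbol_eq (A := star A) (isSymbol_symbol A).star

theorem isToeplitzSymbol_symbolHom : IsToeplitzSymbol symbolHom := by
  refine ⟨fun f => IsSymbol.symbol_eq (A := ⟨_, toeplitzOp_mem f⟩)
    (IsSymbol.toeplitz f), fun A => ⟨fun h => ?_, fun h => ?_⟩,
    fun A hA => isCompactOperator_mem_toeplitzAlgebra hA⟩
  · have := isSymbol_symbol A
    rwa [show symbol A = 0 from h, isSymbol_zero_iff] at this
  · exact IsSymbol.symbol_eq (A := A) (isSymbol_zero_iff.2 h)

/-! ### Uniqueness of the symbol, and the uncompressed extension on `L²(S¹)` -/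

section

variable {σ : toeplitzAlgebra →⋆ₐ[ℂ] C(Circle, ℂ)}

/-- Any symbol map kills the compact difference between `A` and the Toeplitz operator of its symbol,
so it must return that symbol. This gives uniqueness of `σ`. -/
theorem IsToeplitzSymbol.isSymbol (hσ : IsToeplitzSymbol σ) (A : toeplitzAlgebra) :
    IsSymbol A (σ A) := by
  let T : toeplitzAlgebra := ⟨toeplitzOp (symbol A), toeplitzOp_mem _⟩
  have hT : σ T = symbol A := hσ.1 _
  have h : σ (A - T) = 0 := (hσ.2.1 (A - T)).2 (isSymbol_symbol A)
  rw [map_sub, hT, sub_eq_zero] at h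
  rw [h]
  exact isSymbol_symbol A

theorem existsUnique_isToeplitzSymbol :
    ∃! σ : toeplitzAlgebra →⋆ₐ[ℂ] C(Circle, ℂ), IsToeplitzSymbol σ :=
  ⟨symbolHom, isToeplitzSymbol_symbolHom, fun _ h => StarAlgHom.ext fun A =>
    (h.isSymbol A).symbol_eq.symm⟩

/-- The compression `f ↦ P M(f) P` to the Hardy space, as operators on `L²(S¹)`. -/
def compression : C(Circle, ℂ) →L[ℂ] (L2Circle →L[ℂ] L2Circle) :=
  LinearMap.mkContinuous
    { toFun := fun f => hardyExt (toeplitzL f)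
      map_add' := fun f g => by rw [map_add, hardyExt_add]
      map_smul' := fun c f => by rw [map_smul, hardyExt_smul, RingHom.id_apply] } ‖toeplitzL‖
    fun f => (norm_hardyExt_le _).trans (toeplitzL.le_opNorm f)

theorem compression_apply (f : C(Circle, ℂ)) :
    compression f = hardyP * circleMul f * hardyP := rfl

theorem compression_eq_hardyExt (f : C(Circle, ℂ)) : compression f = hardyExt (toeplitzL f) := rfl

theorem star_compression (f : C(Circle, ℂ)) : star (compression f) = compression (star f) := by
  rw [compression_eq_hardyExt, ← hardyExt_star, toeplitzL_apply, star_toeplitzOp]; rfl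

theorem isCompactOperator_compression_mul_sub (f g : C(Circle, ℂ)) :
    IsCompactOperator (compression f * compression g - compression (f * g)) := by
  have h := isCompactOperator_hardyExt_iff.2 (isCompactOperator_toeplitzOp_mul_sub f g)
  rw [sub_eq_add_neg, ← neg_one_smul ℂ, hardyExt_add, hardyExt_smul, hardyExt_mul,
    neg_one_smul, ← sub_eq_add_neg] at h
  exact h

theorem IsSymbol.hardyExt {A : Hardy →L[ℂ] Hardy} {f : C(Circle, ℂ)} (h : IsSymbol A f) :
    IsCompactOperator (hardyExt A - compression f) := by
  have h := isCompactOperator_hardyExt_iff.2 h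
  rw [sub_eq_add_neg, ← neg_one_smul ℂ, hardyExt_add, hardyExt_smul,
    neg_one_smul, ← sub_eq_add_neg] at h
  exact h

/-- Describes the algebra without reference to `σ` or to operators on the Hardy space; all later
arguments use this form. -/
theorem mem_uncompressed_iff (hσ : IsToeplitzSymbol σ) {B : L2Circle →L[ℂ] L2Circle} :
    B ∈ uncompressed σ ↔ ∃ f : circleC0, IsCompactOperator (B - compression f) := by
  constructor
  · rintro ⟨A, hA, K, hK, rfl⟩
    refine ⟨⟨σ A, hA⟩, ?_⟩
    have h := compact_add (hσ.isSymbol A).hardyExt (show IsCompactOperator K from hK)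
    rwa [sub_add_eq_add_sub] at h
  · rintro ⟨f, hf⟩
    refine ⟨⟨_, toeplitzOp_mem f⟩, ?_, _, hf, ?_⟩
    · have h : σ ⟨_, toeplitzOp_mem f⟩ ∈ circleC0 := by
        rw [hσ.1]
        exact f.2
      exact h
    · rw [compression_eq_hardyExt, toeplitzL_apply]; abel

theorem isClosed_uncompressed (hσ : IsToeplitzSymbol σ) :
    IsClosed (uncompressed σ : Set (L2Circle →L[ℂ] L2Circle)) := by
  have hc : IsClosed {f : C(Circle, ℂ) | f 1 = 0} :=
    isClosed_eq (by fun_prop) continuous_const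
  have h := isClosed_setOf_exists_sub_mem compression {f : C(Circle, ℂ) | f 1 = 0} hc _
    isClosed_compactOperator fun f K hK => norm_le_norm_compression_add f hK
  have he : (uncompressed σ : Set (L2Circle →L[ℂ] L2Circle)) = {B | ∃ f ∈ {f : C(Circle, ℂ) |
      f 1 = 0}, B - compression f ∈ compactOperator (RingHom.id ℂ) L2Circle L2Circle} := by
    ext B
    rw [SetLike.mem_coe, mem_uncompressed_iff hσ]
    exact ⟨fun ⟨f, hf⟩ => ⟨f, f.2, hf⟩, fun ⟨f, h1, hf⟩ => ⟨⟨f, h1⟩, hf⟩⟩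
  rw [he]
  exact h

theorem compression_symbol_unique {B : L2Circle →L[ℂ] L2Circle} {f g : C(Circle, ℂ)}
    (hf : IsCompactOperator (B - compression f)) (hg : IsCompactOperator (B - compression g)) :
    f = g := by
  have h := norm_le_norm_compression_add (f - g) (compact_sub hf hg)
  rw [← compression_apply, map_sub, show compression f - compression g +
    ((B - compression f) - (B - compression g)) = 0 by abel, norm_zero, norm_le_zero_iff,
    sub_eq_zero] at h
  exact h

theorem IsUncompressedSymbol.apply_eq (hσ : IsToeplitzSymbol σ)
    {σbar : uncompressed σ →⋆ₙₐ[ℂ] circleC0} (h : IsUncompressedSymbol σ σbar)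
    (B : uncompressed σ) (f : circleC0)
    (hf : IsCompactOperator ((B : L2Circle →L[ℂ] L2Circle) - compression f)) :
    σbar B = f := by
  have hs : σ ⟨_, toeplitzOp_mem f⟩ = f := hσ.1 f
  have hf0 : (⟨_, toeplitzOp_mem f⟩ : toeplitzAlgebra) ∈ toeplitz0 σ := by
    have : σ ⟨_, toeplitzOp_mem f⟩ ∈ circleC0 := by rw [hs]; exact f.2
    exact this
  let T : uncompressed σ := ⟨_, hardyExt_mem hf0⟩
  have hT : σbar T = f := (h.1 _ hf0).trans (Subtype.ext hs)
  have h1 : σbar (B - T) = 0 := (h.2 (B - T)).2 hf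
  rwa [map_sub, hT, sub_eq_zero] at h1

/-- A symbol is chosen for each operator. It is unique, so every algebraic law for the map follows
from the corresponding congruence modulo compacts. -/
theorem existsUnique_isUncompressedSymbol (hσ : IsToeplitzSymbol σ) :
    ∃! σbar : uncompressed σ →⋆ₙₐ[ℂ] circleC0, IsUncompressedSymbol σ σbar := by
  choose s hs using fun B : uncompressed σ => (mem_uncompressed_iff hσ).1 B.2
  have hsu : ∀ (B : uncompressed σ) (f : circleC0),
      IsCompactOperator ((B : L2Circle →L[ℂ] L2Circle) - compression f) → s B = f :=
    fun B f hf => Subtype.ext (compression_symbol_unique (hs B) hf)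
  have hmul : ∀ {A B : L2Circle →L[ℂ] L2Circle} {f g : C(Circle, ℂ)},
      IsCompactOperator (A - compression f) → IsCompactOperator (B - compression g) →
      IsCompactOperator (A * B - compression (f * g)) := by
    intro A B f g hA hB
    have : A * B - compression (f * g) = (A - compression f) * B +
        compression f * (B - compression g) +
        (compression f * compression g - compression (f * g)) := by noncomm_ring
    rw [this]
    exact compact_add (compact_add (compact_mul_right hA _) (compact_mul_left _ hB))
      (isCompactOperator_compression_mul_sub f g)
  have hadd : ∀ {A B : L2Circle →L[ℂ] L2Circle} {f g : C(Circle, ℂ)},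
      IsCompactOperator (A - compression f) → IsCompactOperator (B - compression g) →
      IsCompactOperator (A + B - compression (f + g)) := by
    intro A B f g hA hB
    rw [map_add, add_sub_add_comm]
    exact compact_add hA hB
  have hsmul : ∀ (c : ℂ) {A : L2Circle →L[ℂ] L2Circle} {f : C(Circle, ℂ)},
      IsCompactOperator (A - compression f) →
      IsCompactOperator (c • A - compression (c • f)) := by
    intro c A f hA
    rw [map_smul, ← smul_sub]
    exact compact_smul c hA
  have hstar : ∀ {A : L2Circle →L[ℂ] L2Circle} {f : C(Circle, ℂ)},
      IsCompactOperator (A - compression f) →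
      IsCompactOperator (star A - compression (star f)) := by
    intro A f hA
    rw [← star_compression, ← star_sub]
    exact isCompactOperator_star hA
  have hzero : ∀ {A : L2Circle →L[ℂ] L2Circle}, IsCompactOperator (A - compression 0) ↔
      IsCompactOperator A := by
    intro A
    rw [map_zero, sub_zero]
  let σbar : uncompressed σ →⋆ₙₐ[ℂ] circleC0 :=
    { toFun := s
      map_smul' := fun c B => hsu _ _ (hsmul c (hs B))
      map_zero' := hsu _ _ (hzero.2 compact_zero)
      map_add' := fun A B => hsu _ _ (hadd (hs A) (hs B))
      map_mul' := fun A B => hsu _ _ (hmul (hs A) (hs B))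
      map_star' := fun B => hsu _ _ (hstar (hs B)) }
  have hbar : IsUncompressedSymbol σ σbar := by
    refine ⟨fun A hA => hsu _ _ (hσ.isSymbol A).hardyExt, fun B => ⟨fun h => ?_, fun h => ?_⟩⟩
    · have h1 := hs B
      rw [show s B = 0 from h] at h1
      exact hzero.1 h1
    · exact hsu _ _ (hzero.2 h)
  exact ⟨σbar, hbar, fun τ hτ => NonUnitalStarAlgHom.ext fun B =>
    hτ.apply_eq hσ B (s B) (hs B)⟩

theorem IsUncompressedSymbol.surjective (hσ : IsToeplitzSymbol σ)
    {σbar : uncompressed σ →⋆ₙₐ[ℂ] circleC0} (h : IsUncompressedSymbol σ σbar) :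
    Function.Surjective σbar := fun f => by
  have hc : IsCompactOperator (compression f - compression f) := by
    rw [sub_self]; exact compact_zero
  exact ⟨⟨compression f, (mem_uncompressed_iff hσ).2 ⟨f, hc⟩⟩, h.apply_eq hσ _ f hc⟩

end

/-! ### The Fourier transform on `L²(ℝ)` -/

theorem integral_fourier_mul {f g : ℝ → ℂ} (hf : Integrable f) (hg : Integrable g) :
    ∫ x, 𝓕 f x * g x = ∫ x, f x * 𝓕 g x := by
  have h := VectorFourier.integral_fourierIntegral_smul_eq_flip (L := innerₗ ℝ)
    Real.continuous_fourierChar continuous_inner hf hg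
  rw [flip_innerₗ] at h
  exact h

theorem integral_fourierInv_mul {f g : ℝ → ℂ} (hf : Integrable f) (hg : Integrable g) :
    ∫ x, 𝓕⁻ f x * g x = ∫ x, f x * 𝓕⁻ g x := by
  rw [Real.fourierInv_eq_fourier_comp_neg, integral_fourier_mul hf.comp_neg hg,
    ← integral_neg_eq_self]
  simp only [neg_neg, Real.fourierInv_eq_fourier_neg]

theorem continuous_fourier {f : ℝ → ℂ} (hf : Integrable f) : Continuous (𝓕 f) :=
  VectorFourier.fourierIntegral_continuous Real.continuous_fourierChar continuous_inner hf

theorem continuous_fourierInv {f : ℝ → ℂ} (hf : Integrable f) : Continuous (𝓕⁻ f) := by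
  rw [Real.fourierInv_eq_fourier_comp_neg]
  exact continuous_fourier hf.comp_neg

theorem norm_fourierInv_le (f : ℝ → ℂ) (x : ℝ) : ‖𝓕⁻ f x‖ ≤ ∫ t, ‖f t‖ := by
  rw [Real.fourierInv_eq]
  refine (norm_integral_le_integral_norm _).trans_eq ?_
  simp [Circle.norm_smul]

theorem memLp_top_fourierInv {f : ℝ → ℂ} (hf : Integrable f) : MemLp (𝓕⁻ f) ∞ volume :=
  memLp_top_of_bound (continuous_fourierInv hf).aestronglyMeasurable (∫ t, ‖f t‖)
    (Eventually.of_forall (norm_fourierInv_le f))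

theorem schwartz_integrable (φ : SchwartzMap ℝ ℂ) : Integrable φ := φ.integrable

/-- Lets an identity of tempered distributions be read off as an almost everywhere identity of
functions; smooth functions of compact support already suffice as tests. -/
theorem ae_eq_of_integral_schwartz_mul {f g : ℝ → ℂ} (hf : LocallyIntegrable f)
    (hg : LocallyIntegrable g)
    (h : ∀ φ : SchwartzMap ℝ ℂ, ∫ x, φ x * f x = ∫ x, φ x * g x) : ∀ᵐ x, f x = g x := by
  refine ae_eq_of_integral_contDiff_smul_eq hf hg fun k hk hks => ?_
  have hks' : HasCompactSupport fun x => (k x : ℂ) := hks.comp_left (g := Complex.ofReal) rfl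
  have hk' : ContDiff ℝ (⊤ : ℕ∞) fun x => (k x : ℂ) := Complex.ofRealCLM.contDiff.comp hk
  simpa using h (hks'.toSchwartzMap hk')

/-- Both sides define the same distribution: on `L²` the transform is dual to that of Schwartz
functions, and on `L¹` the multiplication formula `∫ f̂ g = ∫ f ĝ` says the same. -/
theorem fourierU_ae {f : ℝ → ℂ} (h1 : Integrable f) (h2 : MemLp f 2) :
    ∀ᵐ x, fourierU h2.toLp x = 𝓕 f x := by
  refine ae_eq_of_integral_schwartz_mul
    ((Lp.memLp (fourierU h2.toLp)).locallyIntegrable one_le_two)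
    (continuous_fourier h1).locallyIntegrable fun φ => ?_
  have h := congrArg (fun T : TemperedDistribution ℝ ℂ => T φ)
    (Lp.fourier_toTemperedDistribution_eq h2.toLp)
  simp only [TemperedDistribution.fourier_apply, Lp.toTemperedDistribution_apply, smul_eq_mul] at h
  have h3 : (𝓕 h2.toLp : Lp ℂ 2 (volume : Measure ℝ)) = fourierU h2.toLp := rfl
  rw [← h3, ← h, ← integral_fourier_mul (schwartz_integrable φ) h1]
  refine integral_congr_ae ?_
  filter_upwards [h2.coeFn_toLp] with x hx
  rw [hx, SchwartzMap.fourier_coe]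

theorem fourierU_symm_ae {f : ℝ → ℂ} (h1 : Integrable f) (h2 : MemLp f 2) :
    ∀ᵐ x, fourierU.symm h2.toLp x = 𝓕⁻ f x := by
  refine ae_eq_of_integral_schwartz_mul
    ((Lp.memLp (fourierU.symm h2.toLp)).locallyIntegrable one_le_two)
    (continuous_fourierInv h1).locallyIntegrable fun φ => ?_
  have h := congrArg (fun T : TemperedDistribution ℝ ℂ => T φ)
    (Lp.fourierInv_toTemperedDistribution_eq h2.toLp)
  simp only [TemperedDistribution.fourierInv_apply, Lp.toTemperedDistribution_apply,
    smul_eq_mul] at h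
  have h3 : (𝓕⁻ h2.toLp : Lp ℂ 2 (volume : Measure ℝ)) = fourierU.symm h2.toLp := rfl
  rw [← h3, ← h, ← integral_fourierInv_mul (schwartz_integrable φ) h1]
  refine integral_congr_ae ?_
  filter_upwards [h2.coeFn_toLp] with x hx
  rw [hx, SchwartzMap.fourierInv_coe]

theorem memLp_top_fourierChar (s : ℝ) :
    MemLp (fun t : ℝ => (Real.fourierChar (s * t) : ℂ)) ∞ volume :=
  memLp_top_of_bound (continuous_circle_coe.comp
    (Real.continuous_fourierChar.comp (continuous_const_mul s))).aestronglyMeasurable 1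
    (Eventually.of_forall fun _ => (Circle.norm_coe _).le)

/-- Multiplication by `t ↦ e^{2πist}` on `L²(ℝ)`. -/
def modulation (s : ℝ) : L2Real →L[ℂ] L2Real :=
  mulOp volume (fun t : ℝ => (Real.fourierChar (s * t) : ℂ)) (memLp_top_fourierChar s)

theorem fourier_fourierChar_mul (f : ℝ → ℂ) (s x : ℝ) :
    𝓕 (fun t => (Real.fourierChar (s * t) : ℂ) * f t) x = 𝓕 f (x - s) := by
  rw [Real.fourier_real_eq, Real.fourier_real_eq]
  congr 1
  ext t
  rw [Circle.smul_def, Circle.smul_def, smul_eq_mul, smul_eq_mul, ← mul_assoc, ← Circle.coe_mul,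
    ← AddChar.map_add_eq_mul]
  congr 3
  ring

/-- Both sides are continuous in `ξ`, so it suffices to treat Schwartz functions, where `U` is the
Fourier integral and a change of phase shifts the frequency. -/
theorem translation_fourierU (s : ℝ) (ξ : L2Real) :
    translation s (fourierU ξ) = fourierU (modulation s ξ) := by
  have hd : DenseRange fun φ : SchwartzMap ℝ ℂ => φ.toLp 2 (volume : Measure ℝ) :=
    SchwartzMap.denseRange_toLpCLM (p := 2) (F := ℂ) (E := ℝ) ENNReal.ofNat_ne_top
  refine hd.induction_on (p := fun ξ => translation s (fourierU ξ) = fourierU (modulation s ξ)) ξ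
    (isClosed_eq ((translation s).continuous.comp fourierU.continuous)
      (fourierU.continuous.comp (modulation s).continuous)) fun φ => ?_
  have hn : ∀ t, ‖(Real.fourierChar (s * t) : ℂ) * φ t‖ = ‖φ t‖ := fun t => by
    rw [norm_mul, Circle.norm_coe, one_mul]
  have hm : MemLp (fun t => (Real.fourierChar (s * t) : ℂ) * φ t) 2 := by
    refine (φ.memLp 2).of_le ((memLp_top_fourierChar s).1.mul (φ.memLp 2).1)
      (Eventually.of_forall fun t => (hn t).le)
  have hi : Integrable (fun t => (Real.fourierChar (s * t) : ℂ) * φ t) := by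
    refine (schwartz_integrable φ).mono ((memLp_top_fourierChar s).1.mul (φ.memLp 2).1)
      (Eventually.of_forall fun t => (hn t).le)
  have h1 : modulation s (φ.toLp 2) = hm.toLp := by
    refine mulOp_apply_eq _ ?_
    filter_upwards [hm.coeFn_toLp, φ.coeFn_toLp 2] with t h1 h2
    rw [h1, h2]
  rw [h1]
  apply Lp.ext
  filter_upwards [translation_ae s (fourierU (φ.toLp 2)), fourierU_ae hi hm,
    (measurePreserving_sub_right volume s).quasiMeasurePreserving.ae
      (fourierU_ae (schwartz_integrable φ) (φ.memLp 2))] with x h3 h4 h5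
  rw [h3, h4, fourier_fourierChar_mul, ← h5]
  rfl

theorem regular_ofL1_apply {h : ℝ → ℂ} (hh : Integrable h) (ξ : L2Real) :
    regular (ofL1 (memLp_one_iff_integrable.2 hh).toLp) ξ = ∫ s, h s • translation s ξ := by
  have h1 : ∀ᵐ s : ℝ, (memLp_one_iff_integrable.2 hh).toLp h s • translation s ξ =
      h s • translation s ξ := by
    filter_upwards [(memLp_one_iff_integrable.2 hh).coeFn_toLp] with s hs
    rw [hs]
  exact integral_congr_ae (G := L2Real) h1

theorem integrable_smul_translation {h : ℝ → ℂ} (hh : Integrable h) (ξ : L2Real) :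
    Integrable fun s => h s • translation s ξ := by
  refine hh.smul_bdd ‖ξ‖ (regularRep.continuous_apply ξ).aestronglyMeasurable
    (Eventually.of_forall fun t => ?_)
  exact ((translation t).norm_map ξ).le

/-- Paired with `η`, the left side is the integral of `h` against the inverse Fourier transform of
the integrable function `η̄ ξ`; the multiplication formula moves the transform onto `h`. -/
theorem integral_smul_modulation {h : ℝ → ℂ} (hh : Integrable h) (ξ : L2Real)
    (hi : Integrable fun s => h s • modulation s ξ) :
    ∫ s, h s • modulation s ξ = mulOp volume (𝓕⁻ h) (memLp_top_fourierInv hh) ξ := by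
  refine ext_inner_left ℂ fun η => ?_
  rw [← integral_inner hi]
  have hp : Integrable fun t => star (η t) * ξ t := by
    have := L2.integrable_inner (𝕜 := ℂ) η ξ
    refine this.congr (Eventually.of_forall fun t => ?_)
    simp [mul_comm]
  have h1 : ∀ s, inner ℂ η (h s • modulation s ξ) = h s * 𝓕⁻ (fun t => star (η t) * ξ t) s := by
    intro s
    rw [inner_smul_right, L2.inner_def, Real.fourierInv_eq]
    congr 1
    refine integral_congr_ae ?_
    filter_upwards [mulOp_ae volume _ (memLp_top_fourierChar s) ξ] with t ht
    rw [modulation, ht, Circle.smul_def]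
    simp only [RCLike.inner_apply, RCLike.star_def, smul_eq_mul, conj_trivial]
    ring
  simp only [h1]
  rw [← integral_fourierInv_mul hh hp, L2.inner_def]
  refine integral_congr_ae ?_
  filter_upwards [mulOp_ae volume _ (memLp_top_fourierInv hh) ξ] with t ht
  rw [ht]
  simp only [RCLike.inner_apply, RCLike.star_def]
  ring

/-- The operator `U M(f) U⁻¹` on `L²(ℝ)`. -/
def fourierConj : (L2Real →L[ℂ] L2Real) ≃⋆ₐ[ℂ] (L2Real →L[ℂ] L2Real) :=
  fourierU.conjStarAlgEquiv

theorem fourierConj_apply (T : L2Real →L[ℂ] L2Real) (ξ : L2Real) :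
    fourierConj T ξ = fourierU (T (fourierU.symm ξ)) := rfl

/-- Convolution operators are diagonalized by `U`: each translation is a conjugated modulation, and
the modulations integrate to multiplication by `𝓕⁻ h`. -/
theorem regular_ofL1 {h : ℝ → ℂ} (hh : Integrable h) :
    regular (ofL1 (memLp_one_iff_integrable.2 hh).toLp) =
      fourierConj (mulOp volume (𝓕⁻ h) (memLp_top_fourierInv hh)) := by
  ext1 ξ
  rw [regular_ofL1_apply hh, fourierConj_apply]
  have h1 : ∀ s, translation s ξ = fourierU (modulation s (fourierU.symm ξ)) := by
    intro s
    rw [← translation_fourierU, LinearIsometryEquiv.apply_symm_apply]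
  have hi := integrable_smul_translation hh ξ
  have h2 : ∀ s, h s • modulation s (fourierU.symm ξ) =
      (fourierU.symm : L2Real →L[ℂ] L2Real) (h s • translation s ξ) := by
    intro s
    rw [map_smul, h1]
    simp
  have hi2 : Integrable fun s => h s • modulation s (fourierU.symm ξ) := by
    simp only [h2]
    exact ContinuousLinearMap.integrable_comp _ hi
  rw [← integral_smul_modulation hh _ hi2]
  simp only [h2]
  rw [ContinuousLinearMap.integral_comp_comm _ hi]
  simp

/-! ### Functions on the circle and on the line -/

/-- Away from `1` every point is `exp(iθ)` with `0 < θ < 2π`, and the arctangent form of `cayley`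
exhibits it as a value at `tan((θ - π)/2)`. -/
theorem cayley_cayleyInv {z : Circle} (hz : z ≠ 1) : cayley (cayleyInv z) = z := by
  obtain ⟨φ, hφ⟩ : ∃ φ : ℝ, Circle.exp φ = z := ⟨_, Circle.exp_arg z⟩
  have hp : Function.Periodic Circle.exp (2 * Real.pi) := Circle.periodic_exp
  set θ := toIocMod Real.two_pi_pos 0 φ with hθ
  have hθz : Circle.exp θ = z := by rw [hθ, toIocMod, hp.sub_zsmul_eq, hφ]
  have hm : θ ∈ Set.Ioc 0 (0 + 2 * Real.pi) := toIocMod_mem_Ioc Real.two_pi_pos 0 φ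
  rw [zero_add] at hm
  have hlt : θ < 2 * Real.pi := by
    refine lt_of_le_of_ne hm.2 fun h => hz ?_
    rw [← hθz, h, Circle.exp_two_pi]
  have hc : cayley (Real.tan ((θ - Real.pi) / 2)) = z := by
    rw [cayley_eq_exp, Real.arctan_tan (by linarith [hm.1]) (by linarith), ← hθz]
    congr 1; ring
  rw [← hc, cayleyInv_cayley]

theorem cayley_ne_one (t : ℝ) : cayley t ≠ 1 := fun h => by
  have h1 := congrArg (fun z : Circle => (z : ℂ)) h
  simp only [coe_cayley, Circle.coe_one, div_eq_one_iff_eq (add_I_ne_zero t)] at h1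
  have h2 := congrArg Complex.im h1
  simp at h2
  norm_num at h2

theorem continuousAt_cayleyInv {z : Circle} (hz : z ≠ 1) : ContinuousAt cayleyInv z := by
  have h : (1 : ℂ) - (z : ℂ) ≠ 0 := fun h => hz (Circle.ext (by
    rw [Circle.coe_one]; exact (sub_eq_zero.1 h).symm))
  have hc : ContinuousAt (fun z : Circle => (z : ℂ)) z := continuous_circle_coe.continuousAt
  exact Complex.continuous_re.continuousAt.comp
    ((continuousAt_const.mul (continuousAt_const.add hc)).div (continuousAt_const.sub hc) h)

open Classical in
/-- The extension to the circle by `0` at `1` of a function on the line. -/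
def circleExtend (f : C₀(ℝ, ℂ)) : circleC0 :=
  ⟨⟨fun z => if z = 1 then 0 else f (cayleyInv z), by
    rw [continuous_iff_continuousAt]
    intro z
    by_cases hz : z = 1
    · subst hz
      rw [ContinuousAt, if_pos rfl, Metric.tendsto_nhds]
      intro ε hε
      have h1 := (Metric.tendsto_nhds.1 f.zero_at_infty') ε hε
      obtain ⟨K, hK, hKs⟩ := mem_cocompact.1 h1
      -- The image of a compact set is closed and misses `1`, so points near `1` come from outside
      -- `K`, where `f` is small.
      have h2 : ∀ᶠ z in 𝓝 (1 : Circle), z ∉ cayley '' K :=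
        (hK.image continuous_cayley).isClosed.isOpen_compl.mem_nhds
          fun ⟨t, _, ht⟩ => cayley_ne_one t ht
      filter_upwards [h2] with z hz
      split_ifs with h
      · simpa using hε
      · exact hKs fun hm => hz ⟨_, hm, cayley_cayleyInv h⟩
    · refine ((f.continuous.continuousAt).comp (continuousAt_cayleyInv hz)).congr ?_
      filter_upwards [isOpen_ne.mem_nhds hz] with y hy
      exact (if_neg hy).symm⟩, if_pos rfl⟩

theorem compCayley_circleExtend (f : C₀(ℝ, ℂ)) : compCayley (circleExtend f) = f := by
  ext t
  exact (if_neg (cayley_ne_one t)).trans (by rw [cayleyInv_cayley])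

theorem compCayley_surjective : Function.Surjective compCayley := fun f =>
  ⟨_, compCayley_circleExtend f⟩

theorem compCayley_injective : Function.Injective compCayley := fun f g h => by
  refine Subtype.ext (ContinuousMap.ext fun z => ?_)
  by_cases hz : z = 1
  · rw [hz, show (f : C(Circle, ℂ)) 1 = 0 from f.2, show (g : C(Circle, ℂ)) 1 = 0 from g.2]
  · rw [← cayley_cayleyInv hz]
    exact DFunLike.congr_fun h (cayleyInv z)

/-- The complex conjugate of a Schwartz function. -/
def schwartzConj (φ : SchwartzMap ℝ ℂ) : SchwartzMap ℝ ℂ :=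
  φ.postcompCLM (𝕜 := ℝ) (Complex.conjCLE : ℂ →L[ℝ] ℂ)

theorem schwartzConj_apply (φ : SchwartzMap ℝ ℂ) (x : ℝ) : schwartzConj φ x = star (φ x) := rfl

/-- The product of two Schwartz functions. -/
def schwartzMul (φ ψ : SchwartzMap ℝ ℂ) : SchwartzMap ℝ ℂ :=
  SchwartzMap.pairing (ContinuousLinearMap.mul ℂ ℂ) φ ψ

theorem schwartzMul_apply (φ ψ : SchwartzMap ℝ ℂ) (x : ℝ) :
    schwartzMul φ ψ x = φ x * ψ x := rfl

/-- The functions on the circle that are the sum of a constant and a Schwartz function on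
the line. -/
def circleSchwartz : StarSubalgebra ℂ C(Circle, ℂ) where
  carrier := {f | ∃ (c : ℂ) (φ : SchwartzMap ℝ ℂ), ∀ t, f (cayley t) = c + φ t}
  mul_mem' := by
    rintro f g ⟨c, φ, hf⟩ ⟨d, ψ, hg⟩
    refine ⟨c * d, c • ψ + d • φ + schwartzMul φ ψ, fun t => ?_⟩
    rw [ContinuousMap.mul_apply, hf, hg, add_apply, add_apply, smul_apply, smul_apply,
      schwartzMul_apply, smul_eq_mul, smul_eq_mul]
    ring
  add_mem' := by
    rintro f g ⟨c, φ, hf⟩ ⟨d, ψ, hg⟩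
    refine ⟨c + d, φ + ψ, fun t => ?_⟩
    rw [ContinuousMap.add_apply, hf, hg, add_apply]
    ring
  algebraMap_mem' r := ⟨r, 0, fun t => by simp⟩
  star_mem' := by
    rintro f ⟨c, φ, hf⟩
    refine ⟨star c, schwartzConj φ, fun t => ?_⟩
    rw [ContinuousMap.star_apply, hf, star_add, schwartzConj_apply]

/-- A smooth bump centred at one of the two points, transplanted to the circle, vanishes at the
other. At least one of them is not `1` and can serve as the centre. -/
theorem circleSchwartz_separatesPoints : circleSchwartz.SeparatesPoints := by
  have key : ∀ (a : ℝ) (y : Circle), cayley a ≠ y → ∃ f ∈ circleSchwartz, f (cayley a) ≠ f y := by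
    intro a y hay
    have hb : a ≠ cayleyInv y ∨ y = 1 := by
      by_cases hy : y = 1
      · exact Or.inr hy
      · exact Or.inl fun h => hay (by rw [h, cayley_cayleyInv hy])
    obtain ⟨r, hr, hyr⟩ : ∃ r > 0, r < dist (cayleyInv y) a ∨ y = 1 := by
      rcases hb with h | h
      · have := dist_pos.2 h.symm
        exact ⟨_, half_pos this, Or.inl (half_lt_self this)⟩
      · exact ⟨1, one_pos, Or.inr h⟩
    let χ : ContDiffBump a := ⟨r / 2, r, half_pos hr, half_lt_self hr⟩
    have hs : HasCompactSupport fun x => (χ x : ℂ) :=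
      χ.hasCompactSupport.comp_left (g := Complex.ofReal) rfl
    have hd : ContDiff ℝ (⊤ : ℕ∞) fun x => (χ x : ℂ) := Complex.ofRealCLM.contDiff.comp χ.contDiff
    let φ : SchwartzMap ℝ ℂ := hs.toSchwartzMap hd
    have hφ : ∀ t, (circleExtend φ.toZeroAtInfty : C(Circle, ℂ)) (cayley t) = χ t := fun t =>
      DFunLike.congr_fun (compCayley_circleExtend φ.toZeroAtInfty) t
    refine ⟨circleExtend φ.toZeroAtInfty, ⟨0, φ, fun t => by rw [hφ, zero_add]; rfl⟩, ?_⟩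
    have h0 : (circleExtend φ.toZeroAtInfty : C(Circle, ℂ)) y = 0 := by
      by_cases hy : y = 1
      · rw [hy]; exact (circleExtend φ.toZeroAtInfty).2
      · rw [← cayley_cayleyInv hy, hφ, Complex.ofReal_eq_zero]
        exact χ.zero_of_le_dist (hyr.resolve_right hy).le
    rw [h0, hφ, χ.one_of_mem_closedBall (Metric.mem_closedBall_self (half_pos hr).le)]
    simp
  intro x y hxy
  by_cases hx : x = 1
  · have hy : y ≠ 1 := fun h => hxy (hx.trans h.symm)
    obtain ⟨f, hf, h⟩ := key (cayleyInv y) x (by rw [cayley_cayleyInv hy]; exact hxy.symm)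
    rw [cayley_cayleyInv hy] at h
    exact ⟨f, ⟨f, hf, rfl⟩, h.symm⟩
  · obtain ⟨f, hf, h⟩ := key (cayleyInv x) y (by rw [cayley_cayleyInv hx]; exact hxy)
    rw [cayley_cayleyInv hx] at h
    exact ⟨f, ⟨f, hf, rfl⟩, h⟩

/-- Schwartz functions are dense in `C₀(ℝ)`. -/
theorem denseRange_toZeroAtInfty :
    DenseRange (SchwartzMap.toZeroAtInftyCLM ℂ ℝ ℂ) := by
  intro f
  rw [Metric.mem_closure_iff]
  intro ε hε
  have hmem : (circleExtend f : C(Circle, ℂ)) ∈ circleSchwartz.topologicalClosure := by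
    rw [ContinuousMap.starSubalgebra_topologicalClosure_eq_top_of_separatesPoints _
      circleSchwartz_separatesPoints]
    exact StarSubalgebra.mem_top
  obtain ⟨g, ⟨c, φ, hg⟩, hfg⟩ := Metric.mem_closure_iff.1 hmem (ε / 3) (by positivity)
  -- The constant part is the value at the point at infinity. As the extended `f` vanishes there,
  -- the constant is small and can be dropped.
  have hg1 : g 1 = c := by
    have h1 : Tendsto (fun t => g (cayley t)) (cocompact ℝ) (𝓝 (g 1)) :=
      (g.continuous.tendsto 1).comp tendsto_cayley
    have h2 : Tendsto (fun t => c + φ t) (cocompact ℝ) (𝓝 (c + 0)) :=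
      tendsto_const_nhds.add (φ.toZeroAtInfty.zero_at_infty')
    simp only [hg] at h1
    rw [add_zero] at h2
    exact tendsto_nhds_unique h1 h2
  have hd : ∀ z, ‖(circleExtend f : C(Circle, ℂ)) z - g z‖ < ε / 3 := fun z => by
    rw [← dist_eq_norm]
    exact (ContinuousMap.dist_apply_le_dist z).trans_lt hfg
  have hc : ‖c‖ < ε / 3 := by
    have := hd 1
    rwa [show (circleExtend f : C(Circle, ℂ)) 1 = 0 from (circleExtend f).2, hg1, zero_sub,
      norm_neg] at this
  refine ⟨_, ⟨φ, rfl⟩, ?_⟩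
  rw [dist_eq_norm, ← ZeroAtInftyContinuousMap.norm_toBCF_eq_norm]
  refine lt_of_le_of_lt ((BoundedContinuousFunction.norm_le (C := 2 * (ε / 3))
    (by positivity)).2 fun t => ?_) (by linarith)
  change ‖f t - φ t‖ ≤ _
  have h1 := hd (cayley t)
  rw [hg, show (circleExtend f : C(Circle, ℂ)) (cayley t) = f t from
    DFunLike.congr_fun (compCayley_circleExtend f) t] at h1
  have h2 := norm_add_le (f t - (c + φ t)) c
  rw [show f t - (c + φ t) + c = f t - φ t by ring] at h2
  linarith

/-! ### Integrated forms on Schwartz functions -/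

/-- Derived from the convolution theorem by inversion, using that the double transform is reflection
`x ↦ -x`. -/
theorem fourier_schwartzMul (φ ψ : SchwartzMap ℝ ℂ) :
    𝓕 (schwartzMul φ ψ) = SchwartzMap.convolution (ContinuousLinearMap.mul ℂ ℂ) (𝓕 φ) (𝓕 ψ) := by
  have h := SchwartzMap.fourier_convolution (ContinuousLinearMap.mul ℂ ℂ) (𝓕 φ) (𝓕 ψ)
  have key : 𝓕⁻ (SchwartzMap.convolution (ContinuousLinearMap.mul ℂ ℂ) (𝓕 φ) (𝓕 ψ)) =
      schwartzMul φ ψ := by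
    ext x
    have e : ∀ χ : SchwartzMap ℝ ℂ, (𝓕⁻ χ) x = (𝓕 χ) (-x) := by
      intro χ
      rw [SchwartzMap.fourierInv_coe, SchwartzMap.fourier_coe, Real.fourierInv_eq_fourier_neg]
    have e2 : ∀ χ : SchwartzMap ℝ ℂ, χ x = (𝓕 (𝓕 χ)) (-x) := by
      intro χ
      rw [← e, FourierTransform.fourierInv_fourier_eq]
    rw [e, h, SchwartzMap.pairing_apply_apply, schwartzMul_apply, e2 φ, e2 ψ]
    rfl
  rw [← key, FourierTransform.fourier_fourierInv_eq]

theorem fourier_schwartzConj (φ : SchwartzMap ℝ ℂ) (x : ℝ) :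
    𝓕 (schwartzConj φ) x = star (𝓕 φ (-x)) := by
  rw [SchwartzMap.fourier_coe, SchwartzMap.fourier_coe, Real.fourier_real_eq,
    Real.fourier_real_eq, RCLike.star_def, ← integral_conj]
  congr 1
  ext t
  rw [Circle.smul_def, Circle.smul_def, smul_eq_mul, smul_eq_mul, map_mul, schwartzConj_apply,
    ← Circle.coe_inv_eq_conj, ← AddChar.map_neg_eq_inv]
  simp

namespace UnitaryRep

variable (π : UnitaryRep)

theorem integrated_toLp {h : ℝ → ℂ} (hh : MemLp h 1) (ξ : π.carrier) :
    π.integrated hh.toLp ξ = ∫ t, h t • π.u t ξ := by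
  rw [integrated_apply]
  refine integral_congr_ae ?_
  filter_upwards [hh.coeFn_toLp] with s hs
  rw [hs]

theorem integrable_smul' {h : ℝ → ℂ} (hh : Integrable h) (ξ : π.carrier) :
    Integrable (fun t => h t • π.u t ξ) := by
  refine hh.smul_bdd ‖ξ‖ (π.continuous_apply ξ).aestronglyMeasurable
    (Eventually.of_forall fun t => ?_)
  exact ((π.u t).norm_map ξ).le

theorem u_zero (ξ : π.carrier) : π.u 0 ξ = ξ := by
  have h := π.map_add 0 0 ξ
  rw [add_zero] at h
  exact ((π.u 0).injective h).symm

theorem inner_u_left (t : ℝ) (ξ η : π.carrier) :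
    Inner.inner ℂ (π.u t ξ) η = Inner.inner ℂ ξ (π.u (-t) η) := by
  rw [← (π.u (-t)).inner_map_map, ← π.map_add, neg_add_cancel, u_zero]

/-- The integrated form of `π`, evaluated at the Fourier transform of a Schwartz function. -/
def schwartz (φ : SchwartzMap ℝ ℂ) : π.carrier →L[ℂ] π.carrier :=
  π.integrated ((𝓕 φ).toLp 1)

theorem schwartz_apply (φ : SchwartzMap ℝ ℂ) (ξ : π.carrier) :
    π.schwartz φ ξ = ∫ t, 𝓕 φ t • π.u t ξ :=
  π.integrated_toLp _ ξ

theorem star_schwartz (φ : SchwartzMap ℝ ℂ) :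
    star (π.schwartz φ) = π.schwartz (schwartzConj φ) := by
  rw [ContinuousLinearMap.star_eq_adjoint, eq_comm, ContinuousLinearMap.eq_adjoint_iff]
  intro ξ η
  rw [schwartz_apply, schwartz_apply,
    ← integral_inner (π.integrable_smul' (𝓕 φ).integrable η), ← inner_conj_symm,
    ← integral_inner (π.integrable_smul' (𝓕 (schwartzConj φ)).integrable ξ), ← integral_conj,
    ← integral_neg_eq_self]
  congr 1
  ext t
  rw [inner_conj_symm, inner_smul_left, inner_smul_right, inner_u_left, neg_neg,
    fourier_schwartzConj, neg_neg, RCLike.star_def, RCLike.conj_conj]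

/-- The Fourier transform turns the pointwise product into convolution, and Fubini with the
substitution `r ↦ r - t` turns convolution into composition. -/
theorem schwartz_mul (φ ψ : SchwartzMap ℝ ℂ) :
    π.schwartz (schwartzMul φ ψ) = π.schwartz φ * π.schwartz ψ := by
  ext1 ξ
  rw [mul_apply_eq_comp, schwartz_apply, schwartz_apply, fourier_schwartzMul]
  set a := 𝓕 φ
  set b := 𝓕 ψ
  have h1 : ∀ t, a t • π.u t (π.schwartz ψ ξ) = ∫ r, (a t * b (r - t)) • π.u r ξ := by
    intro t
    have hc := ((π.u t).toContinuousLinearEquiv : π.carrier →L[ℂ] π.carrier).integral_comp_comm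
      (π.integrable_smul' b.integrable ξ)
    have : π.u t (π.schwartz ψ ξ) = ∫ r, b r • π.u (t + r) ξ := by
      rw [schwartz_apply]
      refine hc.symm.trans ?_
      congr 1
      ext r
      rw [map_smul, π.map_add]
      rfl
    rw [this, ← integral_smul, ← integral_sub_right_eq_self _ t]
    congr 1
    ext r
    rw [smul_smul, add_sub_cancel]
  simp only [h1]
  have hint : Integrable (fun p : ℝ × ℝ => (a p.1 * b (p.2 - p.1)) • π.u p.2 ξ)
      (volume.prod volume) := by
    have h2 := (a.integrable (μ := volume)).convolution_integrand (ContinuousLinearMap.mul ℂ ℂ)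
      (b.integrable (μ := volume))
    have h3 := h2.swap
    refine h3.smul_bdd ‖ξ‖ ((π.continuous_apply ξ).comp continuous_snd).aestronglyMeasurable
      (Eventually.of_forall fun p => ((π.u p.2).norm_map ξ).le)
  rw [integral_integral_swap hint]
  congr 1
  ext r
  rw [SchwartzMap.convolution_apply, MeasureTheory.convolution, integral_smul_const]
  rfl

theorem schwartz_add (φ ψ : SchwartzMap ℝ ℂ) :
    π.schwartz (φ + ψ) = π.schwartz φ + π.schwartz ψ := by
  ext1 ξ
  rw [add_apply, schwartz_apply, schwartz_apply, schwartz_apply, ← integral_add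
    (π.integrable_smul' (𝓕 φ).integrable ξ) (π.integrable_smul' (𝓕 ψ).integrable ξ),
    FourierTransform.fourier_add]
  simp only [add_apply, add_smul]

theorem schwartz_smul (c : ℂ) (φ : SchwartzMap ℝ ℂ) :
    π.schwartz (c • φ) = c • π.schwartz φ := by
  ext1 ξ
  rw [smul_apply, schwartz_apply, schwartz_apply, ← integral_smul,
    FourierTransform.fourier_smul]
  simp only [smul_apply, smul_assoc]

end UnitaryRep

/-! ### The norm of the integrated forms -/

/-- Only values of `u = |φ|²` up to `M² < c²` matter. Cutting off before the square root becomes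
singular at `c²` gives a smooth function of compact support, hence of temperate growth. -/
theorem exists_contDiff_sqrt {M c : ℝ} (hM : 0 ≤ M) (hMc : M < c) :
    ∃ g : ℝ → ℝ, g.HasTemperateGrowth ∧
      ∀ u ∈ Set.Icc 0 (M ^ 2), g u = (c + Real.sqrt (c ^ 2 - u))⁻¹ := by
  have hc : 0 < c := hM.trans_lt hMc
  have hMc2 : M ^ 2 < c ^ 2 := by nlinarith
  -- The inner and outer radii are the points dividing `[M², c²]` into thirds.
  let χ : ContDiffBump (0 : ℝ) :=
    ⟨(2 * M ^ 2 + c ^ 2) / 3, (M ^ 2 + 2 * c ^ 2) / 3, by positivity, by linarith⟩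
  refine ⟨fun u => χ u * (c + Real.sqrt (c ^ 2 - u))⁻¹, ?_, fun u hu => ?_⟩
  · refine HasCompactSupport.hasTemperateGrowth χ.hasCompactSupport.mul_right ?_
    rw [contDiff_iff_contDiffAt]
    intro u
    by_cases hu : u < c ^ 2
    · have h1 : (c ^ 2 - u) ≠ 0 := by linarith
      have h2 : c + Real.sqrt (c ^ 2 - u) ≠ 0 := by positivity
      exact χ.contDiff.contDiffAt.mul
        ((contDiffAt_const.add ((contDiffAt_const.sub contDiffAt_id).sqrt h1)).inv h2)
    · refine (contDiffAt_const (c := (0 : ℝ))).congr_of_eventuallyEq ?_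
      have h3 : (M ^ 2 + 2 * c ^ 2) / 3 < u := by push Not at hu; linarith
      filter_upwards [lt_mem_nhds h3] with v hv
      rw [χ.zero_of_le_dist, zero_mul]
      rw [Real.dist_eq, sub_zero]
      exact hv.le.trans (le_abs_self v)
  · change χ u * _ = _
    rw [χ.one_of_mem_closedBall, one_mul]
    rw [mem_closedBall_zero_iff, Real.norm_eq_abs, abs_of_nonneg hu.1]
    change u ≤ (2 * M ^ 2 + c ^ 2) / 3
    linarith [hu.2]

theorem norm_le_norm_toZeroAtInfty (φ : SchwartzMap ℝ ℂ) (t : ℝ) : ‖φ t‖ ≤ ‖φ.toZeroAtInfty‖ := by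
  rw [← ZeroAtInftyContinuousMap.norm_toBCF_eq_norm]
  exact φ.toZeroAtInfty.toBCF.norm_coe_le_norm t

/-- The function `k = c - √(c² - |φ|²)` is a Schwartz function. -/
theorem exists_schwartz_sqrt (φ : SchwartzMap ℝ ℂ) {c : ℝ} (hc : ‖φ.toZeroAtInfty‖ < c) :
    ∃ k : SchwartzMap ℝ ℂ, schwartzConj k = k ∧
      schwartzMul (schwartzConj φ) φ + schwartzMul k k = (2 * c : ℂ) • k := by
  have hM := norm_nonneg φ.toZeroAtInfty
  obtain ⟨g, hg, hgu⟩ := exists_contDiff_sqrt hM hc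
  have hg2 : (fun t => g (‖φ t‖ ^ 2)).HasTemperateGrowth :=
    hg.comp ((Function.hasTemperateGrowth_norm_sq (H := ℂ)).comp φ.hasTemperateGrowth)
  -- With `s = √(c² - |φ|²)` one has `c - s = |φ|²/(c + s)`; the factor `|φ|²` provides the Schwartz
  -- decay.
  have hk : ∀ t, SchwartzMap.smulLeftCLM ℂ (fun t => g (‖φ t‖ ^ 2))
      (schwartzMul (schwartzConj φ) φ) t =
      (((c + Real.sqrt (c ^ 2 - ‖φ t‖ ^ 2))⁻¹ * ‖φ t‖ ^ 2 : ℝ) : ℂ) := by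
    intro t
    rw [SchwartzMap.smulLeftCLM_apply_apply hg2, hgu _ ⟨by positivity,
      pow_le_pow_left₀ (norm_nonneg _) (norm_le_norm_toZeroAtInfty φ t) 2⟩, schwartzMul_apply,
      schwartzConj_apply, RCLike.star_def, RCLike.conj_mul, Complex.real_smul]
    push_cast
    rfl
  refine ⟨SchwartzMap.smulLeftCLM ℂ (fun t => g (‖φ t‖ ^ 2)) (schwartzMul (schwartzConj φ) φ),
    ?_, ?_⟩
  · ext t
    rw [schwartzConj_apply, hk, RCLike.star_def, Complex.conj_ofReal]
  · ext t
    rw [_root_.add_apply, _root_.smul_apply, schwartzMul_apply, schwartzMul_apply, hk,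
      schwartzConj_apply, RCLike.star_def, RCLike.conj_mul, smul_eq_mul]
    have h1 : ‖φ t‖ ^ 2 ≤ c ^ 2 := pow_le_pow_left₀ (norm_nonneg _)
      ((norm_le_norm_toZeroAtInfty φ t).trans hc.le) 2
    have hs := Real.sq_sqrt (sub_nonneg.2 h1)
    set s := Real.sqrt (c ^ 2 - ‖φ t‖ ^ 2)
    have hs0 : 0 ≤ s := Real.sqrt_nonneg _
    have hcs : c + s ≠ 0 := by linarith
    have h2 : ‖φ t‖ ^ 2 + ((c + s)⁻¹ * ‖φ t‖ ^ 2) * ((c + s)⁻¹ * ‖φ t‖ ^ 2) =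
        2 * c * ((c + s)⁻¹ * ‖φ t‖ ^ 2) := by
      have h3 : ‖φ t‖ ^ 2 = (c + s) * (c - s) := by linarith
      rw [h3, inv_mul_cancel_left₀ hcs]
      ring
    have h4 := congrArg (fun r : ℝ => (r : ℂ)) h2
    push_cast at h4 ⊢
    exact h4

/-- For `c > ‖φ‖∞` the Schwartz function `k = c - √(c² - |φ|²)` satisfies `φ̄φ + k² = 2ck`. Applying
`π` and pairing with `ξ` gives `‖π(φ̂)ξ‖² + ‖π(k̂)ξ‖² ≤ 2c‖ξ‖‖π(k̂)ξ‖`, and completing the square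
bounds the first term by `c²‖ξ‖²`. -/
theorem UnitaryRep.norm_schwartz_le (π : UnitaryRep) (φ : SchwartzMap ℝ ℂ) :
    ‖π.schwartz φ‖ ≤ ‖φ.toZeroAtInfty‖ := by
  refine le_of_forall_gt_imp_ge_of_dense fun c hc => ?_
  have hc0 : 0 < c := (norm_nonneg _).trans_lt hc
  obtain ⟨k, hk1, hk2⟩ := exists_schwartz_sqrt φ hc
  have h1 : star (π.schwartz φ) * π.schwartz φ + star (π.schwartz k) * π.schwartz k =
      (2 * c : ℂ) • π.schwartz k := by
    rw [star_schwartz, star_schwartz, hk1, ← schwartz_mul, ← schwartz_mul, ← schwartz_add, hk2,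
      schwartz_smul]
  refine ContinuousLinearMap.opNorm_le_bound _ hc0.le fun ξ => ?_
  have h2 := congrArg (fun T : π.carrier →L[ℂ] π.carrier => RCLike.re (Inner.inner ℂ ξ (T ξ))) h1
  simp only [_root_.add_apply, mul_apply_eq_comp, _root_.smul_apply, inner_add_right,
    ContinuousLinearMap.star_eq_adjoint, ContinuousLinearMap.adjoint_inner_right,
    _root_.map_add,
    inner_self_eq_norm_sq, inner_smul_right] at h2
  have h3 : RCLike.re ((2 * c : ℂ) * Inner.inner ℂ ξ (π.schwartz k ξ)) =
      2 * c * RCLike.re (Inner.inner ℂ ξ (π.schwartz k ξ)) := by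
    rw [show (2 * c : ℂ) = ((2 * c : ℝ) : ℂ) by push_cast; rfl]
    exact Complex.re_ofReal_mul _ _
  rw [h3] at h2
  have h4 : RCLike.re (Inner.inner ℂ ξ (π.schwartz k ξ)) ≤ ‖ξ‖ * ‖π.schwartz k ξ‖ :=
    (RCLike.re_le_norm _).trans (norm_inner_le_norm _ _)
  refine le_of_sq_le_sq ?_ (by positivity)
  nlinarith [sq_nonneg (c * ‖ξ‖ - ‖π.schwartz k ξ‖)]

/-! ### The isomorphism of `C₀(ℝ)` with `C*(ℝ)` -/

theorem integrated_add (π : UnitaryRep) (f g : Lp ℂ 1 (volume : Measure ℝ)) :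
    π.integrated (f + g) = π.integrated f + π.integrated g := by
  ext1 ξ
  rw [_root_.add_apply, π.integrated_apply, π.integrated_apply, π.integrated_apply,
    ← integral_add (π.integrable_smul f ξ) (π.integrable_smul g ξ)]
  refine integral_congr_ae ?_
  filter_upwards [Lp.coeFn_add f g] with t ht
  rw [ht, Pi.add_apply, add_smul]

theorem integrated_smul (π : UnitaryRep) (c : ℂ) (f : Lp ℂ 1 (volume : Measure ℝ)) :
    π.integrated (c • f) = c • π.integrated f := by
  ext1 ξ
  rw [_root_.smul_apply, π.integrated_apply, π.integrated_apply, ← integral_smul]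
  refine integral_congr_ae ?_
  filter_upwards [Lp.coeFn_smul c f] with t ht
  rw [ht, Pi.smul_apply, smul_assoc]

theorem groupCStar_ext {a b : GroupCStar} (h : ∀ π : UnitaryRep,
    π.integratedForm a = π.integratedForm b) : a = b :=
  Subtype.ext (Subtype.ext (funext h))

theorem groupCStar_norm_le {a : GroupCStar} {C : ℝ} (hC : 0 ≤ C)
    (h : ∀ π : UnitaryRep, ‖π.integratedForm a‖ ≤ C) : ‖a‖ ≤ C :=
  lp.norm_le_of_forall_le hC h

/-- The canonical map `L¹(ℝ) → C*(ℝ)` as a continuous linear map. -/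
def ofL1CLM : Lp ℂ 1 (volume : Measure ℝ) →L[ℂ] GroupCStar :=
  LinearMap.mkContinuous
    { toFun := ofL1
      map_add' := fun f g => groupCStar_ext fun π => by
        rw [map_add]
        exact integrated_add π f g
      map_smul' := fun c f => groupCStar_ext fun π => by
        rw [map_smul]
        exact integrated_smul π c f } 1 fun f => by
    rw [one_mul]
    exact groupCStar_norm_le (norm_nonneg f) fun π => π.norm_integrated_le f

/-- The map `φ ↦ 𝓕φ` from Schwartz functions to `C*(ℝ)`. -/
def schwartzGroup : SchwartzMap ℝ ℂ →L[ℂ] GroupCStar :=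
  ofL1CLM ∘L SchwartzMap.toLpCLM ℂ ℂ 1 volume ∘L FourierTransform.fourierCLM ℂ (SchwartzMap ℝ ℂ)

theorem schwartzGroup_mul (φ ψ : SchwartzMap ℝ ℂ) :
    schwartzGroup (schwartzMul φ ψ) = schwartzGroup φ * schwartzGroup ψ :=
  groupCStar_ext fun π => by
    rw [map_mul]
    exact π.schwartz_mul φ ψ

theorem schwartzGroup_star (φ : SchwartzMap ℝ ℂ) :
    schwartzGroup (schwartzConj φ) = star (schwartzGroup φ) :=
  groupCStar_ext fun π => by
    rw [map_star]
    exact (π.star_schwartz φ).symm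

/-- The range is a `*`-algebra. Schwartz functions are dense in `L¹` and are all Fourier transforms
of Schwartz functions, so its closure contains the generators of `C*(ℝ)`. -/
theorem denseRange_schwartzGroup : DenseRange schwartzGroup := by
  let R : NonUnitalStarSubalgebra ℂ UniversalProduct :=
    { carrier := Set.range fun φ => (schwartzGroup φ).1
      add_mem' := by
        rintro _ _ ⟨φ, rfl⟩ ⟨ψ, rfl⟩
        exact ⟨φ + ψ, congrArg Subtype.val (map_add schwartzGroup φ ψ)⟩
      zero_mem' := ⟨0, congrArg Subtype.val (map_zero schwartzGroup)⟩
      mul_mem' := by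
        rintro _ _ ⟨φ, rfl⟩ ⟨ψ, rfl⟩
        exact ⟨schwartzMul φ ψ, congrArg Subtype.val (schwartzGroup_mul φ ψ)⟩
      smul_mem' := by
        rintro c _ ⟨φ, rfl⟩
        exact ⟨c • φ, congrArg Subtype.val (map_smul schwartzGroup c φ)⟩
      star_mem' := by
        rintro _ ⟨φ, rfl⟩
        exact ⟨schwartzConj φ, congrArg Subtype.val (schwartzGroup_star φ)⟩ }
  have hval : Isometry (Subtype.val : GroupCStar → UniversalProduct) := isometry_subtype_coe
  have hle : groupCStarSubalgebra ≤ R.topologicalClosure := by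
    refine NonUnitalStarSubalgebra.topologicalClosure_minimal _ (NonUnitalStarAlgebra.adjoin_le ?_)
      R.isClosed_topologicalClosure
    rintro _ ⟨f, rfl⟩
    have hd : DenseRange fun φ : SchwartzMap ℝ ℂ => (𝓕 φ).toLp 1 volume :=
      (SchwartzMap.denseRange_toLpCLM ENNReal.one_ne_top).comp
        (FourierTransform.fourierCLE ℂ (SchwartzMap ℝ ℂ)).surjective.denseRange
        (SchwartzMap.toLpCLM ℝ ℂ 1 volume).continuous
    have hcl : IsClosed {f : Lp ℂ 1 (volume : Measure ℝ) |
        (ofL1CLM f).1 ∈ R.topologicalClosure} :=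
      R.isClosed_topologicalClosure.preimage (hval.continuous.comp ofL1CLM.continuous)
    exact hd.induction_on (p := fun f => (ofL1CLM f).1 ∈ R.topologicalClosure) f hcl
      fun φ => R.le_topologicalClosure ⟨φ, rfl⟩
  intro a
  have ha : a.1 ∈ closure (R : Set UniversalProduct) := hle a.2
  rw [Metric.mem_closure_iff] at ha ⊢
  intro ε hε
  obtain ⟨_, ⟨φ, rfl⟩, h⟩ := ha ε hε
  exact ⟨_, ⟨φ, rfl⟩, h⟩

theorem memLp_top_zeroAtInfty (b : C₀(ℝ, ℂ)) : MemLp b ∞ (volume : Measure ℝ) :=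
  memLp_top_of_bound b.continuous.aestronglyMeasurable ‖b.toBCF‖
    (Eventually.of_forall fun x => b.toBCF.norm_coe_le_norm x)

/-- The multiplication representation of `C₀(ℝ)` on `L²(ℝ)`. -/
def realMul : C₀(ℝ, ℂ) →⋆ₙₐ[ℂ] (L2Real →L[ℂ] L2Real) where
  toFun b := mulOp volume b (memLp_top_zeroAtInfty b)
  map_smul' c b := (mulOp_smul (memLp_top_zeroAtInfty b) (memLp_top_zeroAtInfty (c • b)) c
    (Eventually.of_forall fun _ => rfl)).symm
  map_zero' := by
    ext1 ξ
    refine mulOp_apply_eq _ ?_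
    filter_upwards [Lp.coeFn_zero ℂ 2 (volume : Measure ℝ)] with x h2
    rw [_root_.zero_apply, h2]
    exact (zero_mul _).symm
  map_add' b c := (mulOp_add (memLp_top_zeroAtInfty b) (memLp_top_zeroAtInfty c)
    (memLp_top_zeroAtInfty (b + c)) (Eventually.of_forall fun _ => rfl)).symm
  map_mul' b c := (mulOp_mul (memLp_top_zeroAtInfty b) (memLp_top_zeroAtInfty c)
    (memLp_top_zeroAtInfty (b * c)) (Eventually.of_forall fun _ => rfl)).symm
  map_star' b := (star_mulOp _ _ (Eventually.of_forall fun _ => rfl)).symm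

theorem cayleyW_monomial_ae (n : ℤ) :
    ∀ᵐ t : ℝ, cayleyW (monomial n) t = weight t * circlePow n (cayley t) := by
  filter_upwards [(memLp_cayley (monomial n)).coeFn_toLp,
    quasi_cayley.ae (monomial_ae n)] with t h1 h2
  rw [← h2]
  exact h1

/-- Tested on `W(1) = √2/(t+i)`, which vanishes nowhere. -/
theorem realMul_injective : Function.Injective realMul := by
  rw [injective_iff_map_eq_zero]
  intro b hb
  have h1 : ∀ᵐ t : ℝ, b t = 0 := by
    filter_upwards [mulOp_ae volume b (memLp_top_zeroAtInfty b) (cayleyW (monomial 0)),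
      cayleyW_monomial_ae 0, Lp.coeFn_zero ℂ 2 (volume : Measure ℝ)] with t h1 h2 h3
    have h4 : mulOp volume b (memLp_top_zeroAtInfty b) (cayleyW (monomial 0)) = 0 := by
      change realMul b _ = 0
      rw [hb, _root_.zero_apply]
    rw [h4, h3, h2] at h1
    simpa [weight_ne_zero, circlePow_apply] using h1.symm
  ext t
  exact congrFun ((b.continuous.ae_eq_iff_eq volume continuous_const).1 h1) t

theorem norm_realMul (b : C₀(ℝ, ℂ)) : ‖realMul b‖ = ‖b‖ :=
  NonUnitalStarAlgHom.norm_map realMul realMul_injective b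

theorem norm_fourierConj (T : L2Real →L[ℂ] L2Real) : ‖fourierConj T‖ = ‖T‖ :=
  NonUnitalStarAlgHom.norm_map fourierConj (EquivLike.injective fourierConj) T

theorem regular_schwartzGroup (φ : SchwartzMap ℝ ℂ) :
    regular (schwartzGroup φ) = fourierConj (realMul φ.toZeroAtInfty) := by
  refine (regular_ofL1 (𝓕 φ : SchwartzMap ℝ ℂ).integrable).trans (congrArg fourierConj ?_)
  have h : 𝓕⁻ (⇑(𝓕 φ : SchwartzMap ℝ ℂ)) = φ := by
    rw [← SchwartzMap.fourierInv_coe, FourierTransform.fourierInv_fourier_eq]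
  ext1 ξ
  refine mulOp_apply_eq _ ?_
  filter_upwards [mulOp_ae volume _ (memLp_top_zeroAtInfty φ.toZeroAtInfty) ξ] with x hx
  exact hx.trans (congrArg (fun g : ℝ → ℂ => g x * ξ x) h.symm)

/-- The upper bound holds in every representation; the regular one, unitarily equivalent to
multiplication by `φ`, attains it. -/
theorem norm_schwartzGroup (φ : SchwartzMap ℝ ℂ) :
    ‖schwartzGroup φ‖ = ‖φ.toZeroAtInfty‖ := by
  refine le_antisymm (groupCStar_norm_le (norm_nonneg _) fun π => π.norm_schwartz_le φ) ?_
  rw [← norm_realMul, ← norm_fourierConj, ← regular_schwartzGroup]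
  exact NonUnitalStarAlgHom.norm_apply_le regular _

theorem exists_linearIsometryEquiv_of_dense {E F G : Type*} [AddCommGroup E] [Module ℂ E]
    [NormedAddCommGroup F] [NormedSpace ℂ F] [CompleteSpace F] [NormedAddCommGroup G]
    [NormedSpace ℂ G] [CompleteSpace G] (e₁ : E →ₗ[ℂ] F) (e₂ : E →ₗ[ℂ] G) (h₁ : DenseRange e₁)
    (h₂ : DenseRange e₂) (h : ∀ x, ‖e₂ x‖ = ‖e₁ x‖) :
    ∃ f : F ≃ₗᵢ[ℂ] G, ∀ x, f (e₁ x) = e₂ x :=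
  ⟨(LinearEquiv.refl ℂ E).extendOfIsometry e₁ e₂ h₁ h₂ h, fun x =>
    LinearEquiv.extendOfIsometry_eq (LinearEquiv.refl ℂ E) e₁ e₂ h₁ h₂ h x⟩

theorem exists_fourierIsometry : ∃ f : C₀(ℝ, ℂ) ≃ₗᵢ[ℂ] GroupCStar,
    ∀ φ : SchwartzMap ℝ ℂ, f φ.toZeroAtInfty = schwartzGroup φ :=
  exists_linearIsometryEquiv_of_dense
    (SchwartzMap.toZeroAtInftyCLM ℂ ℝ ℂ : SchwartzMap ℝ ℂ →ₗ[ℂ] C₀(ℝ, ℂ))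
    (schwartzGroup : SchwartzMap ℝ ℂ →ₗ[ℂ] GroupCStar)
    denseRange_toZeroAtInfty denseRange_schwartzGroup norm_schwartzGroup

/-- The isometric extension to `C₀(ℝ)` of the Fourier transform of Schwartz functions. -/
def fourierIsometry : C₀(ℝ, ℂ) ≃ₗᵢ[ℂ] GroupCStar := exists_fourierIsometry.choose

theorem fourierIsometry_toZeroAtInfty (φ : SchwartzMap ℝ ℂ) :
    fourierIsometry φ.toZeroAtInfty = schwartzGroup φ := exists_fourierIsometry.choose_spec φ

theorem zeroAtInfty_induction {p : C₀(ℝ, ℂ) → Prop} (hp : IsClosed {b | p b})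
    (h : ∀ φ : SchwartzMap ℝ ℂ, p φ.toZeroAtInfty) (b : C₀(ℝ, ℂ)) : p b :=
  denseRange_toZeroAtInfty.induction_on b hp h

theorem toZeroAtInfty_schwartzMul (φ ψ : SchwartzMap ℝ ℂ) :
    (schwartzMul φ ψ).toZeroAtInfty = φ.toZeroAtInfty * ψ.toZeroAtInfty := rfl

theorem toZeroAtInfty_schwartzConj (φ : SchwartzMap ℝ ℂ) :
    (schwartzConj φ).toZeroAtInfty = star φ.toZeroAtInfty := rfl

/-- The isomorphism of `C₀(ℝ)` with `C*(ℝ)` given by the Fourier transform. -/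
def fourierEquiv : C₀(ℝ, ℂ) ≃⋆ₐ[ℂ] GroupCStar where
  toFun := fourierIsometry
  invFun := fourierIsometry.symm
  left_inv := fourierIsometry.symm_apply_apply
  right_inv := fourierIsometry.apply_symm_apply
  map_add' := map_add fourierIsometry
  map_smul' c b := map_smul fourierIsometry c b
  map_mul' b c := by
    have hc := fourierIsometry.continuous
    refine zeroAtInfty_induction (isClosed_eq (hc.comp (continuous_id.mul continuous_const))
      (hc.mul continuous_const)) (fun φ => ?_) b
    refine zeroAtInfty_induction (isClosed_eq (hc.comp (continuous_const.mul continuous_id))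
      (continuous_const.mul hc)) (fun ψ => ?_) c
    change fourierIsometry (φ.toZeroAtInfty * ψ.toZeroAtInfty) =
      fourierIsometry φ.toZeroAtInfty * fourierIsometry ψ.toZeroAtInfty
    rw [← toZeroAtInfty_schwartzMul, fourierIsometry_toZeroAtInfty, fourierIsometry_toZeroAtInfty,
      fourierIsometry_toZeroAtInfty, schwartzGroup_mul]
  map_star' b := by
    have hc := fourierIsometry.continuous
    refine zeroAtInfty_induction (isClosed_eq (hc.comp continuous_star) hc.star) (fun φ => ?_) b
    change fourierIsometry (star φ.toZeroAtInfty) = star (fourierIsometry φ.toZeroAtInfty)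
    rw [← toZeroAtInfty_schwartzConj, fourierIsometry_toZeroAtInfty, fourierIsometry_toZeroAtInfty,
      schwartzGroup_star]

theorem ExtendsFourier.apply_toZeroAtInfty {F : C₀(ℝ, ℂ) ≃⋆ₐ[ℂ] GroupCStar}
    (hF : ExtendsFourier F) (φ : SchwartzMap ℝ ℂ) :
    F φ.toZeroAtInfty = schwartzGroup φ :=
  hF φ.toZeroAtInfty φ.integrable (𝓕 φ).integrable

theorem continuous_nonUnitalStarAlgHom {A B : Type*} [NonUnitalCStarAlgebra A]
    [NonUnitalCStarAlgebra B] (φ : A →⋆ₙₐ[ℂ] B) : Continuous φ :=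
  AddMonoidHomClass.continuous_of_bound φ 1 fun a => by
    rw [one_mul]
    exact NonUnitalStarAlgHom.norm_apply_le φ a

theorem continuous_starAlgEquiv (F : C₀(ℝ, ℂ) ≃⋆ₐ[ℂ] GroupCStar) : Continuous F :=
  continuous_nonUnitalStarAlgHom (F : C₀(ℝ, ℂ) →⋆ₙₐ[ℂ] GroupCStar)

theorem continuous_fourierConj : Continuous fourierConj :=
  AddMonoidHomClass.continuous_of_bound fourierConj 1 fun T => by
    rw [norm_fourierConj, one_mul]

theorem regular_apply_of_schwartz {F : C₀(ℝ, ℂ) ≃⋆ₐ[ℂ] GroupCStar}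
    (hF : ∀ φ : SchwartzMap ℝ ℂ, F φ.toZeroAtInfty = schwartzGroup φ) (b : C₀(ℝ, ℂ)) :
    regular (F b) = fourierConj (realMul b) := by
  refine zeroAtInfty_induction (isClosed_eq
    ((continuous_nonUnitalStarAlgHom regular).comp (continuous_starAlgEquiv F))
    (continuous_fourierConj.comp (continuous_nonUnitalStarAlgHom realMul))) (fun φ => ?_) b
  change regular (F φ.toZeroAtInfty) = fourierConj (realMul φ.toZeroAtInfty)
  rw [hF, regular_schwartzGroup]

theorem fourierEquiv_toZeroAtInfty (φ : SchwartzMap ℝ ℂ) :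
    fourierEquiv φ.toZeroAtInfty = schwartzGroup φ := fourierIsometry_toZeroAtInfty φ

/-- Faithfulness of the regular representation, which allows identities in `C*(ℝ)` to be checked on
`L²(ℝ)`. -/
theorem norm_regular (a : GroupCStar) : ‖regular a‖ = ‖a‖ := by
  obtain ⟨b, rfl⟩ := fourierIsometry.surjective a
  rw [fourierIsometry.norm_map, ← norm_realMul, ← norm_fourierConj (realMul b)]
  exact congrArg norm (regular_apply_of_schwartz fourierEquiv_toZeroAtInfty b)

theorem regular_injective : Function.Injective regular := by
  rw [injective_iff_map_eq_zero]
  intro a ha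
  rw [← norm_eq_zero, ← norm_regular, ha, norm_zero]

/-- Here `f` need not be Schwartz. After applying the faithful `regular`, both sides are conjugated
multiplication operators, and Fourier inversion for continuous `f` identifies the multipliers. -/
theorem extendsFourier_fourierEquiv : ExtendsFourier fourierEquiv := by
  intro f hf1 hf2
  apply regular_injective
  refine (regular_apply_of_schwartz fourierEquiv_toZeroAtInfty f).trans
    ((congrArg fourierConj ?_).trans (regular_ofL1 hf2).symm)
  ext1 ξ
  symm
  refine mulOp_apply_eq _ ?_
  filter_upwards [mulOp_ae volume _ (memLp_top_zeroAtInfty f) ξ] with x hx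
  have h : 𝓕⁻ (𝓕 (f : ℝ → ℂ)) = f := (map_continuous f).fourierInv_fourier_eq hf1 hf2
  rw [h]
  exact hx

theorem existsUnique_extendsFourier :
    ∃! F : C₀(ℝ, ℂ) ≃⋆ₐ[ℂ] GroupCStar, ExtendsFourier F := by
  refine ⟨fourierEquiv, extendsFourier_fourierEquiv, fun F hF => ?_⟩
  ext1 b
  refine zeroAtInfty_induction (isClosed_eq (continuous_starAlgEquiv F)
    (continuous_starAlgEquiv fourierEquiv)) (fun φ => ?_) b
  rw [hF.apply_toZeroAtInfty, extendsFourier_fourierEquiv.apply_toZeroAtInfty]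

theorem ExtendsFourier.regular_apply {F : C₀(ℝ, ℂ) ≃⋆ₐ[ℂ] GroupCStar} (hF : ExtendsFourier F)
    (b : C₀(ℝ, ℂ)) : regular (F b) = fourierConj (realMul b) :=
  regular_apply_of_schwartz hF.apply_toZeroAtInfty b

/-! ### The transform of multiplication operators on the circle -/

theorem memLp_top_comp_cayley (f : C(Circle, ℂ)) :
    MemLp (fun t => f (cayley t)) ∞ (volume : Measure ℝ) :=
  memLp_top_of_bound (f.continuous.comp continuous_cayley).aestronglyMeasurable ‖f‖
    (Eventually.of_forall fun t => f.norm_coe_le_norm (cayley t))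

theorem conj_cayleyW_circleMul (f : C(Circle, ℂ)) :
    cayleyW.conjStarAlgEquiv (circleMul f) = mulOp volume _ (memLp_top_comp_cayley f) := by
  ext1 ξ
  obtain ⟨η, rfl⟩ := cayleyW.surjective ξ
  symm
  refine mulOp_apply_eq _ ?_
  have h : cayleyW.conjStarAlgEquiv (circleMul f) (cayleyW η) = cayleyW (circleMul f η) := by
    simp
  rw [h]
  filter_upwards [cayleyW_ae (circleMul f η), cayleyW_ae η,
    quasi_cayley.ae (mulOp_ae arcLength f (memLp_top_circle f) η)] with t h1 h2 h3
  rw [h1, h2, circleMul, h3]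
  ring

theorem adUW_circleMul (f : C(Circle, ℂ)) :
    adUW (circleMul f) = fourierConj (mulOp volume _ (memLp_top_comp_cayley f)) :=
  congrArg fourierConj (conj_cayleyW_circleMul f)

theorem adUW_circleMul_of_mem (f : circleC0) :
    adUW (circleMul f) = fourierConj (realMul (compCayley f)) :=
  adUW_circleMul f

theorem adUW_apply (T : L2Circle →L[ℂ] L2Circle) (ξ : L2Circle) :
    adUW T (fourierU (cayleyW ξ)) = fourierU (cayleyW (T ξ)) := by
  change fourierU (cayleyW (T (cayleyW.symm (fourierU.symm (fourierU (cayleyW ξ)))))) = _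
  rw [LinearIsometryEquiv.symm_apply_apply, LinearIsometryEquiv.symm_apply_apply]

/-! ### The transform of the Hardy projection -/

theorem memLp_top_indicator_one {E : Set ℝ} (hE : MeasurableSet E) :
    MemLp (E.indicator fun _ => (1 : ℂ)) ∞ (volume : Measure ℝ) :=
  memLp_top_of_bound (aestronglyMeasurable_const.indicator hE) 1
    (Eventually.of_forall fun x => by
      by_cases hx : x ∈ E <;> simp [hx])

/-- The projection of `L²(ℝ)` onto `L²(E)`. -/
def restrictOp {E : Set ℝ} (hE : MeasurableSet E) : L2Real →L[ℂ] L2Real :=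
  mulOp volume _ (memLp_top_indicator_one hE)

theorem restrictOp_eq_zero_iff {E : Set ℝ} (hE : MeasurableSet E) (ξ : L2Real) :
    restrictOp hE ξ = 0 ↔ ∀ᵐ x : ℝ, x ∈ E → ξ x = 0 := by
  constructor
  · intro h
    filter_upwards [mulOp_ae volume _ (memLp_top_indicator_one hE) ξ,
      Lp.coeFn_zero ℂ 2 (volume : Measure ℝ)] with x h1 h2 hx
    change restrictOp hE ξ x = _ at h1
    rw [h, h2, Set.indicator_of_mem hx, one_mul] at h1
    exact h1.symm
  · intro h
    refine mulOp_apply_eq _ ?_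
    filter_upwards [h, Lp.coeFn_zero ℂ 2 (volume : Measure ℝ)] with x h1 h2
    rw [h2]
    by_cases hx : x ∈ E
    · rw [h1 hx, mul_zero]; rfl
    · rw [Set.indicator_of_notMem hx, zero_mul]; rfl

/-- If `E` is stable under `x ↦ x - s` for all `s` in the support of `h`, then convolution with `h`
preserves vanishing on `E`. -/
theorem restrictOp_regular_ofL1 {E : Set ℝ} (hE : MeasurableSet E) {h : ℝ → ℂ}
    (hh : Integrable h) (hs : ∀ s, h s ≠ 0 → ∀ x ∈ E, x - s ∈ E) {ξ : L2Real}
    (hξ : restrictOp hE ξ = 0) :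
    restrictOp hE (regular (ofL1 (memLp_one_iff_integrable.2 hh).toLp) ξ) = 0 := by
  rw [regular_ofL1_apply hh,
    ← (restrictOp hE).integral_comp_comm (integrable_smul_translation hh ξ)]
  refine (integral_congr_ae (Eventually.of_forall fun s => ?_)).trans
    (integral_zero ℝ L2Real)
  change restrictOp hE (h s • translation s ξ) = 0
  rw [map_smul]
  by_cases h0 : h s = 0
  · rw [h0, zero_smul]
  · rw [(restrictOp_eq_zero_iff hE _).2, smul_zero]
    filter_upwards [translation_ae s ξ, (measurePreserving_sub_right volume
      s).quasiMeasurePreserving.ae ((restrictOp_eq_zero_iff hE ξ).1 hξ)] with x h1 h2 hx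
    rw [h1, h2 (hs s h0 x hx)]

/-- Induction along powers of `w`. The first vector transforms to a multiple of `h`, which vanishes
on `E`; each further factor `wᵏ = 1 + c 𝓕⁻h` acts after `U` as `1 + c λ(h)`, which preserves
vanishing on `E`. One argument covers both half-lines. -/
theorem restrictOp_monomial {E : Set ℝ} (hE : MeasurableSet E) {h : ℝ → ℂ}
    (hh : Integrable h) (hh2 : MemLp h 2) (hs : ∀ s, h s ≠ 0 → ∀ x ∈ E, x - s ∈ E)
    (hE0 : ∀ s ∈ E, h s = 0) {k : ℤ} {m : ℕ → ℤ} (hm : ∀ n, m (n + 1) = k + m n) {c d : ℂ}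
    (hk : ∀ t, circlePow k (cayley t) = 1 + c * 𝓕⁻ h t)
    (hm0 : ∀ t, weight t * circlePow (m 0) (cayley t) = d * 𝓕⁻ h t) (n : ℕ) :
    restrictOp hE (fourierU (cayleyW (monomial (m n)))) = 0 := by
  induction n with
  | zero =>
    have h1 : cayleyW (monomial (m 0)) = d • fourierU.symm hh2.toLp := by
      apply Lp.ext
      filter_upwards [cayleyW_monomial_ae (m 0), Lp.coeFn_smul d (fourierU.symm hh2.toLp),
        fourierU_symm_ae hh hh2] with t h1 h2 h3
      rw [h1, h2, Pi.smul_apply, h3, hm0, smul_eq_mul]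
    rw [h1, map_smul, LinearIsometryEquiv.apply_symm_apply, map_smul,
      (restrictOp_eq_zero_iff hE _).2, smul_zero]
    filter_upwards [hh2.coeFn_toLp] with x hx hxE
    rw [hx, hE0 x hxE]
  | succ n ih =>
    have h1 : mulOp volume _ (memLp_top_comp_cayley (circlePow k)) =
        1 + c • mulOp volume _ (memLp_top_fourierInv hh) := by
      ext1 ξ
      refine mulOp_apply_eq _ ?_
      rw [_root_.add_apply, _root_.smul_apply, one_apply_eq_self]
      filter_upwards [Lp.coeFn_add ξ (c • mulOp volume _ (memLp_top_fourierInv hh) ξ),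
        Lp.coeFn_smul c (mulOp volume _ (memLp_top_fourierInv hh) ξ),
        mulOp_ae volume _ (memLp_top_fourierInv hh) ξ] with t h1 h2 h3
      rw [h1, Pi.add_apply, h2, Pi.smul_apply, h3, hk, smul_eq_mul]
      ring
    rw [hm, ← circleMul_circlePow, ← adUW_apply, adUW_circleMul, h1, map_add, map_one, map_smul,
      ← regular_ofL1 hh, _root_.add_apply, _root_.smul_apply, one_apply_eq_self, map_add, ih,
      zero_add, map_smul, restrictOp_regular_ofL1 hE hh hs ih, smul_zero]

/-- The inverse Fourier transform of this function is `1 / (t + i)`. -/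
def halfExp : ℝ → ℂ :=
  (Set.Ioi 0).indicator fun s => -(2 * Real.pi * Complex.I) * Complex.exp (-(2 * Real.pi : ℂ) * s)

theorem halfExp_of_nonpos {s : ℝ} (hs : s ≤ 0) : halfExp s = 0 :=
  Set.indicator_of_notMem (by simpa using hs) _

theorem neg_two_pi_re : (-(2 * Real.pi : ℂ)).re < 0 := by
  simp [Real.pi_pos]

theorem integrable_halfExp : Integrable halfExp :=
  IntegrableOn.integrable_indicator
    ((integrableOn_exp_mul_complex_Ioi neg_two_pi_re 0).const_mul _) measurableSet_Ioi

theorem norm_halfExp_le (s : ℝ) : ‖halfExp s‖ ≤ 2 * Real.pi := by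
  by_cases hs : s ∈ Set.Ioi 0
  · rw [halfExp, Set.indicator_of_mem hs, norm_mul, Complex.norm_exp]
    have h1 : ‖-(2 * Real.pi * Complex.I)‖ = 2 * Real.pi := by
      simp [abs_of_pos Real.pi_pos]
    rw [h1]
    refine mul_le_of_le_one_right (by positivity) (Real.exp_le_one_iff.2 ?_)
    have h2 : 0 < 2 * Real.pi * s := mul_pos Real.two_pi_pos hs
    simpa using h2.le
  · rw [halfExp, Set.indicator_of_notMem hs, norm_zero]
    positivity

theorem memLp_halfExp : MemLp halfExp 2 := by
  rw [memLp_two_iff_integrable_sq_norm integrable_halfExp.aestronglyMeasurable]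
  simp only [sq]
  exact integrable_halfExp.norm.bdd_mul integrable_halfExp.norm.aestronglyMeasurable
    (Eventually.of_forall fun s => by rw [norm_norm]; exact norm_halfExp_le s)

theorem fourierInv_halfExp (t : ℝ) : 𝓕⁻ halfExp t = ((t : ℂ) + Complex.I)⁻¹ := by
  rw [Real.fourierInv_eq']
  have h1 : ∀ s : ℝ, Complex.exp (↑(2 * Real.pi * inner ℝ s t) * Complex.I) • halfExp s =
      (Set.Ioi 0).indicator (fun s : ℝ => -(2 * Real.pi * Complex.I) *
        Complex.exp ((2 * Real.pi * Complex.I * (t + Complex.I)) * s)) s := by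
    intro s
    by_cases hs : s ∈ Set.Ioi 0
    · rw [halfExp, Set.indicator_of_mem hs, Set.indicator_of_mem hs, smul_eq_mul, mul_left_comm,
        ← Complex.exp_add]
      congr 2
      simp only [RCLike.inner_apply, conj_trivial]
      push_cast
      linear_combination -(2 * Real.pi * s : ℂ) * Complex.I_sq
    · rw [halfExp, Set.indicator_of_notMem hs, Set.indicator_of_notMem hs, smul_zero]
  have hre : (2 * Real.pi * Complex.I * (t + Complex.I) : ℂ).re < 0 := by
    simp [Real.pi_pos]
  have hpi : (Real.pi : ℂ) ≠ 0 := by exact_mod_cast Real.pi_ne_zero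
  simp only [h1]
  rw [integral_indicator measurableSet_Ioi, integral_const_mul, integral_exp_mul_complex_Ioi hre]
  have := add_I_ne_zero t
  have := Complex.I_ne_zero
  simp only [Complex.ofReal_zero, mul_zero, Complex.exp_zero]
  field_simp

theorem fourierInv_comp_neg (f : ℝ → ℂ) (t : ℝ) : 𝓕⁻ (fun s => f (-s)) t = 𝓕⁻ f (-t) := by
  rw [Real.fourierInv_eq', Real.fourierInv_eq', ← integral_neg_eq_self]
  simp

theorem coe_cayley_eq (t : ℝ) : (cayley t : ℂ) = 1 + -(2 * Complex.I) * ((t : ℂ) + Complex.I)⁻¹ := by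
  have := add_I_ne_zero t
  rw [coe_cayley]
  field_simp
  ring

theorem sub_I_ne_zero (t : ℝ) : (t : ℂ) - Complex.I ≠ 0 :=
  norm_ne_zero_iff.1 ((norm_sub_I t).trans_ne (norm_ne_zero_iff.2 (add_I_ne_zero t)))

/-- Both `w = 1 - 2i/(t+i)` and the weight `√2/(t+i)` are built from the inverse transform of
`halfExp`, which is supported on `(0,∞)`. -/
theorem restrictOp_monomial_of_nonneg {n : ℤ} (hn : 0 ≤ n) :
    restrictOp (measurableSet_Iio (a := (0 : ℝ))) (fourierU (cayleyW (monomial n))) = 0 := by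
  lift n to ℕ using hn
  refine restrictOp_monomial measurableSet_Iio integrable_halfExp memLp_halfExp
    (fun s hs x hx => ?_) (fun s hs => halfExp_of_nonpos (le_of_lt hs)) (k := 1)
    (m := fun n => (n : ℤ)) (fun n => by push_cast; ring) (c := -(2 * Complex.I))
    (d := (Real.sqrt 2 : ℂ)) (fun t => ?_) (fun t => ?_) n
  · have : 0 < s := not_le.1 fun h => hs (halfExp_of_nonpos h)
    exact (sub_lt_self x this).trans hx
  · rw [circlePow_apply, zpow_one, coe_cayley_eq, fourierInv_halfExp]
  · rw [fourierInv_halfExp, circlePow_apply]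
    simp [weight, div_eq_mul_inv]

theorem restrictOp_monomial_of_neg {n : ℤ} (hn : n < 0) :
    restrictOp (measurableSet_Ici (a := (0 : ℝ))) (fourierU (cayleyW (monomial n))) = 0 := by
  obtain ⟨n, rfl⟩ := Int.eq_negSucc_of_lt_zero hn
  have hinv : ∀ t, 𝓕⁻ (fun s => halfExp (-s)) t = -((t : ℂ) - Complex.I)⁻¹ := by
    intro t
    rw [fourierInv_comp_neg, fourierInv_halfExp, ← inv_neg]
    push_cast
    ring
  have hw : ∀ t, circlePow (-1) (cayley t) = ((t : ℂ) + Complex.I) / ((t : ℂ) - Complex.I) := by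
    intro t
    rw [circlePow_apply, zpow_neg_one, Circle.coe_inv, coe_cayley, inv_div]
  -- The reflected exponential has inverse transform `-1/(t-i)`, while `w⁻¹ = 1 + 2i/(t-i)` and `W
  -- z⁻¹ = √2/(t-i)`. It vanishes at `0` as well, so the closed half-line is allowed.
  refine restrictOp_monomial measurableSet_Ici integrable_halfExp.comp_neg
    (memLp_halfExp.comp_measurePreserving (Measure.measurePreserving_neg volume))
    (fun s hs x hx => ?_) (fun s hs => halfExp_of_nonpos (neg_nonpos.2 hs)) (k := -1)
    (m := Int.negSucc) (fun n => by omega) (c := -(2 * Complex.I))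
    (d := -(Real.sqrt 2 : ℂ)) (fun t => ?_) (fun t => ?_) n
  · have : s < 0 := not_le.1 fun h => hs (halfExp_of_nonpos (neg_nonpos.2 h))
    have hx0 : 0 ≤ x := hx
    exact Set.mem_Ici.2 (by linarith)
  · have := sub_I_ne_zero t
    rw [hw, hinv]
    field_simp
    ring
  · have := sub_I_ne_zero t
    have := add_I_ne_zero t
    rw [show Int.negSucc 0 = -1 from rfl, hw, hinv, weight]
    field_simp

theorem restrictOp_add_restrictOp :
    restrictOp (measurableSet_Iio (a := (0 : ℝ))) + restrictOp (measurableSet_Ici (a := (0 : ℝ))) =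
      1 := by
  have h1 : MemLp (fun _ : ℝ => (1 : ℂ)) ∞ volume := memLp_top_const 1
  rw [restrictOp, restrictOp, mulOp_add _ _ h1, mulOp_one _ (Eventually.of_forall fun _ => rfl)]
  refine Eventually.of_forall fun x => ?_
  by_cases hx : x < 0
  · simp [hx]
  · simp [hx, not_lt.1 hx]

/-- The Paley–Wiener theorem in disguise: the transforms of `zⁿ` are supported on the right
half-line for `n ≥ 0` and on the left one for `n < 0`, and the monomials are total. -/
theorem adUW_hardyP :
    adUW hardyP = restrictOp (measurableSet_Ici (a := (0 : ℝ))) := by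
  have key : ∀ T : L2Real →L[ℂ] L2Real, (∀ n, adUW hardyP (fourierU (cayleyW (monomial n))) =
      T (fourierU (cayleyW (monomial n)))) → adUW hardyP = T := by
    intro T h
    have h2 : (adUW hardyP) ∘L (cayleyW.trans fourierU : L2Circle →L[ℂ] L2Real) =
        T ∘L (cayleyW.trans fourierU : L2Circle →L[ℂ] L2Real) :=
      clm_eq_of_total span_monomial (by rintro _ ⟨n, rfl⟩; exact h n)
    ext1 ξ
    obtain ⟨η, rfl⟩ := (cayleyW.trans fourierU).surjective ξ
    exact DFunLike.congr_fun h2 η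
  refine key _ fun n => ?_
  rw [adUW_apply]
  rcases le_or_gt 0 n with hn | hn
  · rw [hardyP_monomial_of_nonneg hn]
    have h := DFunLike.congr_fun restrictOp_add_restrictOp (fourierU (cayleyW (monomial n)))
    rw [_root_.add_apply, restrictOp_monomial_of_nonneg hn, zero_add, one_apply_eq_self] at h
    exact h.symm
  · rw [hardyP_monomial_of_neg hn, restrictOp_monomial_of_neg hn, map_zero, map_zero]

/-! ### Products of multiplication and convolution operators -/

/-- Writing `ξ = Uζ`, the value at `x` is `a(x)` times the Fourier integral of `φζ`, hence an inner
product of `ζ` with a modulated `φ̄`. This displays the sections of the integral kernel. -/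
theorem mulOp_fourierConj_apply_ae {a : ℝ → ℂ} (ha : MemLp a ∞ volume) (φ : SchwartzMap ℝ ℂ)
    (ξ : L2Real) : ∀ᵐ x : ℝ, (mulOp volume a ha * fourierConj (realMul φ.toZeroAtInfty)) ξ x =
      inner ℂ (star (a x) • fourierU (modulation x ((schwartzConj φ).toLp 2))) ξ := by
  obtain ⟨ζ, rfl⟩ := fourierU.surjective ξ
  have h1 : Integrable fun t => φ t * ζ t := (φ.memLp 2).integrable_mul (Lp.memLp ζ)
  have h2 : MemLp (fun t => φ t * ζ t) 2 volume :=
    (Lp.memLp ζ).mul (memLp_top_zeroAtInfty φ.toZeroAtInfty)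
  have h3 : realMul φ.toZeroAtInfty ζ = h2.toLp := by
    refine mulOp_apply_eq _ ?_
    filter_upwards [h2.coeFn_toLp] with t ht
    exact ht
  have h4 : ∀ x, inner ℂ (modulation x ((schwartzConj φ).toLp 2)) ζ = 𝓕 (fun t => φ t * ζ t) x := by
    intro x
    rw [L2.inner_def, Real.fourier_real_eq]
    refine integral_congr_ae ?_
    filter_upwards [mulOp_ae volume _ (memLp_top_fourierChar x) ((schwartzConj φ).toLp 2),
      (schwartzConj φ).coeFn_toLp 2 volume] with t h5 h6
    rw [modulation, h5, h6, schwartzConj_apply, Circle.smul_def, AddChar.map_neg_eq_inv,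
      Circle.coe_inv_eq_conj, mul_comm t x]
    simp only [RCLike.inner_apply, RCLike.star_def, smul_eq_mul, map_mul, RCLike.conj_conj]
    ring
  filter_upwards [mulOp_ae volume a ha (fourierU (realMul φ.toZeroAtInfty ζ)),
    fourierU_ae h1 h2] with x h5 h6
  rw [mul_apply_eq_comp, fourierConj_apply, LinearIsometryEquiv.symm_apply_apply, h5, h3, h6,
    inner_smul_left, LinearIsometryEquiv.inner_map_map, h4, RCLike.star_def, RCLike.conj_conj]

/-- The kernel is square integrable: its section at `x` has norm at most `|a(x)| ‖φ‖₂`. -/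
theorem isCompactOperator_mulOp_fourierConj_schwartz {a : ℝ → ℂ} (ha : MemLp a ∞ volume)
    (ha2 : MemLp a 2 volume) (φ : SchwartzMap ℝ ℂ) :
    IsCompactOperator (mulOp volume a ha * fourierConj (realMul φ.toZeroAtInfty)) := by
  refine isCompactOperator_of_ae_eq_inner _ _ (mulOp_fourierConj_apply_ae ha φ) ?_
  have hmod : ∀ x ξ, ‖modulation x ξ‖ ≤ ‖ξ‖ := by
    intro x ξ
    have h := norm_mulOp_le (memLp_top_fourierChar x) zero_le_one
      (Eventually.of_forall fun t => (Circle.norm_coe _).le)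
    exact (ContinuousLinearMap.le_opNorm _ ξ).trans
      ((mul_le_mul_of_nonneg_right h (norm_nonneg ξ)).trans_eq (one_mul _))
  set C := ‖(schwartzConj φ).toLp 2 (volume : Measure ℝ)‖
  have hle : ∀ x, ‖star (a x) • fourierU (modulation x ((schwartzConj φ).toLp 2))‖ₑ ^ 2 ≤
      ENNReal.ofReal (C ^ 2) * ‖a x‖ₑ ^ 2 := by
    intro x
    rw [← ofReal_norm, ← ofReal_norm, ← ENNReal.ofReal_pow (norm_nonneg _),
      ← ENNReal.ofReal_pow (norm_nonneg _), ← ENNReal.ofReal_mul (by positivity), ← mul_pow,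
      norm_smul, norm_star, LinearIsometryEquiv.norm_map, mul_comm C]
    gcongr
    exact hmod x _
  refine ((lintegral_mono hle).trans_lt ?_).ne
  rw [lintegral_const_mul' _ _ ENNReal.ofReal_ne_top]
  refine ENNReal.mul_lt_top ENNReal.ofReal_lt_top ?_
  have h := ha2.2
  rw [eLpNorm_lt_top_iff_lintegral_rpow_enorm_lt_top two_ne_zero ENNReal.ofNat_ne_top] at h
  simpa using h

theorem isCompactOperator_mulOp_fourierConj_of_memLp {a : ℝ → ℂ} (ha : MemLp a ∞ volume)
    (ha2 : MemLp a 2 volume) (b : C₀(ℝ, ℂ)) :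
    IsCompactOperator (mulOp volume a ha * fourierConj (realMul b)) := by
  have hc : Continuous fun b : C₀(ℝ, ℂ) => mulOp volume a ha * fourierConj (realMul b) :=
    continuous_const.mul (continuous_fourierConj.comp (continuous_nonUnitalStarAlgHom realMul))
  exact zeroAtInfty_induction ((isClosed_compactOperator (H := L2Real) (G := L2Real)).preimage hc)
    (isCompactOperator_mulOp_fourierConj_schwartz ha ha2) b

/-- If `a` vanishes at infinity, then the product of multiplication by `a` and a convolution
operator is compact. -/
theorem isCompactOperator_mulOp_fourierConj {a : ℝ → ℂ} (ha : MemLp a ∞ volume)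
    (h0 : Tendsto a (cocompact ℝ) (𝓝 0)) (b : C₀(ℝ, ℂ)) :
    IsCompactOperator (mulOp volume a ha * fourierConj (realMul b)) := by
  set B := fourierConj (realMul b)
  have hcl := isClosed_compactOperator (H := L2Real) (G := L2Real)
  change mulOp volume a ha * B ∈ (compactOperator (RingHom.id ℂ) L2Real L2Real : Set _)
  rw [← hcl.closure_eq, Metric.mem_closure_iff]
  intro ε hε
  obtain ⟨δ, hδ, hδε⟩ : ∃ δ > 0, δ * ‖B‖ < ε :=
    ⟨ε / (‖B‖ + 1), by positivity, by
      rw [div_mul_eq_mul_div, div_lt_iff₀ (by positivity)]; nlinarith [norm_nonneg B]⟩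
  -- On the compact set `K` the bounded function `a` is square integrable; off `K` it is smaller
  -- than `δ` and contributes at most `δ ‖B‖` in norm.
  obtain ⟨K, hK, hKa⟩ := mem_cocompact.1 ((Metric.tendsto_nhds.1 h0) δ hδ)
  have hKm := hK.isClosed.measurableSet
  have h1 : MemLp (K.indicator a) ∞ volume := ha.indicator hKm
  have h2 : MemLp (K.indicator a) 2 volume :=
    (memLp_indicator_iff_restrict hKm).2 (by
      have : IsFiniteMeasure (volume.restrict K) := ⟨by
        rw [Measure.restrict_apply_univ]; exact hK.measure_lt_top⟩
      exact (ha.restrict K).mono_exponent le_top)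
  have h3 : MemLp (fun x => a x - K.indicator a x) ∞ volume := ha.sub h1
  refine ⟨_, isCompactOperator_mulOp_fourierConj_of_memLp h1 h2 b, ?_⟩
  have h4 : mulOp volume _ h3 + mulOp volume _ h1 = mulOp volume a ha :=
    mulOp_add h3 h1 ha (Eventually.of_forall fun x => (sub_add_cancel _ _).symm)
  rw [dist_eq_norm, ← sub_mul, ← h4, add_sub_cancel_right]
  refine ((norm_mul_le _ _).trans ?_).trans_lt hδε
  gcongr
  refine norm_mulOp_le h3 hδ.le (Eventually.of_forall fun x => ?_)
  by_cases hx : x ∈ K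
  · simp [hx, hδ.le]
  · have := hKa hx
    simp only [Set.mem_ofPred_eq, dist_zero_right] at this
    simpa [hx] using this.le

theorem ExtLine.tendsto_ofReal_atTop : Tendsto ExtLine.ofReal atTop (𝓝 ExtLine.infty) := by
  rw [tendsto_subtype_rng]
  exact EReal.tendsto_coe_atTop

theorem ExtLine.tendsto_ofReal_atBot : Tendsto ExtLine.ofReal atBot (cocompact ExtLine) := by
  refine (hasBasis_cocompact.tendsto_right_iff).2 fun K hK => ?_
  have h1 : ((Subtype.val : ExtLine → EReal) '' K)ᶜ ∈ 𝓝 (⊥ : EReal) :=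
    (hK.image continuous_subtype_val).isClosed.isOpen_compl.mem_nhds
      fun ⟨x, _, hx⟩ => (Set.mem_Ioi.1 x.2).ne hx.symm
  filter_upwards [EReal.tendsto_coe_atBot h1] with x hx hxK
  exact hx ⟨_, hxK, rfl⟩

/-- At `-∞` both terms tend to zero, and at `+∞` they have the same limit. The jump at `0` is
harmless, since only boundedness and decay are needed. -/
theorem tendsto_extLine_sub (f : C₀(ExtLine, ℂ)) :
    Tendsto (fun x : ℝ => f (ExtLine.ofReal x) -
      f ExtLine.infty * (Set.Ici (0 : ℝ)).indicator (fun _ => 1) x) (cocompact ℝ) (𝓝 0) := by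
  rw [cocompact_eq_atBot_atTop, tendsto_sup]
  constructor
  · refine ((zero_at_infty f).comp ExtLine.tendsto_ofReal_atBot).congr' ?_
    filter_upwards [eventually_lt_atBot 0] with x hx
    simp [hx]
  · have h := ((map_continuous f).tendsto ExtLine.infty).comp ExtLine.tendsto_ofReal_atTop
    rw [← sub_self (f ExtLine.infty)]
    refine (h.sub_const (f ExtLine.infty)).congr' ?_
    filter_upwards [eventually_ge_atTop 0] with x hx
    simp [hx]

theorem isCompactOperator_iff_of_intertwines {H G : Type*} [NormedAddCommGroup H]
    [InnerProductSpace ℂ H] [NormedAddCommGroup G] [InnerProductSpace ℂ G] (V : H ≃ₗᵢ[ℂ] G)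
    {S : G →L[ℂ] G} {T : H →L[ℂ] H} (h : ∀ ξ, S (V ξ) = V (T ξ)) :
    IsCompactOperator S ↔ IsCompactOperator T := by
  constructor
  · intro hS
    have h1 : T = (V.symm : G →L[ℂ] H) ∘L S ∘L (V : H →L[ℂ] G) := by
      ext1 ξ
      simp [h]
    rw [h1]
    exact (hS.comp_clm (V : H →L[ℂ] G)).clm_comp (V.symm : G →L[ℂ] H)
  · intro hT
    have h1 : S = (V : H →L[ℂ] G) ∘L T ∘L (V.symm : G →L[ℂ] H) := by
      ext1 ξ
      obtain ⟨η, rfl⟩ := V.surjective ξ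
      simp [h]
    rw [h1]
    exact (hT.comp_clm (V.symm : G →L[ℂ] H)).clm_comp (V : H →L[ℂ] G)

theorem isCompactOperator_adUW_iff (T : L2Circle →L[ℂ] L2Circle) :
    IsCompactOperator (adUW T) ↔ IsCompactOperator T :=
  isCompactOperator_iff_of_intertwines (cayleyW.trans fourierU) (adUW_apply T)

theorem isCompactOperator_hardyP_mul_sub_compression (h : C(Circle, ℂ)) :
    IsCompactOperator (hardyP * circleMul h - compression h) := by
  have : hardyP * circleMul h - compression h =
      hardyP * (hardyP * circleMul h - circleMul h * hardyP) := by
    rw [compression_apply, mul_sub, ← mul_assoc, ← mul_assoc, hardyP_mul_self]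
  rw [this]
  exact compact_mul_left _ (isCompactOperator_commutator h)

/-- `M(f) λ(g)` agrees modulo compact operators with `f(+∞)` times the transform of a
compression. -/
theorem isCompactOperator_lineMul_regular_sub {F : C₀(ℝ, ℂ) ≃⋆ₐ[ℂ] GroupCStar}
    (hF : ExtendsFourier F) (f : C₀(ExtLine, ℂ)) (h : circleC0) :
    IsCompactOperator (lineMul f * regular (F (compCayley h)) -
      adUW (compression (f ExtLine.infty • (h : C(Circle, ℂ))))) := by
  set c := f ExtLine.infty with hc
  have h1 : MemLp (fun x : ℝ => f (ExtLine.ofReal x) -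
      c * (Set.Ici (0 : ℝ)).indicator (fun _ => 1) x) ∞ volume :=
    (memLp_top_extLine f).sub ((memLp_top_indicator_one measurableSet_Ici).const_mul c)
  -- The step function `c 1_{[0,∞)}` is split off from `f`: its multiplication operator is `c` times
  -- the transformed Hardy projection, and the remainder vanishes at infinity.
  have h2 : lineMul f = mulOp volume _ h1 + c • adUW hardyP := by
    rw [adUW_hardyP, restrictOp, mulOp_smul (memLp_top_indicator_one measurableSet_Ici)
      ((memLp_top_indicator_one measurableSet_Ici).const_mul c) c
      (Eventually.of_forall fun _ => rfl), mulOp_add h1 _ (memLp_top_extLine f)]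
    · rfl
    · exact Eventually.of_forall fun x => (sub_add_cancel _ _).symm
  have h3 : lineMul f * regular (F (compCayley h)) - adUW (compression (c • (h : C(Circle, ℂ)))) =
      mulOp volume _ h1 * fourierConj (realMul (compCayley h)) +
        c • adUW (hardyP * circleMul h - compression h) := by
    rw [hF.regular_apply, h2, add_mul, map_sub, map_mul, adUW_circleMul_of_mem, map_smul, map_smul,
      smul_sub, smul_mul_assoc]
    abel
  rw [h3]
  exact compact_add (isCompactOperator_mulOp_fourierConj h1 (tendsto_extLine_sub f) _)
    (compact_smul c ((isCompactOperator_adUW_iff _).2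
      (isCompactOperator_hardyP_mul_sub_compression h)))

/-! ### The compact operators in the Wiener–Hopf algebra -/

/-- Extension by `0` at `+∞` is continuous because the support is bounded. -/
theorem exists_extLine_extension {f : ℝ → ℂ} (hf : Continuous f) (hc : HasCompactSupport f) :
    ∃ F : C₀(ExtLine, ℂ), ∀ x, F (ExtLine.ofReal x) = f x := by
  classical
  let F : ExtLine → ℂ := fun x => if x.1 = ⊤ then 0 else f x.1.toReal
  have hF : ∀ x, F (ExtLine.ofReal x) = f x := fun x => by
    simp [F, ExtLine.ofReal]
  have hFc : Continuous F := by
    rw [continuous_iff_continuousAt]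
    intro x
    by_cases hx : x.1 = ⊤
    · obtain ⟨N, hN⟩ := hc.isCompact.isBounded.subset_closedBall 0
      refine (continuousAt_const (y := (0 : ℂ))).congr ?_
      have h1 : {y : ExtLine | (N : EReal) < y.1} ∈ 𝓝 x :=
        (isOpen_lt continuous_const continuous_subtype_val).mem_nhds
          (by simp [hx])
      filter_upwards [h1] with y hy
      by_cases hy1 : y.1 = ⊤
      · simp [F, hy1]
      · simp only [F, if_neg hy1]
        by_contra hne
        have h2 := hN (subset_tsupport f (Ne.symm hne))
        rw [mem_closedBall_zero_iff, Real.norm_eq_abs] at h2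
        have hb : y.1 ≠ ⊥ := (Set.mem_Ioi.1 y.2).ne'
        change (N : EReal) < y.1 at hy
        rw [← EReal.coe_toReal hy1 hb, EReal.coe_lt_coe_iff] at hy
        linarith [le_abs_self y.1.toReal]
    · have hb : x.1 ≠ ⊥ := (Set.mem_Ioi.1 x.2).ne'
      have h1 : ContinuousAt (fun y : ExtLine => f y.1.toReal) x :=
        hf.continuousAt.comp (ContinuousAt.comp (g := EReal.toReal)
          (EReal.tendsto_toReal hx hb) continuous_subtype_val.continuousAt)
      refine h1.congr ?_
      filter_upwards [(isOpen_ne_fun continuous_subtype_val continuous_const).mem_nhds hx] with y hy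
      exact (if_neg hy).symm
  have hFs : HasCompactSupport F := by
    refine HasCompactSupport.intro (hc.isCompact.image ExtLine.continuous_ofReal) fun x hx => ?_
    by_cases hx1 : x.1 = ⊤
    · exact if_pos hx1
    · have hb : x.1 ≠ ⊥ := (Set.mem_Ioi.1 x.2).ne'
      simp only [F, if_neg hx1]
      by_contra hne
      exact hx ⟨x.1.toReal, subset_tsupport f hne, Subtype.ext (EReal.coe_toReal hx1 hb)⟩
  exact ⟨⟨⟨F, hFc⟩, hFs.is_zero_at_infty⟩, hF⟩

/-- A continuous function with compact support, as an element of `L²(ℝ)`. -/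
def ccVec (f : ℝ → ℂ) (hf : Continuous f) (hc : HasCompactSupport f) : L2Real :=
  (hf.memLp_of_hasCompactSupport hc).toLp

theorem ccVec_ae (f : ℝ → ℂ) (hf : Continuous f) (hc : HasCompactSupport f) :
    ∀ᵐ x, ccVec f hf hc x = f x := (hf.memLp_of_hasCompactSupport hc).coeFn_toLp

/-- The elements of `L²(ℝ)` given by continuous functions with compact support. -/
def ccSet : Set L2Real := {ξ | ∃ f hf hc, ξ = ccVec f hf hc}

theorem span_ccSet : (Submodule.span ℂ ccSet).topologicalClosure = ⊤ := by
  rw [← Submodule.dense_iff_topologicalClosure_eq_top]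
  refine Dense.mono Submodule.subset_span fun ξ => ?_
  rw [Metric.mem_closure_iff]
  intro ε hε
  obtain ⟨f, hc, hle, hf, -⟩ := (Lp.memLp ξ).exists_hasCompactSupport_eLpNorm_sub_le
    ENNReal.ofNat_ne_top (ENNReal.ofReal_pos.2 (half_pos hε)).ne'
  refine ⟨_, ⟨f, hf, hc, rfl⟩, ?_⟩
  rw [Lp.dist_def]
  have h1 : eLpNorm (⇑ξ - ⇑(ccVec f hf hc)) 2 volume = eLpNorm (⇑ξ - f) 2 volume := by
    refine eLpNorm_congr_ae ?_
    filter_upwards [ccVec_ae f hf hc] with x hx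
    simp [hx]
  rw [h1]
  exact (ENNReal.toReal_mono ENNReal.ofReal_ne_top hle).trans_lt
    (by rw [ENNReal.toReal_ofReal (half_pos hε).le]; linarith)

/-- The operator has kernel `f(x) h(x - y) f̄'(y)`. Taking `h = 1` on all differences of points of
the two supports makes the kernel a product. -/
theorem exists_lineMul_regular_lineMul_eq_rankOne {f f' : ℝ → ℂ} (hf : Continuous f)
    (hc : HasCompactSupport f) (hf' : Continuous f') (hc' : HasCompactSupport f')
    {A A' : C₀(ExtLine, ℂ)} (hA : ∀ x, A (ExtLine.ofReal x) = f x)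
    (hA' : ∀ x, A' (ExtLine.ofReal x) = star (f' x)) :
    ∃ g, lineMul A * regular g * lineMul A' =
      InnerProductSpace.rankOne ℂ (ccVec f hf hc) (ccVec f' hf' hc') := by
  obtain ⟨N₁, hN₁⟩ := hc.isCompact.isBounded.subset_closedBall 0
  obtain ⟨N₂, hN₂⟩ := hc'.isCompact.isBounded.subset_closedBall 0
  -- If the supports lie in balls of radii `N₁` and `N₂`, all differences `x - y` lie in this
  -- interval.
  let h : ℝ → ℂ := (Set.Icc (-(N₁ + N₂)) (N₁ + N₂)).indicator fun _ => 1
  have hh : Integrable h := IntegrableOn.integrable_indicator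
    (integrableOn_const measure_Icc_lt_top.ne) measurableSet_Icc
  refine ⟨ofL1 (memLp_one_iff_integrable.2 hh).toLp, ?_⟩
  ext1 ξ
  rw [mul_apply_eq_comp, mul_apply_eq_comp, regular_ofL1_apply hh]
  set η := lineMul A' ξ with hη
  have hηae : ∀ᵐ x : ℝ, η x = star (f' x) * ξ x := by
    filter_upwards [mulOp_ae volume _ (memLp_top_extLine A') ξ] with x hx
    rw [← hA', ← hx]
    rfl
  have hηi : Integrable η := by
    have h1 : Integrable fun x => star (f' x) * ξ x :=
      (hf'.memLp_of_hasCompactSupport (p := 2) (μ := (volume : Measure ℝ)) hc').star.integrable_mul (Lp.memLp ξ)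
    exact h1.congr (hηae.mono fun x hx => hx.symm)
  have hint := integrable_smul_translation hh η
  rw [← (lineMul A).integral_comp_comm hint]
  refine ext_inner_left ℂ fun ζ => ?_
  rw [← integral_inner ((lineMul A).integrable_comp hint)]
  have hpi : Integrable fun x => star (ζ x) * f x :=
    (Lp.memLp ζ).star.integrable_mul
      (hf.memLp_of_hasCompactSupport (p := 2) (μ := (volume : Measure ℝ)) hc)
  have h1 : ∀ s, inner ℂ ζ (lineMul A (h s • translation s η)) =
      ∫ x, h s * ((star (ζ x) * f x) * η (x - s)) := by
    intro s
    rw [map_smul, inner_smul_right, L2.inner_def, integral_const_mul]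
    congr 1
    refine integral_congr_ae ?_
    filter_upwards [mulOp_ae volume _ (memLp_top_extLine A) (translation s η),
      translation_ae s η] with x h2 h3
    rw [lineMul, h2, h3, hA, RCLike.inner_apply, RCLike.star_def]
    ring
  simp only [h1]
  have hprod : Integrable (fun p : ℝ × ℝ => h p.1 * ((star (ζ p.2) * f p.2) * η (p.2 - p.1)))
      (volume.prod volume) := by
    have h2 := hpi.convolution_integrand (ContinuousLinearMap.mul ℂ ℂ) hηi.comp_neg
    simp only [neg_sub, ContinuousLinearMap.mul_apply'] at h2
    refine h2.bdd_mul (c := 1) hh.aestronglyMeasurable.comp_fst (Eventually.of_forall fun p => ?_)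
    exact (norm_indicator_le_norm_self (fun _ : ℝ => (1 : ℂ)) p.1).trans_eq norm_one
  rw [integral_integral_swap hprod]
  have h2 : ∀ x, ∫ s, h s * ((star (ζ x) * f x) * η (x - s)) = (star (ζ x) * f x) * ∫ y, η y := by
    intro x
    by_cases hx : f x = 0
    · simp [hx]
    rw [← integral_const_mul, ← integral_sub_left_eq_self _ volume x]
    refine integral_congr_ae ?_
    filter_upwards [hηae] with y hy
    rw [sub_sub_cancel]
    by_cases hy0 : f' y = 0
    · rw [hy, hy0, star_zero]; ring
    have h3 := hN₁ (subset_tsupport f hx)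
    have h4 := hN₂ (subset_tsupport f' hy0)
    rw [mem_closedBall_zero_iff, Real.norm_eq_abs, abs_le] at h3 h4
    have h5 : h (x - y) = 1 :=
      Set.indicator_of_mem (show x - y ∈ Set.Icc (-(N₁ + N₂)) (N₁ + N₂) from
        ⟨by linarith [h3.1, h4.2], by linarith [h3.2, h4.1]⟩) _
    rw [h5, one_mul]
  simp only [h2]
  rw [integral_mul_const, InnerProductSpace.rankOne_apply, inner_smul_right, mul_comm]
  congr 1
  · rw [L2.inner_def]
    refine integral_congr_ae ?_
    filter_upwards [hηae, ccVec_ae f' hf' hc'] with x h3 h4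
    rw [h3, h4, RCLike.inner_apply, RCLike.star_def, mul_comm]
  · rw [L2.inner_def]
    refine integral_congr_ae ?_
    filter_upwards [ccVec_ae f hf hc] with x h4
    rw [h4, RCLike.inner_apply, RCLike.star_def, mul_comm]

/-- The images of continuous functions with compact support under convolution operators. -/
def regularSet : Set L2Real := {ψ | ∃ g, ∃ ξ ∈ ccSet, ψ = star (regular g) ξ}

theorem eq_zero_of_inner_eq_zero {H : Type*} [NormedAddCommGroup H] [InnerProductSpace ℂ H]
    {E : Set H} (hE : (Submodule.span ℂ E).topologicalClosure = ⊤) {ζ : H}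
    (h : ∀ ξ ∈ E, inner ℂ ξ ζ = 0) : ζ = 0 := by
  rw [← Submodule.dense_iff_topologicalClosure_eq_top] at hE
  refine hE.eq_zero_of_inner_right ℂ fun v hv => ?_
  induction hv using Submodule.span_induction with
  | mem x hx => exact h x hx
  | zero => exact inner_zero_left _
  | add x y _ _ hx hy => simp_all [inner_add_left]
  | smul c x _ hx => simp_all [inner_smul_left]

/-- A vector orthogonal to this set is annihilated by every `λ(g)`. One `g` whose multiplier under
`U` vanishes nowhere then forces it to be zero. -/
theorem span_regularSet : (Submodule.span ℂ regularSet).topologicalClosure = ⊤ := by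
  rw [Submodule.topologicalClosure_eq_top_iff, Submodule.eq_bot_iff]
  intro ζ hζ
  have h1 : ∀ g, regular g ζ = 0 := fun g =>
    eq_zero_of_inner_eq_zero span_ccSet fun ξ hξ => by
      rw [← ContinuousLinearMap.adjoint_inner_left, ← ContinuousLinearMap.star_eq_adjoint]
      exact (Submodule.mem_orthogonal _ _).1 hζ _ (Submodule.subset_span ⟨g, ξ, hξ, rfl⟩)
  -- The function `1 - z` vanishes only at `1`, a point the Cayley transform omits.
  let u : circleC0 := ⟨1 - circleZ, by
    change (1 : C(Circle, ℂ)) 1 - circleZ 1 = 0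
    simp [circleZ]⟩
  have h2 := h1 (fourierEquiv (compCayley u))
  rw [extendsFourier_fourierEquiv.regular_apply, fourierConj_apply,
    LinearIsometryEquiv.map_eq_zero_iff] at h2
  have h3 : fourierU.symm ζ = 0 := by
    apply Lp.ext
    filter_upwards [mulOp_ae volume _ (memLp_top_zeroAtInfty (compCayley u)) (fourierU.symm ζ),
      Lp.coeFn_zero ℂ 2 (volume : Measure ℝ)] with t h4 h5
    change realMul (compCayley u) _ t = _ at h4
    rw [h2, h5, eq_comm] at h4
    rw [h5]
    refine (mul_eq_zero.1 h4).resolve_left fun h6 => cayley_ne_one t (Circle.ext ?_)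
    exact (sub_eq_zero.1 h6).symm
  exact (LinearIsometryEquiv.map_eq_zero_iff _).1 h3

theorem lineMul_mul_regular_mem (f : C₀(ExtLine, ℂ)) (g : GroupCStar) :
    lineMul f * regular g ∈ wienerHopf := (mulConv f g).2

theorem isClosed_wienerHopf : IsClosed (wienerHopf : Set (L2Real →L[ℂ] L2Real)) :=
  NonUnitalStarSubalgebra.isClosed_topologicalClosure _

/-- `M(B) λ(k) M(B')` need not be a product of generators, so another `λ(g)` is appended. The result
is still of rank one, with `λ(g)*` moved onto the second vector, and such vectors are total. -/
theorem compactOps_le_wienerHopf : compactOps L2Real ≤ wienerHopf := by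
  intro K hK
  let A : Submodule ℂ (L2Real →L[ℂ] L2Real) := wienerHopf.toNonUnitalSubalgebra.toSubmodule
  have hA : IsClosed (A : Set (L2Real →L[ℂ] L2Real)) := isClosed_wienerHopf
  refine isCompactOperator_mem_of_rankOne_mem hA
    (rankOne_mem_of_total hA span_ccSet span_regularSet ?_) K hK
  rintro _ ⟨f, hf, hc, rfl⟩ _ ⟨g, _, ⟨f', hf', hc', rfl⟩, rfl⟩
  obtain ⟨B, hB⟩ := exists_extLine_extension hf hc
  obtain ⟨B', hB'⟩ := exists_extLine_extension (f := fun x => star (f' x)) hf'.star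
    (hc'.comp_left (star_zero ℂ))
  obtain ⟨k, hk⟩ := exists_lineMul_regular_lineMul_eq_rankOne hf hc hf' hc' hB hB'
  have h1 : InnerProductSpace.rankOne ℂ (ccVec f hf hc) (star (regular g) (ccVec f' hf' hc')) =
      (lineMul B * regular k) * (lineMul B' * regular g) := by
    rw [← mul_assoc, hk]
    ext1 ξ
    rw [mul_apply_eq_comp, InnerProductSpace.rankOne_apply, InnerProductSpace.rankOne_apply,
      ContinuousLinearMap.star_eq_adjoint, ContinuousLinearMap.adjoint_inner_left]
  rw [h1]
  change _ ∈ wienerHopf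
  exact mul_mem (lineMul_mul_regular_mem B k) (lineMul_mul_regular_mem B' g)

/-! ### The isomorphism of extensions -/

instance instLocallyCompactSpaceExtLine : LocallyCompactSpace ExtLine :=
  isOpen_Ioi.locallyCompactSpace

theorem exists_extLine_infty_eq_one : ∃ f : C₀(ExtLine, ℂ), f ExtLine.infty = 1 := by
  obtain ⟨f, hf1, hf2, -⟩ := exists_continuousMap_one_of_isCompact_subset_isOpen
    (isCompact_singleton (x := ExtLine.infty)) isOpen_univ (Set.subset_univ _)
  have hc : HasCompactSupport fun x => (f x : ℂ) :=
    HasCompactSupport.comp_left (g := Complex.ofReal) hf2 Complex.ofReal_zero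
  refine ⟨⟨⟨fun x => (f x : ℂ), by fun_prop⟩, hc.is_zero_at_infty⟩, ?_⟩
  change ((f ExtLine.infty : ℝ) : ℂ) = 1
  rw [hf1 (Set.mem_singleton _)]
  simp

section Extension

variable {σ : toeplitzAlgebra →⋆ₐ[ℂ] C(Circle, ℂ)} {F : C₀(ℝ, ℂ) ≃⋆ₐ[ℂ] GroupCStar}

theorem isCompactOperator_symm_lineMul_regular_sub (hF : ExtendsFourier F)
    (f : C₀(ExtLine, ℂ)) (h : circleC0) :
    IsCompactOperator (adUW.symm (lineMul f * regular (F (compCayley h))) -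
      compression (f ExtLine.infty • h : circleC0)) := by
  rw [← isCompactOperator_adUW_iff, map_sub, StarAlgEquiv.apply_symm_apply]
  exact isCompactOperator_lineMul_regular_sub hF f h

/-- Modulo compacts, the transform of `P M(h) P` is `M(f) λ(F(h ∘ w))` for any `f` with `f(+∞) = 1`,
and conversely every generator comes from some `f(+∞) P M(h) P`. Both algebras are closed and
contain the compacts. -/
theorem map_uncompressed (hσ : IsToeplitzSymbol σ) (hF : ExtendsFourier F) :
    (uncompressed σ).map adUW = wienerHopf := by
  apply le_antisymm
  · rintro _ ⟨B, hB, rfl⟩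
    obtain ⟨h, hh⟩ := (mem_uncompressed_iff hσ).1 hB
    obtain ⟨f, hf⟩ := exists_extLine_infty_eq_one
    have h1 := isCompactOperator_lineMul_regular_sub hF f h
    rw [hf, one_smul] at h1
    have h2 : adUW B = lineMul f * regular (F (compCayley h)) +
        (adUW (B - compression h) -
          (lineMul f * regular (F (compCayley h)) - adUW (compression h))) := by
      rw [map_sub]
      abel
    change adUW B ∈ wienerHopf
    rw [h2]
    exact add_mem (lineMul_mul_regular_mem _ _) (compactOps_le_wienerHopf
      (compact_sub ((isCompactOperator_adUW_iff _).2 hh) h1))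
  · refine NonUnitalStarSubalgebra.topologicalClosure_minimal _
      (NonUnitalStarAlgebra.adjoin_le ?_) ?_
    · rintro _ ⟨f, g, rfl⟩
      obtain ⟨b, rfl⟩ := EquivLike.surjective F g
      obtain ⟨h, rfl⟩ := compCayley_surjective b
      refine ⟨adUW.symm (lineMul f * regular (F (compCayley h))), ?_,
        adUW.apply_symm_apply _⟩
      exact (mem_uncompressed_iff hσ).2
        ⟨f ExtLine.infty • h, isCompactOperator_symm_lineMul_regular_sub hF f h⟩
    · have hc : Continuous adUW.symm :=
        continuous_nonUnitalStarAlgHom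
          (adUW.symm : (L2Real →L[ℂ] L2Real) →⋆ₙₐ[ℂ] (L2Circle →L[ℂ] L2Circle))
      convert (isClosed_uncompressed hσ).preimage hc using 1
      ext A
      constructor
      · rintro ⟨B, hB, rfl⟩
        change adUW.symm (adUW B) ∈ uncompressed σ
        rw [StarAlgEquiv.symm_apply_apply]
        exact hB
      · intro hA
        exact ⟨adUW.symm A, hA, adUW.apply_symm_apply A⟩

theorem map_compactOps : (compactOps L2Circle).map adUW = compactOps L2Real := by
  ext A
  constructor
  · rintro ⟨B, hB, rfl⟩
    exact (isCompactOperator_adUW_iff B).2 hB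
  · intro hA
    refine ⟨adUW.symm A, (isCompactOperator_adUW_iff _).1 ?_, adUW.apply_symm_apply A⟩
    rw [StarAlgEquiv.apply_symm_apply]
    exact hA

theorem exists_uncompressed (h : (uncompressed σ).map adUW = wienerHopf) (A : wienerHopf) :
    ∃ B : uncompressed σ, (A : L2Real →L[ℂ] L2Real) = adUW (B : L2Circle →L[ℂ] L2Circle) := by
  obtain ⟨B, hB, hBA⟩ : (A : L2Real →L[ℂ] L2Real) ∈ (uncompressed σ).map adUW := h.ge A.2
  exact ⟨⟨B, hB⟩, hBA.symm⟩

theorem exists_wienerHopf (h : (uncompressed σ).map adUW = wienerHopf) (B : uncompressed σ) :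
    ∃ A : wienerHopf, (A : L2Real →L[ℂ] L2Real) = adUW (B : L2Circle →L[ℂ] L2Circle) :=
  ⟨⟨adUW B, h.le ⟨B, B.2, rfl⟩⟩, rfl⟩

/-- The map `f ↦ f ∘ w` from `C₀(S¹)` to `C₀(ℝ)`. -/
def compCayleyHom : circleC0 →⋆ₙₐ[ℂ] C₀(ℝ, ℂ) where
  toFun := compCayley
  map_smul' _ _ := rfl
  map_zero' := rfl
  map_add' _ _ := rfl
  map_mul' _ _ := rfl
  map_star' _ := rfl

variable {σbar : uncompressed σ →⋆ₙₐ[ℂ] circleC0}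

/-- Inverting `Ad_U ∘ Ad_W` on the Wiener–Hopf algebra leaves no choice: the map is that inverse
followed by `σbar`, composition with `w`, and `F`. -/
theorem existsUnique_intertwines (h : (uncompressed σ).map adUW = wienerHopf) :
    ∃! σR : wienerHopf →⋆ₙₐ[ℂ] GroupCStar, Intertwines σbar F σR := by
  choose s hs using exists_uncompressed h
  have hsu : ∀ (A : wienerHopf) (B : uncompressed σ),
      (A : L2Real →L[ℂ] L2Real) = adUW (B : L2Circle →L[ℂ] L2Circle) → s A = B := by
    intro A B hAB
    exact Subtype.ext (EquivLike.injective adUW ((hs A).symm.trans hAB))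
  let sHom : wienerHopf →⋆ₙₐ[ℂ] uncompressed σ :=
    { toFun := s
      map_smul' := fun c A => hsu _ _ (by
        change c • (A : L2Real →L[ℂ] L2Real) = adUW (c • (s A : L2Circle →L[ℂ] L2Circle))
        rw [map_smul, ← hs])
      map_zero' := hsu _ _ (map_zero adUW).symm
      map_add' := fun A A' => hsu _ _ (by
        change (A : L2Real →L[ℂ] L2Real) + A' = adUW ((s A : L2Circle →L[ℂ] L2Circle) + s A')
        rw [map_add, ← hs, ← hs])
      map_mul' := fun A A' => hsu _ _ (by
        change (A : L2Real →L[ℂ] L2Real) * A' = adUW ((s A : L2Circle →L[ℂ] L2Circle) * s A')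
        rw [map_mul, ← hs, ← hs])
      map_star' := fun A => hsu _ _ (by
        change star (A : L2Real →L[ℂ] L2Real) = adUW (star (s A : L2Circle →L[ℂ] L2Circle))
        rw [map_star, ← hs]) }
  refine ⟨(F : C₀(ℝ, ℂ) →⋆ₙₐ[ℂ] GroupCStar).comp ((compCayleyHom.comp σbar).comp sHom),
    fun B A hAB => ?_, fun σR hσR => ?_⟩
  · change F (compCayley (σbar (s A))) = _
    rw [hsu A B hAB]
  · ext A
    exact hσR (s A) A (hs A)

variable {σR : wienerHopf →⋆ₙₐ[ℂ] GroupCStar}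

theorem Intertwines.eq_zero_iff (h : (uncompressed σ).map adUW = wienerHopf)
    (hσbar : IsUncompressedSymbol σ σbar) (hσR : Intertwines σbar F σR) (A : wienerHopf) :
    σR A = 0 ↔ (A : L2Real →L[ℂ] L2Real) ∈ compactOps L2Real := by
  obtain ⟨B, hB⟩ := exists_uncompressed h A
  rw [hσR B A hB, hB]
  refine Iff.trans ?_ ((hσbar.2 B).trans (isCompactOperator_adUW_iff _).symm)
  rw [EmbeddingLike.map_eq_zero_iff]
  exact ⟨fun h0 => compCayley_injective h0, fun h0 => by rw [h0]; rfl⟩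

theorem Intertwines.surjective (h : (uncompressed σ).map adUW = wienerHopf)
    (hσbar : Function.Surjective σbar) (hσR : Intertwines σbar F σR) :
    Function.Surjective σR := by
  intro g
  obtain ⟨b, rfl⟩ := EquivLike.surjective F g
  obtain ⟨f, rfl⟩ := compCayley_surjective b
  obtain ⟨B, rfl⟩ := hσbar f
  obtain ⟨A, hA⟩ := exists_wienerHopf h B
  exact ⟨A, hσR B A hA⟩

/-- With `g = F(h ∘ w)`, the preimage of `M(f) λ(g)` agrees modulo compacts with the compression of
`f(+∞) h`, which is therefore its symbol. -/
theorem Intertwines.apply_mulConv (hσ : IsToeplitzSymbol σ) (hF : ExtendsFourier F)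
    (hσbar : IsUncompressedSymbol σ σbar) (hσR : Intertwines σbar F σR)
    (f : C₀(ExtLine, ℂ)) (g : GroupCStar) :
    σR (mulConv f g) = f ExtLine.infty • g := by
  obtain ⟨B, hB⟩ := exists_uncompressed (map_uncompressed hσ hF) (mulConv f g)
  obtain ⟨b, rfl⟩ := EquivLike.surjective F g
  obtain ⟨h, rfl⟩ := compCayley_surjective b
  have h1 := isCompactOperator_symm_lineMul_regular_sub hF f h
  have h2 : adUW.symm (lineMul f * regular (F (compCayley h))) = B := by
    rw [← StarAlgEquiv.symm_apply_apply adUW (B : L2Circle →L[ℂ] L2Circle), ← hB]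
    rfl
  rw [h2] at h1
  rw [hσR B _ hB, hσbar.apply_eq hσ B _ h1, ← map_smul]
  rfl

end Extension

end WienerHopf

end

theorem mainTheorem9 :
    (∃! σ : toeplitzAlgebra →⋆ₐ[ℂ] C(Circle, ℂ), IsToeplitzSymbol σ) ∧
    (∃! F : C₀(ℝ, ℂ) ≃⋆ₐ[ℂ] GroupCStar, ExtendsFourier F) ∧
    ∀ σ : toeplitzAlgebra →⋆ₐ[ℂ] C(Circle, ℂ), IsToeplitzSymbol σ →
    ∀ F : C₀(ℝ, ℂ) ≃⋆ₐ[ℂ] GroupCStar, ExtendsFourier F →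
      (uncompressed σ).map adUW = wienerHopf ∧
      (compactOps L2Circle).map adUW = compactOps L2Real ∧
      (∃! σbar : uncompressed σ →⋆ₙₐ[ℂ] circleC0, IsUncompressedSymbol σ σbar) ∧
      ∀ σbar : uncompressed σ →⋆ₙₐ[ℂ] circleC0, IsUncompressedSymbol σ σbar →
        Function.Surjective σbar ∧
        (∃! σR : wienerHopf →⋆ₙₐ[ℂ] GroupCStar, Intertwines σbar F σR) ∧
        ∀ σR : wienerHopf →⋆ₙₐ[ℂ] GroupCStar, Intertwines σbar F σR →
          (compactOps L2Real ≤ wienerHopf ∧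
            (∀ A, σR A = 0 ↔ (A : L2Real →L[ℂ] L2Real) ∈ compactOps L2Real) ∧
            Function.Surjective σR) ∧
          ∀ (f : C₀(ExtLine, ℂ)) (g : GroupCStar),
            σR (mulConv f g) = f ExtLine.infty • g := by
  refine ⟨existsUnique_isToeplitzSymbol, existsUnique_extendsFourier, fun σ hσ F hF => ?_⟩
  have hmap := map_uncompressed hσ hF
  refine ⟨hmap, map_compactOps, existsUnique_isUncompressedSymbol hσ, fun σbar hσbar => ?_⟩
  have hsurj := hσbar.surjective hσ
  exact ⟨hsurj, existsUnique_intertwines hmap, fun σR hσR =>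
    ⟨⟨compactOps_le_wienerHopf, hσR.eq_zero_iff hmap hσbar, hσR.surjective hmap hsurj⟩,
      hσR.apply_mulConv hσ hF hσbar⟩⟩
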